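/- **Definitions.** Let $\mathrm{MHS}_1$ be the category of graded polarizable mixed Hodge structures of level $\le 1$: finitely generated abelian groups $H_{\mathbb Z}$ (torsion allowed) with a weight filtration $0\subseteq W_{-2}\subseteq W_{-1}\subseteq W_0=H_{\mathbb Q}$ and a Hodge filtration $0=F^1\subseteq F^0\subseteq F^{-1}=H_{\mathbb C}$ such that $\mathrm{gr}^W_{-2}$ is of type $(-1,-1)$, $\mathrm{gr}^W_{-1}$ is a polarizable pure Hodge structure of types $(-1,0),(0,-1)$, and $\mathrm{gr}^W_0$ is of type $(0,0)$. Morphisms are the group homomorphisms respecting both filtrations. A commutative formal group over $\mathbb C$ is a left exact functor $H$ from finite-dimensional commutative $\mathbb C$-algebras to abelian groups; we require that $H_{\mathbb Z}:=H(\mathbb C)$ (the group underlying the étale part of $H=H^0\times H_{\mathbb Z}$) is finitely generated and that $\mathrm{Lie}\,H=\ker(H(\mathbb C[\varepsilon])\to H(\mathbb C))$ is finite-dimensional. Morphisms are homomorphisms of group functors. A complex vector space $V$ is regarded as the group functor $R\mapsto R\otimes_{\mathbb C}V$. A formal Hodge structure $(H,V)$ of level $\le 1$ consists of a commutative formal group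 $H$ together with a structure $H_{\mathrm{et}}\in\mathrm{MHS}_1$ on $H_{\mathbb Z}$; a finite-dimensional $\mathbb C$-vector space $V$ with subspaces $V^0\subseteq V^1\subseteq V$; a homomorphism of group functors $v:H\to V$; and a $\mathbb C$-linear isomorphism $\sigma:H_{\mathbb C}/F^0\to V/V^0$ restricting to an isomorphism $W_{-2}H_{\mathbb C}\cong V^1/V^0$, such that $\sigma\circ c=\mathrm{pr}\circ v_{\mathbb Z}$, where $c:H_{\mathbb Z}\to H_{\mathbb C}/F^0$ and $\mathrm{pr}:V\to V/V^0$ are the canonical maps and $v_{\mathbb Z}:H_{\mathbb Z}\to V$ is the map induced by $v$ on $\mathbb C$-points. A morphism $(H,V)\to(H',V')$ is a pair $(f,g)$ of a homomorphism of formal groups $f:H\to H'$ whose étale part $f_{\mathrm{et}}:H_{\mathrm{et}}\to H'_{\mathrm{et}}$ is a morphism in $\mathrm{MHS}_1$ and a $\mathbb C$-linear map $g:V\to V'$ with $g(V^i)\subseteq V'^i$ for $i=0,1$, such that $v'f=gv$ and $\sigma'\bar f=\bar g\sigma$ for the induced maps $\bar f:H_{\mathbb C}/F^0\to H'_{\mathbb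 C}/F^0$ and $\bar g:V/V^0\to V'/V'^0$. Let $\mathrm{FHS}_1$ be the resulting category. **Proposition.** The category $\mathrm{FHS}_1$ is abelian. Moreover, a sequence $$0\to (H,V)\to (H',V')\to (H'',V'')\to 0$$ in $\mathrm{FHS}_1$ in which the composite of the two middle morphisms is zero is short exact if and only if all of the following hold: 1. $0\to H\to H'\to H''\to 0$ is a short exact sequence of commutative formal groups; 2. $0\to V\to V'\to V''\to 0$ is a short exact sequence of filtered vector spaces, i.e. it and the sequences $0\to V^i\to V'^i\to V''^i\to 0$ for $i=0,1$ are exact; 3. $0\to H_{\mathrm{et}}\to H'_{\mathrm{et}}\to H''_{\mathrm{et}}\to 0$ is a short exact sequence in $\mathrm{MHS}_1$. -/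

import Mathlib

open CategoryTheory CategoryTheory.Limits
open scoped TensorProduct

noncomputable section

namespace FormalHodge

/-! ## Mixed Hodge structures of level at most one -/

section LinearAlgebra

variable (A : Type) [AddCommGroup A]

/-- The canonical map `A ⊗ ℚ → A ⊗ ℂ`. -/
def ratToComplex : (ℚ ⊗[ℤ] A) →ₗ[ℤ] (ℂ ⊗[ℤ] A) :=
  LinearMap.rTensor A (algebraMap ℚ ℂ).toAddMonoidHom.toIntLinearMap

/-- The complexification `W ⊗ ℂ ⊆ A ⊗ ℂ` of a rational subspace `W ⊆ A ⊗ ℚ`. -/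
def complexify {A : Type} [AddCommGroup A] (W : Submodule ℚ (ℚ ⊗[ℤ] A)) :
    Submodule ℂ (ℂ ⊗[ℤ] A) :=
  Submodule.span ℂ (ratToComplex A '' (W : Set (ℚ ⊗[ℤ] A)))

/-- Complex conjugation on `A ⊗ ℂ` (conjugation on `ℂ`, identity on `A`), as a `ℤ`-linear map. -/
def conjInt : (ℂ ⊗[ℤ] A) →ₗ[ℤ] (ℂ ⊗[ℤ] A) :=
  LinearMap.rTensor A (starRingEnd ℂ).toAddMonoidHom.toIntLinearMap

theorem conjInt_smul (c : ℂ) (x : ℂ ⊗[ℤ] A) :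
    conjInt A (c • x) = (starRingEnd ℂ c) • conjInt A x := by
  induction x using TensorProduct.induction_on with
  | zero => simp
  | tmul z a =>
    exact congrArg (· ⊗ₜ[ℤ] a) (map_mul (starRingEnd ℂ) c z)
  | add x y hx hy => rw [smul_add, map_add, hx, hy, map_add, smul_add]

/-- Complex conjugation on `A ⊗ ℂ`, as a conjugate-linear map. -/
def conj : (ℂ ⊗[ℤ] A) →ₛₗ[starRingEnd ℂ] (ℂ ⊗[ℤ] A) where
  toFun := conjInt A
  map_add' := map_add (conjInt A)
  map_smul' := conjInt_smul A

/-- The complex conjugate of a complex subspace of `A ⊗ ℂ` (conjugation is an involution, so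
preimages under conjugation are images). -/
def conjSub {A : Type} [AddCommGroup A] (F : Submodule ℂ (ℂ ⊗[ℤ] A)) :
    Submodule ℂ (ℂ ⊗[ℤ] A) :=
  F.comap (conj A)

variable {A} {B : Type} [AddCommGroup B]

/-- `f ⊗ ℚ`. -/
def mapQ (f : A →+ B) : (ℚ ⊗[ℤ] A) →ₗ[ℚ] (ℚ ⊗[ℤ] B) :=
  LinearMap.baseChange ℚ f.toIntLinearMap

/-- `f ⊗ ℂ`. -/
def mapC (f : A →+ B) : (ℂ ⊗[ℤ] A) →ₗ[ℂ] (ℂ ⊗[ℤ] B) :=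
  LinearMap.baseChange ℂ f.toIntLinearMap

end LinearAlgebra

/-- A graded polarizable mixed Hodge structure of level `≤ 1` on a (finitely generated) abelian
group `A`, i.e. one whose Hodge types lie in `{(0,0), (0,-1), (-1,0), (-1,-1)}`.
The weight filtration is `0 ⊆ W₋₂ ⊆ W₋₁ ⊆ W₀ = A ⊗ ℚ` and the Hodge filtration is
`0 = F¹ ⊆ F⁰ ⊆ F⁻¹ = A ⊗ ℂ`. -/
structure LevelOneMHS (A : Type) [AddCommGroup A] where
  /-- `W₋₂` -/
  W₂ : Submodule ℚ (ℚ ⊗[ℤ] A)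
  /-- `W₋₁` -/
  W₁ : Submodule ℚ (ℚ ⊗[ℤ] A)
  /-- `F⁰` -/
  F₀ : Submodule ℂ (ℂ ⊗[ℤ] A)
  W₂_le_W₁ : W₂ ≤ W₁
  /-- `gr₋₂` is purely of type `(-1,-1)`: the filtration induced by `F` has `F⁰ gr₋₂ = 0`. -/
  gr_two : F₀ ⊓ complexify W₂ = ⊥
  /-- `gr₋₁` is a pure Hodge structure of weight `-1`, that is,
  `F⁰ gr₋₁ ⊕ conj (F⁰ gr₋₁) = gr₋₁`. This is written for the inverse images
  in `W₋₁ ⊗ ℂ` of these subspaces of `gr₋₁ ⊗ ℂ = (W₋₁ ⊗ ℂ) / (W₋₂ ⊗ ℂ)`; first the sum. -/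
  gr_one_sup : ((F₀ ⊓ complexify W₁) ⊔ complexify W₂) ⊔
    conjSub ((F₀ ⊓ complexify W₁) ⊔ complexify W₂) = complexify W₁
  /-- ... and the intersection is zero in `gr₋₁`. -/
  gr_one_inf : ((F₀ ⊓ complexify W₁) ⊔ complexify W₂) ⊓
    conjSub ((F₀ ⊓ complexify W₁) ⊔ complexify W₂) = complexify W₂
  /-- `gr₀` is purely of type `(0,0)`: the filtration induced by `F` has `F⁰ gr₀ = gr₀`. -/
  gr_zero : F₀ ⊔ complexify W₁ = ⊤
  /-- `gr₋₁` is polarizable: there is a rational alternating form `Ψ` which on `W₋₁` has `W₋₂` in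
  its radical (so that it induces a form on `gr₋₁`) and which satisfies the Riemann relations on
  `F⁰ gr₋₁`, of which `F⁰ ∩ (W₋₁ ⊗ ℂ)` is an isomorphic lift because `F⁰ gr₋₂ = 0`.
  Only the restriction of `Ψ` to `W₋₁` matters, and every rational alternating form on `gr₋₁`
  arises in this way. (The pieces `gr₋₂` and `gr₀` are always polarizable.) -/
  polarizable : ∃ Ψ : LinearMap.BilinForm ℂ (ℂ ⊗[ℤ] A),
    (∀ a b : A, ∃ q : ℚ, Ψ (1 ⊗ₜ[ℤ] a) (1 ⊗ₜ[ℤ] b) = (q : ℂ)) ∧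
    Ψ.IsAlt ∧
    (∀ x ∈ complexify W₂, ∀ y ∈ complexify W₁, Ψ x y = 0) ∧
    (∀ x ∈ F₀ ⊓ complexify W₁, ∀ y ∈ F₀ ⊓ complexify W₁, Ψ x y = 0) ∧
    (∀ x ∈ F₀ ⊓ complexify W₁, x ≠ 0 → 0 < (Complex.I * Ψ x (conj A x)).re)

/-- A group homomorphism is a morphism of mixed Hodge structures if it respects the weight
and Hodge filtrations. -/
structure LevelOneMHS.IsHom {A B : Type} [AddCommGroup A] [AddCommGroup B]
    (S : LevelOneMHS A) (T : LevelOneMHS B) (f : A →+ B) : Prop where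
  W₂ : S.W₂ ≤ T.W₂.comap (mapQ f)
  W₁ : S.W₁ ≤ T.W₁.comap (mapQ f)
  F₀ : S.F₀ ≤ T.F₀.comap (mapC f)

section HomLemmas

variable {A B D : Type} [AddCommGroup A] [AddCommGroup B] [AddCommGroup D]

theorem mapQ_id : mapQ (AddMonoidHom.id A) = LinearMap.id :=
  LinearMap.baseChange_id

theorem mapC_id : mapC (AddMonoidHom.id A) = LinearMap.id :=
  LinearMap.baseChange_id

theorem mapQ_comp (g : B →+ D) (f : A →+ B) : mapQ (g.comp f) = mapQ g ∘ₗ mapQ f :=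
  LinearMap.baseChange_comp (A := ℚ) f.toIntLinearMap g.toIntLinearMap

theorem mapC_comp (g : B →+ D) (f : A →+ B) : mapC (g.comp f) = mapC g ∘ₗ mapC f :=
  LinearMap.baseChange_comp (A := ℂ) f.toIntLinearMap g.toIntLinearMap

theorem mapQ_zero : mapQ (0 : A →+ B) = 0 :=
  LinearMap.baseChange_zero

theorem mapC_zero : mapC (0 : A →+ B) = 0 :=
  LinearMap.baseChange_zero

theorem LevelOneMHS.IsHom.id (S : LevelOneMHS A) : S.IsHom S (AddMonoidHom.id A) where
  W₂ := by rw [mapQ_id]; exact le_rfl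
  W₁ := by rw [mapQ_id]; exact le_rfl
  F₀ := by rw [mapC_id]; exact le_rfl

theorem LevelOneMHS.IsHom.comp {S : LevelOneMHS A} {T : LevelOneMHS B} {U : LevelOneMHS D}
    {f : A →+ B} {g : B →+ D} (hf : S.IsHom T f) (hg : T.IsHom U g) : S.IsHom U (g.comp f) where
  W₂ := by rw [mapQ_comp]; exact fun x hx => hg.W₂ (hf.W₂ hx)
  W₁ := by rw [mapQ_comp]; exact fun x hx => hg.W₁ (hf.W₁ hx)
  F₀ := by rw [mapC_comp]; exact fun x hx => hg.F₀ (hf.F₀ hx)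

theorem LevelOneMHS.IsHom.zero (S : LevelOneMHS A) (T : LevelOneMHS B) :
    S.IsHom T (0 : A →+ B) where
  W₂ := by rw [mapQ_zero]; exact fun x _ => T.W₂.zero_mem
  W₁ := by rw [mapQ_zero]; exact fun x _ => T.W₁.zero_mem
  F₀ := by rw [mapC_zero]; exact fun x _ => T.F₀.zero_mem

end HomLemmas

/-- Objects of `MHS₁`: finitely generated abelian groups with a graded polarizable mixed Hodge
structure of level `≤ 1` (torsion is allowed). -/
structure MHS₁ : Type 1 where
  carrier : Type
  [group : AddCommGroup carrier]
  [fg : Module.Finite ℤ carrier]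
  str : LevelOneMHS carrier

attribute [instance] MHS₁.group MHS₁.fg

namespace MHS₁

/-- Morphisms of `MHS₁`. -/
@[ext]
structure Hom (X Y : MHS₁) where
  hom : X.carrier →+ Y.carrier
  isHom : X.str.IsHom Y.str hom

instance : Category MHS₁ where
  Hom := Hom
  id _ := ⟨AddMonoidHom.id _, LevelOneMHS.IsHom.id _⟩
  comp f g := ⟨g.hom.comp f.hom, f.isHom.comp g.isHom⟩

instance : HasZeroMorphisms MHS₁ where
  zero _ _ := ⟨⟨0, LevelOneMHS.IsHom.zero _ _⟩⟩
  comp_zero f _ := Hom.ext (AddMonoidHom.zero_comp f.hom)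
  zero_comp _ {_ _} f := Hom.ext (AddMonoidHom.comp_zero f.hom)

end MHS₁

/-! ## Commutative formal groups over `ℂ` -/

/-- The category of finite-dimensional commutative `ℂ`-algebras. -/
abbrev FinAlg : Type 1 :=
  ObjectProperty.FullSubcategory (C := CommAlgCat.{0} ℂ) (fun R => Module.Finite ℂ R)

namespace FinAlg

/-- The finite-dimensional algebra `R` as an object of `FinAlg`. -/
abbrev of (R : Type) [CommRing R] [Algebra ℂ R] [h : Module.Finite ℂ R] : FinAlg :=
  ⟨CommAlgCat.of ℂ R, h⟩

/-- An algebra homomorphism as a morphism of `FinAlg`. -/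
abbrev ofHom {R S : Type} [CommRing R] [Algebra ℂ R] [Module.Finite ℂ R]
    [CommRing S] [Algebra ℂ S] [Module.Finite ℂ S] (φ : R →ₐ[ℂ] S) : of R ⟶ of S :=
  ObjectProperty.homMk (CommAlgCat.ofHom φ)

/-- The algebra `ℂ`. -/
abbrev point : FinAlg := of ℂ

instance : Module.Finite ℂ (DualNumber ℂ) :=
  inferInstanceAs (Module.Finite ℂ (ℂ × ℂ))

/-- The algebra `ℂ[ε]` of dual numbers. -/
abbrev dual : FinAlg := of (DualNumber ℂ)

/-- The homomorphism `ℂ[ε] → ℂ`, `ε ↦ 0`. -/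
def dualToPoint : dual ⟶ point := ofHom (TrivSqZeroExt.fstHom ℂ ℂ ℂ)

/-- The homomorphism `ℂ[ε] → ℂ[ε]`, `ε ↦ c ε`. -/
def dualScale (c : ℂ) : dual ⟶ dual :=
  ofHom (TrivSqZeroExt.map (c • (LinearMap.id : ℂ →ₗ[ℂ] ℂ)))

end FinAlg

/-- A commutative formal group over `ℂ` is a commutative group object in formal schemes over `ℂ`,
that is, a left exact functor from finite-dimensional commutative `ℂ`-algebras to abelian groups.
As in Hodge theory of level `≤ 1`, the étale part, which over the algebraically closed field `ℂ` is
the constant formal group with group `H(ℂ)`, is required to be finitely generated, and the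
connected part `H⁰(R) = ker (H(R) → H(R_red))` is required to be finite-dimensional,
that is, `Lie H = ker (H(ℂ[ε]) → H(ℂ))`, on which `c ∈ ℂ` acts through `ε ↦ c ε`, is spanned by
finitely many elements. -/
structure IsFormalGroup (H : FinAlg ⥤ AddCommGrpCat.{0}) : Prop where
  leftExact : PreservesFiniteLimits H
  etale_fg : Module.Finite ℤ (H.obj FinAlg.point)
  lie_fin : ∃ (n : ℕ) (t : Fin n → H.obj FinAlg.dual),
    (∀ i, (H.map FinAlg.dualToPoint).hom (t i) = 0) ∧
    ∀ x : H.obj FinAlg.dual, (H.map FinAlg.dualToPoint).hom x = 0 →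
      ∃ c : Fin n → ℂ, x = ∑ i, (H.map (FinAlg.dualScale (c i))).hom (t i)

/-- The category of commutative formal groups over `ℂ`; morphisms are homomorphisms of group
functors. -/
abbrev FormalGroup : Type 1 :=
  ObjectProperty.FullSubcategory (C := FinAlg ⥤ AddCommGrpCat.{0}) IsFormalGroup

namespace FormalGroup

/-- The group `H_ℤ = H(ℂ)` underlying the étale part of a formal group. -/
abbrev etalePart (H : FormalGroup) : Type := H.obj.obj FinAlg.point

instance (H : FormalGroup) : Module.Finite ℤ H.etalePart := H.property.etale_fg

/-- The homomorphism of étale parts induced by a homomorphism of formal groups. -/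
abbrev etaleMap {H H' : FormalGroup} (f : H ⟶ H') : H.etalePart →+ H'.etalePart :=
  (f.hom.app FinAlg.point).hom

end FormalGroup

/-- A complex vector space `V` as a group functor: `R ↦ R ⊗ V`. -/
def vectorGroup (V : Type) [AddCommGroup V] [Module ℂ V] : FinAlg ⥤ AddCommGrpCat.{0} where
  obj R := AddCommGrpCat.of (R.obj ⊗[ℂ] V)
  map φ := AddCommGrpCat.ofHom (LinearMap.rTensor V φ.hom.hom.toLinearMap).toAddMonoidHom
  map_id R := by
    ext x
    exact LinearMap.rTensor_id_apply V _ x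
  map_comp φ ψ := by
    ext x
    exact LinearMap.rTensor_comp_apply V ψ.hom.hom.toLinearMap φ.hom.hom.toLinearMap x

/-- The homomorphism of group functors induced by a linear map. -/
def vectorGroupMap {V V' : Type} [AddCommGroup V] [Module ℂ V] [AddCommGroup V'] [Module ℂ V']
    (g : V →ₗ[ℂ] V') : vectorGroup V ⟶ vectorGroup V' where
  app R := AddCommGrpCat.ofHom (LinearMap.lTensor R.obj g).toAddMonoidHom
  naturality R S φ := by
    ext x
    exact (LinearMap.congr_fun (LinearMap.lTensor_comp_rTensor R.obj φ.hom.hom.toLinearMap g) x).trans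
      (LinearMap.congr_fun (LinearMap.rTensor_comp_lTensor R.obj φ.hom.hom.toLinearMap g) x).symm

theorem vectorGroupMap_id (V : Type) [AddCommGroup V] [Module ℂ V] :
    vectorGroupMap (LinearMap.id : V →ₗ[ℂ] V) = 𝟙 (vectorGroup V) := by
  ext R x
  exact LinearMap.lTensor_id_apply _ _ x

theorem vectorGroupMap_comp {V V' V'' : Type} [AddCommGroup V] [Module ℂ V]
    [AddCommGroup V'] [Module ℂ V'] [AddCommGroup V''] [Module ℂ V'']
    (g' : V' →ₗ[ℂ] V'') (g : V →ₗ[ℂ] V') :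
    vectorGroupMap (g' ∘ₗ g) = vectorGroupMap g ≫ vectorGroupMap g' := by
  ext R x
  exact LinearMap.lTensor_comp_apply _ g' g x

theorem vectorGroupMap_zero (V V' : Type) [AddCommGroup V] [Module ℂ V]
    [AddCommGroup V'] [Module ℂ V'] :
    vectorGroupMap (0 : V →ₗ[ℂ] V') = 0 := by
  ext R x
  exact LinearMap.congr_fun (LinearMap.lTensor_zero R.obj) x

/-- The map `v_ℤ : H_ℤ → V` induced by a homomorphism of group functors `v : H → V`, namely its
value on `ℂ`-points, with `V(ℂ) = ℂ ⊗ V = V`. -/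
def etaleValue {H : FormalGroup} {V : Type} [AddCommGroup V] [Module ℂ V]
    (v : H.obj ⟶ vectorGroup V) : H.etalePart →+ V :=
  (TensorProduct.lid ℂ V).toLinearMap.toAddMonoidHom.comp (v.app FinAlg.point).hom

/-! ## Formal Hodge structures -/

/-- Formal Hodge structures `(H, V)` of level `≤ 1`. -/
structure FHS₁ : Type 1 where
  /-- the formal group -/
  H : FormalGroup
  /-- the mixed Hodge structure of level `≤ 1` on the étale part -/
  mhs : LevelOneMHS H.etalePart
  V : Type
  [groupV : AddCommGroup V]
  [moduleV : Module ℂ V]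
  [finiteV : FiniteDimensional ℂ V]
  V₀ : Submodule ℂ V
  V₁ : Submodule ℂ V
  V₀_le_V₁ : V₀ ≤ V₁
  /-- the group homomorphism `v : H → V` -/
  v : H.obj ⟶ vectorGroup V
  /-- the isomorphism `σ : H_ℂ / F⁰ ≃ V / V⁰` -/
  σ : ((ℂ ⊗[ℤ] H.etalePart) ⧸ mhs.F₀) ≃ₗ[ℂ] (V ⧸ V₀)
  /-- `σ` restricts to an isomorphism of `W₋₂ H_ℂ` (which injects into `H_ℂ / F⁰`)
  with `V¹ / V⁰`. -/
  σ_W₂ : ((complexify mhs.W₂).map mhs.F₀.mkQ).map σ.toLinearMap = V₁.map V₀.mkQ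
  /-- `σ ∘ c = pr ∘ v_ℤ` -/
  σ_comm : ∀ h : H.etalePart, σ (mhs.F₀.mkQ (1 ⊗ₜ[ℤ] h)) = V₀.mkQ (etaleValue v h)

attribute [instance] FHS₁.groupV FHS₁.moduleV FHS₁.finiteV

namespace FHS₁

/-- Morphisms of formal Hodge structures. -/
@[ext]
structure Hom (X Y : FHS₁) where
  f : X.H ⟶ Y.H
  g : X.V →ₗ[ℂ] Y.V
  /-- `f_et` is a morphism in `MHS₁`. -/
  isHom : X.mhs.IsHom Y.mhs (FormalGroup.etaleMap f)
  map_V₀ : X.V₀ ≤ Y.V₀.comap g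
  map_V₁ : X.V₁ ≤ Y.V₁.comap g
  /-- The square formed by `f`, `g`, `v` and `v'` commutes. -/
  comm : f.hom ≫ Y.v = X.v ≫ vectorGroupMap g
  /-- The square formed by the induced maps on `H_ℂ / F⁰` and `V / V⁰` and by `σ` and `σ'`
  commutes. -/
  comm_σ : ∀ z : (ℂ ⊗[ℤ] X.H.etalePart) ⧸ X.mhs.F₀,
    Y.σ (X.mhs.F₀.mapQ Y.mhs.F₀ (mapC (FormalGroup.etaleMap f)) isHom.F₀ z) =
      X.V₀.mapQ Y.V₀ g map_V₀ (X.σ z)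

/-- The identity morphism. -/
def Hom.id (X : FHS₁) : Hom X X where
  f := 𝟙 X.H
  g := LinearMap.id
  isHom := LevelOneMHS.IsHom.id _
  map_V₀ := le_rfl
  map_V₁ := le_rfl
  comm := by
    rw [vectorGroupMap_id]
    exact (Category.id_comp _).trans (Category.comp_id _).symm
  comm_σ z := by
    have e : mapC (FormalGroup.etaleMap (𝟙 X.H)) = LinearMap.id := mapC_id
    simp only [e, Submodule.mapQ_id, LinearMap.id_apply]

/-- Composition of morphisms. -/
def Hom.comp {X Y Z : FHS₁} (φ : Hom X Y) (ψ : Hom Y Z) : Hom X Z where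
  f := φ.f ≫ ψ.f
  g := ψ.g ∘ₗ φ.g
  isHom := φ.isHom.comp ψ.isHom
  map_V₀ := fun _ hx => ψ.map_V₀ (φ.map_V₀ hx)
  map_V₁ := fun _ hx => ψ.map_V₁ (φ.map_V₁ hx)
  comm := by
    rw [vectorGroupMap_comp, ← Category.assoc, ← φ.comm, Category.assoc, ← ψ.comm,
      ← Category.assoc]
    rfl
  comm_σ z := by
    have e : mapC (FormalGroup.etaleMap (φ.f ≫ ψ.f)) =
        mapC (FormalGroup.etaleMap ψ.f) ∘ₗ mapC (FormalGroup.etaleMap φ.f) := mapC_comp _ _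
    have h := ψ.comm_σ (X.mhs.F₀.mapQ Y.mhs.F₀ _ φ.isHom.F₀ z)
    rw [φ.comm_σ z] at h
    obtain ⟨x, rfl⟩ := Submodule.Quotient.mk_surjective _ z
    simp only [e]
    refine Eq.trans h ?_
    generalize X.σ (Submodule.Quotient.mk x) = w
    obtain ⟨w, rfl⟩ := Submodule.Quotient.mk_surjective _ w
    rfl

/-- The zero morphism. -/
def Hom.zero (X Y : FHS₁) : Hom X Y where
  f := 0
  g := 0
  isHom := LevelOneMHS.IsHom.zero _ _
  map_V₀ := fun _ _ => Y.V₀.zero_mem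
  map_V₁ := fun _ _ => Y.V₁.zero_mem
  comm := by
    rw [vectorGroupMap_zero, comp_zero]
    exact zero_comp
  comm_σ z := by
    have e : mapC (FormalGroup.etaleMap (0 : X.H ⟶ Y.H)) = 0 := mapC_zero
    simp only [e, Submodule.mapQ_zero, LinearMap.zero_apply, map_zero]

instance : Category FHS₁ where
  Hom := Hom
  id := Hom.id
  comp := Hom.comp
  id_comp φ := Hom.ext (Category.id_comp φ.f) (LinearMap.comp_id φ.g)
  comp_id φ := Hom.ext (Category.comp_id φ.f) (LinearMap.id_comp φ.g)
  assoc φ ψ χ := Hom.ext (Category.assoc φ.f ψ.f χ.f) (LinearMap.comp_assoc φ.g ψ.g χ.g).symm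

instance : HasZeroMorphisms FHS₁ where
  zero X Y := ⟨Hom.zero X Y⟩
  comp_zero φ _ := Hom.ext (comp_zero (f := φ.f)) (LinearMap.zero_comp φ.g)
  zero_comp _ {_ _} φ := Hom.ext (zero_comp (f := φ.f)) (LinearMap.comp_zero φ.g)

/-- The forgetful functor `(H, V) ↦ H` to formal groups. -/
def toFormalGroup : FHS₁ ⥤ FormalGroup where
  obj X := X.H
  map φ := φ.f

instance : toFormalGroup.PreservesZeroMorphisms where
  map_zero _ _ := rfl

/-- The functor `(H, V) ↦ H_et` to mixed Hodge structures. -/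
def toMHS : FHS₁ ⥤ MHS₁ where
  obj X := { carrier := X.H.etalePart, str := X.mhs }
  map φ := ⟨FormalGroup.etaleMap φ.f, φ.isHom⟩

instance : toMHS.PreservesZeroMorphisms where
  map_zero _ _ := rfl

end FHS₁

/-- For linear maps `V → V' → V''` and subspaces `P ⊆ V`, `P' ⊆ V'`, `P'' ⊆ V''` respected by
them: the sequence `0 → P → P' → P'' → 0` is exact. -/
structure ShortExactOn {V V' V'' : Type} [AddCommGroup V] [Module ℂ V]
    [AddCommGroup V'] [Module ℂ V'] [AddCommGroup V''] [Module ℂ V'']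
    (g : V →ₗ[ℂ] V') (g' : V' →ₗ[ℂ] V'')
    (P : Submodule ℂ V) (P' : Submodule ℂ V') (P'' : Submodule ℂ V'') : Prop where
  injective : ∀ x ∈ P, g x = 0 → x = 0
  exact : ∀ y ∈ P', g' y = 0 ↔ ∃ x ∈ P, g x = y
  surjective : ∀ z ∈ P'', ∃ y ∈ P', g' y = z

/-- The sequence `0 → (V, V⁰, V¹) → (V', V'⁰, V'¹) → (V'', V''⁰, V''¹) → 0` underlying a sequence
in `FHS₁` is exact as a sequence of filtered vector spaces: it is exact on the vector spaces and
on every step of the filtrations. -/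
structure FilteredShortExact (S : ShortComplex FHS₁) : Prop where
  total : ShortExactOn S.f.g S.g.g ⊤ ⊤ ⊤
  step₁ : ShortExactOn S.f.g S.g.g S.X₁.V₁ S.X₂.V₁ S.X₃.V₁
  step₀ : ShortExactOn S.f.g S.g.g S.X₁.V₀ S.X₂.V₀ S.X₃.V₀

end FormalHodge

end

/-! Everything rests on strictness: kernels and cokernels computed separately on the formal group
and on the vector space inherit all remaining structure, because no filtration can be lost along a
morphism.

Three inputs carry this. (1) Mixed Hodge structures. Deligne's splitting of `H_ℂ` is built from `W`,
`F` and conjugation alone, so every morphism commutes with its projections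
(`LevelOneMHS.IsHom.mapC_proj`). Strictness for `F⁰`, `W₋₁`, `W₋₂` and `F⁰ + W₋₂` follows, and
kernels and quotients acquire splittings. A polarization restricts to a kernel. For a quotient the
source's `W₋₁` is split off orthogonally: by positivity the form is nondegenerate on its image
modulo `W₋₂`, and the orthogonal complement supplies a rational section along which the form is
pulled back (`exists_isPolarization_map`).

(2) Formal groups. The only difficulty is that a pointwise cokernel of left exact functors is again
left exact. In characteristic zero a tangent vector integrates uniquely to compatible elements over
`ℂ[X]/(X^n)`, which gives an exponential on nilpotent elements. With the étale part this yields a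
natural isomorphism of `F(R)` with `(Nil(R) ⊗ Lie F) × F(ℂ)^{X(R)}`, where `X(R)` is the finite set
of points of `R` (`stdHom_bijective`). Cokernels can then be taken in `Lie F` and `F(ℂ)`, and the
resulting functor is visibly left exact (`IsLex.of_exact`). Formal groups are thus closed under
kernels, cokernels and finite products in an abelian functor category.

(3) Formal Hodge structures. The map `σ` is redundant: it is induced by the complex linear extension
`H_ℂ → V` of `v_ℤ`. What remains are the conditions that `F⁰` is the preimage of `V⁰`, that `V` is
the image of `H_ℂ` plus `V⁰`, and that `V¹` is the image of `W₋₂` plus `V⁰` (`ofCore`). These make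
morphisms strict for `V⁰` and `V¹` as well, and they pass to pointwise kernels, cokernels and
products.

Hence monomorphisms and epimorphisms are pointwise and normal, the category is abelian, and short
exactness is short exactness of `H` and of `V`. Exactness on the steps `Vⁱ` and in `MHS₁` then comes
for free from strictness. -/

open CategoryTheory CategoryTheory.Limits
open scoped TensorProduct

noncomputable section

namespace FormalHodge

/-! ### Complexification of rational subspaces, tested by rational coordinates -/

section Coordinates

variable {A B D : Type} [AddCommGroup A] [AddCommGroup B] [AddCommGroup D]

@[simp]
theorem ratToComplex_tmul (q : ℚ) (a : A) : ratToComplex A (q ⊗ₜ a) = (q : ℂ) ⊗ₜ[ℤ] a := rfl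

theorem ratToComplex_smul (q : ℚ) (x : ℚ ⊗[ℤ] A) :
    ratToComplex A (q • x) = (q : ℂ) • ratToComplex A x := by
  induction x using TensorProduct.induction_on with
  | zero => simp
  | tmul c a =>
    rw [TensorProduct.smul_tmul', ratToComplex_tmul, ratToComplex_tmul, TensorProduct.smul_tmul']
    simp
  | add x y hx hy => rw [smul_add, map_add, hx, hy, map_add, smul_add]

@[simp]
theorem mapC_tmul (f : A →+ B) (c : ℂ) (a : A) : mapC f (c ⊗ₜ a) = c ⊗ₜ f a := rfl

@[simp]
theorem mapQ_tmul (f : A →+ B) (c : ℚ) (a : A) : mapQ f (c ⊗ₜ a) = c ⊗ₜ f a := rfl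

@[simp]
theorem conj_tmul (c : ℂ) (a : A) : conj A (c ⊗ₜ a) = (starRingEnd ℂ c) ⊗ₜ a := rfl

theorem mapC_ratToComplex (f : A →+ B) (x : ℚ ⊗[ℤ] A) :
    mapC f (ratToComplex A x) = ratToComplex B (mapQ f x) := by
  induction x using TensorProduct.induction_on with
  | zero => simp
  | tmul c a => simp
  | add x y hx hy => simp only [map_add, hx, hy]

@[simp]
theorem conj_ratToComplex (x : ℚ ⊗[ℤ] A) : conj A (ratToComplex A x) = ratToComplex A x := by
  induction x using TensorProduct.induction_on with
  | zero => simp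
  | tmul c a => simp
  | add x y hx hy => simp only [map_add, hx, hy]

@[simp]
theorem conj_conj (x : ℂ ⊗[ℤ] A) : conj A (conj A x) = x := by
  induction x using TensorProduct.induction_on with
  | zero => simp
  | tmul c a => simp
  | add x y hx hy => simp only [map_add, hx, hy]

theorem mapC_conj (f : A →+ B) (x : ℂ ⊗[ℤ] A) : mapC f (conj A x) = conj B (mapC f x) := by
  induction x using TensorProduct.induction_on with
  | zero => simp
  | tmul c a => simp
  | add x y hx hy => simp only [map_add, hx, hy]

/-- The map `A ⊗ ℂ → A ⊗ ℚ` induced by a `ℚ`-linear functional on `ℂ`. -/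
def coord (A : Type) [AddCommGroup A] (l : ℂ →ₗ[ℚ] ℚ) : (ℂ ⊗[ℤ] A) →ₗ[ℤ] (ℚ ⊗[ℤ] A) :=
  LinearMap.rTensor A l.toAddMonoidHom.toIntLinearMap

@[simp]
theorem coord_tmul (l : ℂ →ₗ[ℚ] ℚ) (c : ℂ) (a : A) : coord A l (c ⊗ₜ a) = l c ⊗ₜ a := rfl

theorem coord_smul (l : ℂ →ₗ[ℚ] ℚ) (c : ℂ) (x : ℂ ⊗[ℤ] A) :
    coord A l (c • x) = coord A (l ∘ₗ LinearMap.mulLeft ℚ c) x := by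
  induction x using TensorProduct.induction_on with
  | zero => simp
  | tmul d a => simp [TensorProduct.smul_tmul']
  | add x y hx hy => simp only [map_add, smul_add, hx, hy]

theorem coord_smul_ratToComplex (l : ℂ →ₗ[ℚ] ℚ) (c : ℂ) (x : ℚ ⊗[ℤ] A) :
    coord A l (c • ratToComplex A x) = l c • x := by
  induction x using TensorProduct.induction_on with
  | zero => simp
  | tmul q a =>
    have h : l (c * q) = l c * q := by
      rw [mul_comm, ← Rat.smul_def, map_smul, smul_eq_mul, mul_comm]
    rw [ratToComplex_tmul, TensorProduct.smul_tmul', coord_tmul, smul_eq_mul, h,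
      TensorProduct.smul_tmul', smul_eq_mul]
  | add x y hx hy => simp only [map_add, smul_add, hx, hy]

theorem mapQ_coord (f : A →+ B) (l : ℂ →ₗ[ℚ] ℚ) (x : ℂ ⊗[ℤ] A) :
    mapQ f (coord A l x) = coord B l (mapC f x) := by
  induction x using TensorProduct.induction_on with
  | zero => simp
  | tmul c a => simp
  | add x y hx hy => simp only [map_add, hx, hy]

theorem coord_conj (l : ℂ →ₗ[ℚ] ℚ) (x : ℂ ⊗[ℤ] A) :
    coord A l (conj A x) =
      coord A (l ∘ₗ (starRingEnd ℂ).toAddMonoidHom.toRatLinearMap) x := by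
  induction x using TensorProduct.induction_on with
  | zero => simp
  | tmul c a => simp
  | add x y hx hy => simp only [map_add, hx, hy]

/-- Only finitely many coordinates of a tensor are nonzero. Allowing every larger index set lets the
index sets of two summands be merged in the induction. -/
theorem exists_sum_coord {ι : Type*} (b : Module.Basis ι ℚ ℂ) (x : ℂ ⊗[ℤ] A) :
    ∃ s : Finset ι, ∀ t : Finset ι, s ⊆ t →
      ∑ i ∈ t, b i • ratToComplex A (coord A (b.coord i) x) = x := by
  classical
  induction x using TensorProduct.induction_on with
  | zero => exact ⟨∅, fun t _ => by simp⟩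
  | tmul c a =>
    refine ⟨(b.repr c).support, fun t ht => ?_⟩
    have h : ∑ i ∈ t, b i * ((b.repr c i : ℚ) : ℂ) = c := by
      conv_rhs => rw [← b.linearCombination_repr c, Finsupp.linearCombination_apply,
        Finsupp.sum_of_support_subset _ ht _ (by simp)]
      exact Finset.sum_congr rfl fun i _ => by rw [Rat.smul_def, mul_comm]
    simp only [coord_tmul, ratToComplex_tmul, TensorProduct.smul_tmul', smul_eq_mul,
      ← TensorProduct.sum_tmul, Module.Basis.coord_apply, h]
  | add x y hx hy =>
    obtain ⟨s, hs⟩ := hx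
    obtain ⟨s', hs'⟩ := hy
    refine ⟨s ∪ s', fun t ht => ?_⟩
    simp only [map_add, smul_add, Finset.sum_add_distrib,
      hs t (Finset.subset_union_left.trans ht), hs' t (Finset.subset_union_right.trans ht)]

/-- The coordinate condition is stable under `ℂ` because a scalar can be absorbed into the
functional; conversely a vector is recovered from its coordinates in a `ℚ`-basis of `ℂ`. A condition
of the form "for all `l`" commutes with preimages and arbitrary intersections, which a span does not
do visibly. -/
theorem mem_complexify {W : Submodule ℚ (ℚ ⊗[ℤ] A)} {x : ℂ ⊗[ℤ] A} :
    x ∈ complexify W ↔ ∀ l : ℂ →ₗ[ℚ] ℚ, coord A l x ∈ W := by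
  constructor
  · intro hx l
    induction hx using Submodule.span_induction generalizing l with
    | mem x h =>
      obtain ⟨w, hw, rfl⟩ := h
      rw [← one_smul ℂ (ratToComplex A w), coord_smul_ratToComplex]
      exact W.smul_mem _ hw
    | zero => simp
    | add x y _ _ hx hy => rw [map_add]; exact W.add_mem (hx l) (hy l)
    | smul c x _ hx =>
      rw [coord_smul]
      exact hx _
  · intro h
    obtain ⟨s, hs⟩ := exists_sum_coord (Module.Basis.ofVectorSpace ℚ ℂ) x
    rw [← hs s le_rfl]
    exact Submodule.sum_mem _ fun i _ => Submodule.smul_mem _ _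
      (Submodule.subset_span ⟨_, h _, rfl⟩)

theorem ratToComplex_mem_complexify {W : Submodule ℚ (ℚ ⊗[ℤ] A)} {x : ℚ ⊗[ℤ] A} (hx : x ∈ W) :
    ratToComplex A x ∈ complexify W :=
  Submodule.subset_span ⟨x, hx, rfl⟩

/-- A `ℚ`-linear retraction of `ℚ → ℂ`. -/
theorem exists_rat_retraction : ∃ l : ℂ →ₗ[ℚ] ℚ, ∀ q : ℚ, l q = q := by
  obtain ⟨l, hl⟩ := (Algebra.linearMap ℚ ℂ).exists_leftInverse_of_injective
    (LinearMap.ker_eq_bot.2 (algebraMap ℚ ℂ).injective)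
  exact ⟨l, fun q => LinearMap.congr_fun hl q⟩

/-- One functional serves all groups at once, so it can be applied at both ends of a map when a
complex statement is descended to `ℚ`. -/
theorem exists_coord_ratToComplex :
    ∃ l : ℂ →ₗ[ℚ] ℚ, ∀ (A : Type) [AddCommGroup A] (x : ℚ ⊗[ℤ] A),
      coord A l (ratToComplex A x) = x := by
  obtain ⟨l, hl⟩ := exists_rat_retraction
  have h1 : l 1 = 1 := by simpa using hl 1
  refine ⟨l, fun A _ x => ?_⟩
  rw [← one_smul ℂ (ratToComplex A x), coord_smul_ratToComplex, h1, one_smul]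

theorem mem_of_ratToComplex_mem {W : Submodule ℚ (ℚ ⊗[ℤ] A)} {x : ℚ ⊗[ℤ] A}
    (hx : ratToComplex A x ∈ complexify W) : x ∈ W := by
  obtain ⟨l, hl⟩ := exists_coord_ratToComplex
  rw [← hl A x]
  exact mem_complexify.1 hx l

theorem complexify_mono {W W' : Submodule ℚ (ℚ ⊗[ℤ] A)} (h : W ≤ W') :
    complexify W ≤ complexify W' :=
  Submodule.span_mono (Set.image_mono h)

theorem le_of_complexify_le {W W' : Submodule ℚ (ℚ ⊗[ℤ] A)} (h : complexify W ≤ complexify W') :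
    W ≤ W' :=
  fun _ hx => mem_of_ratToComplex_mem (h (ratToComplex_mem_complexify hx))

theorem complexify_comap (f : A →+ B) (W : Submodule ℚ (ℚ ⊗[ℤ] B)) :
    complexify (W.comap (mapQ f)) = (complexify W).comap (mapC f) := by
  ext x
  simp only [mem_complexify, Submodule.mem_comap, mapQ_coord]

theorem complexify_map (f : A →+ B) (W : Submodule ℚ (ℚ ⊗[ℤ] A)) :
    complexify (W.map (mapQ f)) = (complexify W).map (mapC f) := by
  rw [complexify, complexify, Submodule.map_span, ← Set.image_comp, Submodule.map_coe,
    ← Set.image_comp]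
  congr 1
  exact Set.image_congr' fun x => (mapC_ratToComplex f x).symm

theorem complexify_iInf {J : Type*} (W : J → Submodule ℚ (ℚ ⊗[ℤ] A)) :
    complexify (⨅ j, W j) = ⨅ j, complexify (W j) := by
  ext x
  simp only [mem_complexify, Submodule.mem_iInf]
  exact forall_comm

theorem conj_mem_complexify {W : Submodule ℚ (ℚ ⊗[ℤ] A)} {x : ℂ ⊗[ℤ] A} (hx : x ∈ complexify W) :
    conj A x ∈ complexify W :=
  mem_complexify.2 fun l => by rw [coord_conj]; exact mem_complexify.1 hx _

theorem mapC_injective {f : A →+ B} (hf : Function.Injective f) : Function.Injective (mapC f) :=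
  Module.Flat.lTensor_preserves_injective_linearMap (M := ℂ) f.toIntLinearMap hf

theorem mapC_surjective {f : A →+ B} (hf : Function.Surjective f) : Function.Surjective (mapC f) :=
  LinearMap.lTensor_surjective ℂ (g := f.toIntLinearMap) hf

theorem mapC_exact {f : A →+ B} {g : B →+ D} (h : Function.Exact f g) :
    Function.Exact (mapC f) (mapC g) :=
  Module.Flat.lTensor_exact (R := ℤ) ℂ (f := f.toIntLinearMap) (g := g.toIntLinearMap) h

theorem mapQ_injective {f : A →+ B} (hf : Function.Injective f) : Function.Injective (mapQ f) :=
  Module.Flat.lTensor_preserves_injective_linearMap (M := ℚ) f.toIntLinearMap hf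

theorem mapQ_surjective {f : A →+ B} (hf : Function.Surjective f) : Function.Surjective (mapQ f) :=
  LinearMap.lTensor_surjective ℚ (g := f.toIntLinearMap) hf

theorem mapQ_exact {f : A →+ B} {g : B →+ D} (h : Function.Exact f g) :
    Function.Exact (mapQ f) (mapQ g) :=
  Module.Flat.lTensor_exact (R := ℤ) ℚ (f := f.toIntLinearMap) (g := g.toIntLinearMap) h

/-- The complexification of a rational linear map. -/
def extendC (s : (ℚ ⊗[ℤ] A) →ₗ[ℚ] (ℚ ⊗[ℤ] B)) : (ℂ ⊗[ℤ] A) →ₗ[ℂ] (ℂ ⊗[ℤ] B) :=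
  LinearMap.liftBaseChange ℂ
    (ratToComplex B ∘ₗ s.restrictScalars ℤ ∘ₗ TensorProduct.mk ℤ ℚ A 1)

theorem extendC_ratToComplex (s : (ℚ ⊗[ℤ] A) →ₗ[ℚ] (ℚ ⊗[ℤ] B)) (x : ℚ ⊗[ℤ] A) :
    extendC s (ratToComplex A x) = ratToComplex B (s x) := by
  induction x using TensorProduct.induction_on with
  | zero => simp
  | tmul q a =>
    have h : q ⊗ₜ[ℤ] a = q • ((1 : ℚ) ⊗ₜ[ℤ] a) := by simp [TensorProduct.smul_tmul']
    rw [h, ratToComplex_smul, map_smul, map_smul, ratToComplex_smul]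
    simp only [extendC, ratToComplex_tmul, Rat.cast_one, LinearMap.liftBaseChange_tmul, one_smul]
    rfl
  | add x y hx hy => simp only [map_add, hx, hy]

/-- Semilinear maps are allowed so that composites with conjugation are covered. -/
theorem linearMap_ext_ratToComplex {σ : ℂ →+* ℂ} {V : Type*} [AddCommGroup V] [Module ℂ V]
    {f g : (ℂ ⊗[ℤ] A) →ₛₗ[σ] V} (h : ∀ x, f (ratToComplex A x) = g (ratToComplex A x)) : f = g := by
  ext x
  induction x using TensorProduct.induction_on with
  | zero => simp
  | tmul c a =>
    have e : c ⊗ₜ[ℤ] a = c • ratToComplex A (1 ⊗ₜ a) := by simp [TensorProduct.smul_tmul']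
    rw [e, map_smulₛₗ, map_smulₛₗ, h]
  | add x y hx hy => simp only [map_add, hx, hy]

theorem extendC_conj (s : (ℚ ⊗[ℤ] A) →ₗ[ℚ] (ℚ ⊗[ℤ] B)) (x : ℂ ⊗[ℤ] A) :
    extendC s (conj A x) = conj B (extendC s x) := by
  refine LinearMap.congr_fun (f := (extendC s).comp (conj A)) (g := (conj B).comp (extendC s))
    (linearMap_ext_ratToComplex fun x => ?_) x
  simp [extendC_ratToComplex]

theorem extendC_mem_complexify {s : (ℚ ⊗[ℤ] A) →ₗ[ℚ] (ℚ ⊗[ℤ] B)} {W : Submodule ℚ (ℚ ⊗[ℤ] A)}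
    {W' : Submodule ℚ (ℚ ⊗[ℤ] B)} (h : ∀ x ∈ W, s x ∈ W') {x : ℂ ⊗[ℤ] A}
    (hx : x ∈ complexify W) : extendC s x ∈ complexify W' := by
  suffices complexify W ≤ (complexify W').comap (extendC s) from this hx
  refine Submodule.span_le.2 ?_
  rintro _ ⟨x, hx, rfl⟩
  simpa [extendC_ratToComplex] using ratToComplex_mem_complexify (h x hx)

end Coordinates

/-! ### Deligne's splitting and strictness of morphisms -/

section Splitting

variable {A B : Type} [AddCommGroup A] [AddCommGroup B]

theorem mem_conjSub {F : Submodule ℂ (ℂ ⊗[ℤ] A)} {x : ℂ ⊗[ℤ] A} :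
    x ∈ conjSub F ↔ conj A x ∈ F := Iff.rfl

/-- Projections onto the summands `I^{0,0}`, `I^{0,-1}`, `I^{-1,0}`, `I^{-1,-1}` of a decomposition
of `A ⊗ ℂ` which splits the weight and the Hodge filtration. -/
structure IsSplitting (W₂ W₁ : Submodule ℚ (ℚ ⊗[ℤ] A)) (F₀ : Submodule ℂ (ℂ ⊗[ℤ] A))
    (p : Fin 4 → Module.End ℂ (ℂ ⊗[ℤ] A)) : Prop where
  sum : ∀ x, p 0 x + p 1 x + p 2 x + p 3 x = x
  ortho : ∀ i j, i ≠ j → ∀ x, p i (p j x) = 0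
  mem_F₀ : ∀ x, x ∈ F₀ ↔ p 2 x = 0 ∧ p 3 x = 0
  mem_W₁ : ∀ x, x ∈ complexify W₁ ↔ p 0 x = 0
  mem_W₂ : ∀ x, x ∈ complexify W₂ ↔ p 0 x = 0 ∧ p 1 x = 0 ∧ p 2 x = 0
  conj : ∀ x, p 1 (conj A x) = conj A (p 2 x)

namespace IsSplitting

variable {W₂ W₁ : Submodule ℚ (ℚ ⊗[ℤ] A)} {F₀ : Submodule ℂ (ℂ ⊗[ℤ] A)}
  {p : Fin 4 → Module.End ℂ (ℂ ⊗[ℤ] A)}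

theorem conj' (h : IsSplitting W₂ W₁ F₀ p) (x : ℂ ⊗[ℤ] A) :
    p 2 (FormalHodge.conj A x) = FormalHodge.conj A (p 1 x) := by
  have := h.conj (FormalHodge.conj A x)
  rw [conj_conj] at this
  rw [this, conj_conj]

theorem mem_F₀_inf (h : IsSplitting W₂ W₁ F₀ p) (x : ℂ ⊗[ℤ] A) :
    x ∈ F₀ ⊓ complexify W₁ ↔ p 0 x = 0 ∧ p 2 x = 0 ∧ p 3 x = 0 := by
  rw [Submodule.mem_inf, h.mem_F₀, h.mem_W₁]
  tauto

theorem one_mem (h : IsSplitting W₂ W₁ F₀ p) (x : ℂ ⊗[ℤ] A) : p 1 x ∈ F₀ ⊓ complexify W₁ :=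
  (h.mem_F₀_inf _).2 ⟨h.ortho _ _ (by decide) _, h.ortho _ _ (by decide) _,
    h.ortho _ _ (by decide) _⟩

theorem three_mem (h : IsSplitting W₂ W₁ F₀ p) (x : ℂ ⊗[ℤ] A) : p 3 x ∈ complexify W₂ :=
  (h.mem_W₂ _).2 ⟨h.ortho _ _ (by decide) _, h.ortho _ _ (by decide) _,
    h.ortho _ _ (by decide) _⟩

theorem mem_inf_sup (h : IsSplitting W₂ W₁ F₀ p) (x : ℂ ⊗[ℤ] A) :
    x ∈ (F₀ ⊓ complexify W₁) ⊔ complexify W₂ ↔ p 0 x = 0 ∧ p 2 x = 0 := by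
  constructor
  · intro hx
    obtain ⟨y, hy, z, hz, rfl⟩ := Submodule.mem_sup.1 hx
    rw [h.mem_F₀_inf] at hy
    rw [h.mem_W₂] at hz
    rw [map_add, map_add, hy.1, hz.1, hy.2.1, hz.2.2]
    simp
  · intro hx
    have e := h.sum x
    rw [hx.1, hx.2, zero_add, add_zero] at e
    rw [← e]
    exact Submodule.add_mem_sup (h.one_mem x) (h.three_mem x)

theorem conj_mem_inf_sup (h : IsSplitting W₂ W₁ F₀ p) (x : ℂ ⊗[ℤ] A) :
    x ∈ conjSub ((F₀ ⊓ complexify W₁) ⊔ complexify W₂) ↔ p 0 x = 0 ∧ p 1 x = 0 := by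
  rw [mem_conjSub, h.mem_inf_sup, h.conj', ← h.mem_W₁, ← h.mem_W₁]
  refine and_congr ⟨fun hx => ?_, conj_mem_complexify⟩ ⟨fun hx => ?_, fun hx => by rw [hx, map_zero]⟩
  · rw [← conj_conj x]
    exact conj_mem_complexify hx
  · rw [← conj_conj (p 1 x), hx, map_zero]

/-- A mixed Hodge structure from a splitting of the filtrations. -/
def toLevelOneMHS (h : IsSplitting W₂ W₁ F₀ p)
    (pol : ∃ Ψ : LinearMap.BilinForm ℂ (ℂ ⊗[ℤ] A),
      (∀ a b : A, ∃ q : ℚ, Ψ (1 ⊗ₜ[ℤ] a) (1 ⊗ₜ[ℤ] b) = (q : ℂ)) ∧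
      Ψ.IsAlt ∧
      (∀ x ∈ complexify W₂, ∀ y ∈ complexify W₁, Ψ x y = 0) ∧
      (∀ x ∈ F₀ ⊓ complexify W₁, ∀ y ∈ F₀ ⊓ complexify W₁, Ψ x y = 0) ∧
      (∀ x ∈ F₀ ⊓ complexify W₁, x ≠ 0 → 0 < (Complex.I * Ψ x (FormalHodge.conj A x)).re)) :
    LevelOneMHS A where
  W₂ := W₂
  W₁ := W₁
  F₀ := F₀
  W₂_le_W₁ := le_of_complexify_le fun x hx => (h.mem_W₁ x).2 ((h.mem_W₂ x).1 hx).1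
  gr_two := by
    refine (Submodule.eq_bot_iff _).2 fun x hx => ?_
    have h1 := (h.mem_F₀ x).1 hx.1
    have h2 := (h.mem_W₂ x).1 hx.2
    rw [← h.sum x, h1.1, h1.2, h2.1, h2.2.1]
    simp
  gr_one_sup := by
    refine le_antisymm (sup_le (fun x hx => ?_) fun x hx => ?_) fun x hx => ?_
    · exact (h.mem_W₁ x).2 ((h.mem_inf_sup x).1 hx).1
    · exact (h.mem_W₁ x).2 ((h.conj_mem_inf_sup x).1 hx).1
    · have e := h.sum x
      rw [(h.mem_W₁ x).1 hx, zero_add] at e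
      rw [← e, add_right_comm]
      exact Submodule.add_mem_sup (Submodule.add_mem_sup (h.one_mem x) (h.three_mem x))
        ((h.conj_mem_inf_sup _).2 ⟨h.ortho _ _ (by decide) _, h.ortho _ _ (by decide) _⟩)
  gr_one_inf := by
    ext x
    rw [Submodule.mem_inf, h.mem_inf_sup, h.conj_mem_inf_sup, h.mem_W₂]
    tauto
  gr_zero := by
    refine eq_top_iff.2 fun x _ => ?_
    rw [← h.sum x, add_assoc, add_assoc]
    refine Submodule.add_mem_sup
      ((h.mem_F₀ _).2 ⟨h.ortho _ _ (by decide) _, h.ortho _ _ (by decide) _⟩)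
      ((h.mem_W₁ _).2 ?_)
    simp only [map_add, h.ortho 0 1 (by decide), h.ortho 0 2 (by decide), h.ortho 0 3 (by decide),
      add_zero]
  polarizable := pol

end IsSplitting

namespace LevelOneMHS

variable (S : LevelOneMHS A)

/-- The summands of Deligne's splitting. -/
def piece : Fin 4 → Submodule ℂ (ℂ ⊗[ℤ] A) :=
  ![S.F₀ ⊓ (conjSub S.F₀ ⊔ complexify S.W₂), S.F₀ ⊓ complexify S.W₁,
    conjSub S.F₀ ⊓ complexify S.W₁, complexify S.W₂]

variable {S}

theorem eq_zero_of_mem_F₀_of_mem_W₂ {x : ℂ ⊗[ℤ] A} (h1 : x ∈ S.F₀) (h2 : x ∈ complexify S.W₂) :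
    x = 0 := by
  have h : x ∈ S.F₀ ⊓ complexify S.W₂ := ⟨h1, h2⟩
  rwa [S.gr_two] at h

theorem complexify_W₂_le : complexify S.W₂ ≤ complexify S.W₁ := complexify_mono S.W₂_le_W₁

theorem piece_zero {x : ℂ ⊗[ℤ] A} (hx : x ∈ S.piece 0) :
    ∃ c w, c + w = x ∧ conj A c ∈ S.F₀ ∧ w ∈ complexify S.W₂ := by
  obtain ⟨c, hc, w, hw, e⟩ := Submodule.mem_sup.1 hx.2
  exact ⟨c, w, e, hc, hw⟩

/-- Modulo `W₋₁` every vector lies in `F⁰`, in particular `conj x` does, so `x` lies in `conj F⁰` up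
to an error in `W₋₁`. The Hodge decomposition of `gr₋₁` splits this error into a part in `F⁰`,
subtracted from `x`, a part absorbed by `conj F⁰`, and a part in `W₋₂`. -/
theorem exists_piece_of_mem_F₀ {x : ℂ ⊗[ℤ] A} (hx : x ∈ S.F₀) :
    ∃ y ∈ S.piece 0, ∃ z ∈ S.piece 1, y + z = x := by
  have h1 : conj A x ∈ S.F₀ ⊔ complexify S.W₁ := by rw [S.gr_zero]; trivial
  obtain ⟨c, hc, w, hw, e⟩ := Submodule.mem_sup.1 h1
  have hw' := conj_mem_complexify hw
  rw [← S.gr_one_sup] at hw'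
  obtain ⟨u, hu, v, hv, e'⟩ := Submodule.mem_sup.1 hw'
  obtain ⟨a, ha, w₁, hw₁, rfl⟩ := Submodule.mem_sup.1 hu
  obtain ⟨b, hb, w₂, hw₂, e''⟩ := Submodule.mem_sup.1 (mem_conjSub.1 hv)
  refine ⟨x - a, ⟨S.F₀.sub_mem hx ha.1, ?_⟩, a, ha, sub_add_cancel _ _⟩
  have ev : v = conj A b + conj A w₂ := by rw [← map_add, e'', conj_conj]
  have ex : x - a = conj A (c + b) + (conj A w₂ + w₁) := by
    have : x = conj A c + conj A w := by rw [← map_add, e, conj_conj]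
    rw [this, ← e', ev, map_add]
    abel
  rw [ex]
  refine Submodule.add_mem_sup (mem_conjSub.2 ?_)
    (Submodule.add_mem _ (conj_mem_complexify hw₂) hw₁)
  rw [conj_conj]
  exact S.F₀.add_mem hc hb.1

theorem exists_piece_of_mem_W₁ {x : ℂ ⊗[ℤ] A} (hx : x ∈ complexify S.W₁) :
    ∃ y ∈ S.piece 1, ∃ z ∈ S.piece 2, ∃ w ∈ S.piece 3, y + z + w = x := by
  rw [← S.gr_one_sup] at hx
  obtain ⟨u, hu, v, hv, e'⟩ := Submodule.mem_sup.1 hx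
  obtain ⟨a, ha, w₁, hw₁, rfl⟩ := Submodule.mem_sup.1 hu
  obtain ⟨b, hb, w₂, hw₂, e''⟩ := Submodule.mem_sup.1 (mem_conjSub.1 hv)
  refine ⟨a, ha, conj A b, ⟨mem_conjSub.2 (by rw [conj_conj]; exact hb.1),
    conj_mem_complexify hb.2⟩, w₁ + conj A w₂,
    Submodule.add_mem _ hw₁ (conj_mem_complexify hw₂), ?_⟩
  have ev : v = conj A b + conj A w₂ := by rw [← map_add, e'', conj_conj]
  rw [← e', ev]
  abel

theorem exists_sum_piece (x : ℂ ⊗[ℤ] A) :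
    ∃ y ∈ S.piece 0, ∃ z ∈ S.piece 1, ∃ u ∈ S.piece 2, ∃ w ∈ S.piece 3, y + z + u + w = x := by
  have h1 : x ∈ S.F₀ ⊔ complexify S.W₁ := by rw [S.gr_zero]; trivial
  obtain ⟨a, ha, b, hb, e⟩ := Submodule.mem_sup.1 h1
  obtain ⟨y, hy, z, hz, e1⟩ := exists_piece_of_mem_F₀ ha
  obtain ⟨z', hz', u, hu, w, hw, e2⟩ := exists_piece_of_mem_W₁ hb
  refine ⟨y, hy, z + z', Submodule.add_mem _ hz hz', u, hu, w, hw, ?_⟩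
  rw [← e, ← e1, ← e2]
  abel

theorem mem_W₂_of_mem {x : ℂ ⊗[ℤ] A}
    (h1 : x ∈ (S.F₀ ⊓ complexify S.W₁) ⊔ complexify S.W₂)
    (h2 : conj A x ∈ (S.F₀ ⊓ complexify S.W₁) ⊔ complexify S.W₂) : x ∈ complexify S.W₂ := by
  have h : x ∈ ((S.F₀ ⊓ complexify S.W₁) ⊔ complexify S.W₂) ⊓
    conjSub ((S.F₀ ⊓ complexify S.W₁) ⊔ complexify S.W₂) := ⟨h1, h2⟩
  rwa [S.gr_one_inf] at h

/-- The components are killed one after another. Each of the first two is shown to lie, together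
with its conjugate, in `(F⁰ ∩ W₋₁) + W₋₂`; purity of `gr₋₁` places it in `W₋₂`, where `F⁰` is zero.
-/
theorem piece_independent {y z u w : ℂ ⊗[ℤ] A} (hy : y ∈ S.piece 0) (hz : z ∈ S.piece 1)
    (hu : u ∈ S.piece 2) (hw : w ∈ S.piece 3) (h : y + z + u + w = 0) :
    y = 0 ∧ z = 0 ∧ u = 0 ∧ w = 0 := by
  have hwW : w ∈ complexify S.W₁ := complexify_W₂_le hw
  have hyW : y ∈ complexify S.W₁ := by
    have e : y = -(z + u + w) := by
      rw [eq_neg_iff_add_eq_zero, ← h]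
      abel
    rw [e]
    exact Submodule.neg_mem _ (Submodule.add_mem _ (Submodule.add_mem _ hz.2 hu.2) hwW)
  have y0 : y = 0 := by
    obtain ⟨c, v, e, hc, hv⟩ := piece_zero hy
    refine eq_zero_of_mem_F₀_of_mem_W₂ hy.1 (mem_W₂_of_mem (Submodule.mem_sup_left ⟨hy.1, hyW⟩) ?_)
    rw [← e, map_add]
    refine Submodule.add_mem_sup ⟨hc, conj_mem_complexify ?_⟩ (conj_mem_complexify hv)
    rw [eq_sub_of_add_eq e]
    exact Submodule.sub_mem _ hyW (complexify_W₂_le hv)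
  subst y0
  rw [zero_add] at h
  have hcu : conj A u ∈ S.F₀ ⊓ complexify S.W₁ := ⟨hu.1, conj_mem_complexify hu.2⟩
  have z0 : z = 0 := by
    refine eq_zero_of_mem_F₀_of_mem_W₂ hz.1 (mem_W₂_of_mem (Submodule.mem_sup_left hz) ?_)
    have e : z = -(u + w) := by
      rw [eq_neg_iff_add_eq_zero, ← h]
      abel
    rw [e, map_neg, map_add]
    exact Submodule.neg_mem _ (Submodule.add_mem_sup hcu (conj_mem_complexify hw))
  subst z0
  rw [zero_add] at h
  have u0 : u = 0 := by
    have : conj A u = 0 := by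
      refine eq_zero_of_mem_F₀_of_mem_W₂ hcu.1 (conj_mem_complexify ?_)
      rw [eq_neg_of_add_eq_zero_left h]
      exact Submodule.neg_mem _ hw
    rw [← conj_conj u, this, map_zero]
  subst u0
  exact ⟨rfl, rfl, rfl, by simpa using h⟩

variable (S)

/-- Addition of the components of Deligne's splitting. -/
def pieceSum : (∀ i, S.piece i) →ₗ[ℂ] (ℂ ⊗[ℤ] A) :=
  ∑ i, (S.piece i).subtype ∘ₗ LinearMap.proj i

theorem pieceSum_apply (y : ∀ i, S.piece i) :
    S.pieceSum y = (y 0 : ℂ ⊗[ℤ] A) + y 1 + y 2 + y 3 := by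
  simp [pieceSum, Fin.sum_univ_four]

theorem pieceSum_bijective : Function.Bijective S.pieceSum := by
  constructor
  · refine (injective_iff_map_eq_zero _).2 fun y hy => ?_
    rw [pieceSum_apply] at hy
    obtain ⟨h0, h1, h2, h3⟩ := piece_independent (y 0).2 (y 1).2 (y 2).2 (y 3).2 hy
    funext i
    fin_cases i
    · exact Subtype.ext h0
    · exact Subtype.ext h1
    · exact Subtype.ext h2
    · exact Subtype.ext h3
  · intro x
    obtain ⟨y, hy, z, hz, u, hu, w, hw, e⟩ := S.exists_sum_piece x
    refine ⟨Fin.cons ⟨y, hy⟩ (Fin.cons ⟨z, hz⟩ (Fin.cons ⟨u, hu⟩ (Fin.cons ⟨w, hw⟩ finZeroElim))), ?_⟩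
    rw [pieceSum_apply]
    exact e

/-- The projections of Deligne's splitting. -/
def proj (i : Fin 4) : Module.End ℂ (ℂ ⊗[ℤ] A) :=
  (S.piece i).subtype ∘ₗ LinearMap.proj i ∘ₗ
    (LinearEquiv.ofBijective S.pieceSum S.pieceSum_bijective).symm.toLinearMap

theorem proj_mem (i : Fin 4) (x : ℂ ⊗[ℤ] A) : S.proj i x ∈ S.piece i :=
  Subtype.property _

theorem sum_proj (x : ℂ ⊗[ℤ] A) : S.proj 0 x + S.proj 1 x + S.proj 2 x + S.proj 3 x = x := by
  conv_rhs => rw [← (LinearEquiv.ofBijective S.pieceSum S.pieceSum_bijective).apply_symm_apply x]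
  exact (S.pieceSum_apply _).symm

variable {S}

theorem proj_eq {x y z u w : ℂ ⊗[ℤ] A} (hy : y ∈ S.piece 0) (hz : z ∈ S.piece 1)
    (hu : u ∈ S.piece 2) (hw : w ∈ S.piece 3) (h : y + z + u + w = x) :
    S.proj 0 x = y ∧ S.proj 1 x = z ∧ S.proj 2 x = u ∧ S.proj 3 x = w := by
  have e : (S.proj 0 x - y) + (S.proj 1 x - z) + (S.proj 2 x - u) + (S.proj 3 x - w) = 0 := by
    rw [← sub_eq_zero.2 ((S.sum_proj x).trans h.symm)]
    abel
  simpa only [sub_eq_zero] using piece_independent (Submodule.sub_mem _ (S.proj_mem 0 x) hy)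
    (Submodule.sub_mem _ (S.proj_mem 1 x) hz) (Submodule.sub_mem _ (S.proj_mem 2 x) hu)
    (Submodule.sub_mem _ (S.proj_mem 3 x) hw) e

variable (S)

theorem proj_of_mem {i : Fin 4} {x : ℂ ⊗[ℤ] A} (hx : x ∈ S.piece i) (j : Fin 4) :
    S.proj j x = if j = i then x else 0 := by
  have z (k : Fin 4) : (0 : ℂ ⊗[ℤ] A) ∈ S.piece k := Submodule.zero_mem _
  fin_cases i
  · obtain ⟨h0, h1, h2, h3⟩ := proj_eq hx (z 1) (z 2) (z 3) (by simp : _ = x)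
    fin_cases j <;> simp [h0, h1, h2, h3]
  · obtain ⟨h0, h1, h2, h3⟩ := proj_eq (z 0) hx (z 2) (z 3) (by simp : _ = x)
    fin_cases j <;> simp [h0, h1, h2, h3]
  · obtain ⟨h0, h1, h2, h3⟩ := proj_eq (z 0) (z 1) hx (z 3) (by simp : _ = x)
    fin_cases j <;> simp [h0, h1, h2, h3]
  · obtain ⟨h0, h1, h2, h3⟩ := proj_eq (z 0) (z 1) (z 2) hx (by simp : _ = x)
    fin_cases j <;> simp [h0, h1, h2, h3]

theorem isSplitting : IsSplitting S.W₂ S.W₁ S.F₀ S.proj where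
  sum := S.sum_proj
  ortho i j hij x := by rw [S.proj_of_mem (S.proj_mem j x), if_neg hij]
  mem_F₀ x := by
    constructor
    · intro hx
      obtain ⟨y, hy, z, hz, e⟩ := exists_piece_of_mem_F₀ hx
      obtain ⟨-, -, h2, h3⟩ := proj_eq hy hz (Submodule.zero_mem _) (Submodule.zero_mem _)
        (by simpa using e)
      exact ⟨h2, h3⟩
    · rintro ⟨h2, h3⟩
      have e := S.sum_proj x
      rw [h2, h3, add_zero, add_zero] at e
      rw [← e]
      exact S.F₀.add_mem (S.proj_mem 0 x).1 (S.proj_mem 1 x).1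
  mem_W₁ x := by
    constructor
    · intro hx
      obtain ⟨y, hy, z, hz, w, hw, e⟩ := exists_piece_of_mem_W₁ hx
      exact (proj_eq (Submodule.zero_mem _) hy hz hw (by simpa using e)).1
    · intro h0
      have e := S.sum_proj x
      rw [h0, zero_add] at e
      rw [← e]
      exact Submodule.add_mem _ (Submodule.add_mem _ (S.proj_mem 1 x).2 (S.proj_mem 2 x).2)
        (complexify_W₂_le (S.proj_mem 3 x))
  mem_W₂ x := by
    constructor
    · intro hx
      obtain ⟨h0, h1, h2, -⟩ := proj_eq (Submodule.zero_mem _) (Submodule.zero_mem _)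
        (Submodule.zero_mem _) hx (by simp : _ = x)
      exact ⟨h0, h1, h2⟩
    · rintro ⟨h0, h1, h2⟩
      have e := S.sum_proj x
      rw [h0, h1, h2, zero_add, zero_add, zero_add] at e
      rw [← e]
      exact S.proj_mem 3 x
  conj x := by
    -- Conjugation exchanges the two middle pieces, but preserves the piece of type `(0,0)` only
    -- modulo `W₋₂`. The correction `w` is moved to the last component, which does not affect the
    -- identity sought.
    obtain ⟨c, w, e, hc, hw⟩ := piece_zero (S.proj_mem 0 x)
    have h1 := S.proj_mem 1 x
    have h2 := S.proj_mem 2 x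
    refine (proj_eq (y := FormalHodge.conj A c) (u := FormalHodge.conj A (S.proj 1 x))
      (w := FormalHodge.conj A (S.proj 3 x) + FormalHodge.conj A w) ⟨hc, ?_⟩
      ⟨h2.1, conj_mem_complexify h2.2⟩
      ⟨mem_conjSub.2 (by rw [conj_conj]; exact h1.1), conj_mem_complexify h1.2⟩
      (Submodule.add_mem _ (conj_mem_complexify (S.proj_mem 3 x)) (conj_mem_complexify hw)) ?_).2.1
    · have : FormalHodge.conj A c = FormalHodge.conj A (S.proj 0 x) + FormalHodge.conj A (-w) := by
        rw [← map_add, ← e, add_neg_cancel_right]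
      rw [this]
      refine Submodule.add_mem_sup (mem_conjSub.2 ?_)
        (conj_mem_complexify (Submodule.neg_mem _ hw))
      rw [conj_conj]
      exact (S.proj_mem 0 x).1
    · conv_rhs => rw [← S.sum_proj x, map_add, map_add, map_add, ← e, map_add]
      abel

variable {S}

namespace IsHom

variable {T : LevelOneMHS B} {f : A →+ B}

theorem complexify_W₂ (hf : S.IsHom T f) {x : ℂ ⊗[ℤ] A} (hx : x ∈ complexify S.W₂) :
    mapC f x ∈ complexify T.W₂ := by
  have h := complexify_mono hf.W₂ hx
  rwa [complexify_comap] at h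

theorem complexify_W₁ (hf : S.IsHom T f) {x : ℂ ⊗[ℤ] A} (hx : x ∈ complexify S.W₁) :
    mapC f x ∈ complexify T.W₁ := by
  have h := complexify_mono hf.W₁ hx
  rwa [complexify_comap] at h

theorem mapC_mem_piece (hf : S.IsHom T f) {i : Fin 4} {x : ℂ ⊗[ℤ] A} (hx : x ∈ S.piece i) :
    mapC f x ∈ T.piece i := by
  fin_cases i
  · obtain ⟨c, w, e, hc, hw⟩ := piece_zero hx
    refine ⟨hf.F₀ hx.1, ?_⟩
    rw [← e, map_add]
    refine Submodule.add_mem_sup (mem_conjSub.2 ?_) (hf.complexify_W₂ hw)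
    rw [← mapC_conj]
    exact hf.F₀ hc
  · exact ⟨hf.F₀ hx.1, hf.complexify_W₁ hx.2⟩
  · refine ⟨mem_conjSub.2 ?_, hf.complexify_W₁ hx.2⟩
    rw [← mapC_conj]
    exact hf.F₀ hx.1
  · exact hf.complexify_W₂ hx

/-- The pieces are defined from the filtrations and conjugation only, so they are preserved, and
decompositions are unique. All strictness statements are read off from this. -/
theorem mapC_proj (hf : S.IsHom T f) (i : Fin 4) (x : ℂ ⊗[ℤ] A) :
    T.proj i (mapC f x) = mapC f (S.proj i x) := by
  have h (j : Fin 4) : mapC f (S.proj j x) ∈ T.piece j := hf.mapC_mem_piece (S.proj_mem j x)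
  obtain ⟨h0, h1, h2, h3⟩ := proj_eq (h 0) (h 1) (h 2) (h 3)
    (by rw [← map_add, ← map_add, ← map_add, S.sum_proj])
  fin_cases i
  · exact h0
  · exact h1
  · exact h2
  · exact h3

/-- Strictness with respect to `F⁰`. -/
theorem exists_mem_F₀ (hf : S.IsHom T f) {x : ℂ ⊗[ℤ] A} (hx : mapC f x ∈ T.F₀) :
    ∃ y ∈ S.F₀, mapC f y = mapC f x := by
  rw [T.isSplitting.mem_F₀, hf.mapC_proj, hf.mapC_proj] at hx
  refine ⟨S.proj 0 x + S.proj 1 x, S.F₀.add_mem (S.proj_mem 0 x).1 (S.proj_mem 1 x).1, ?_⟩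
  conv_rhs => rw [← S.sum_proj x, map_add, map_add, hx.1, hx.2, add_zero, add_zero]

/-- Strictness with respect to `F⁰ + W₋₂`. -/
theorem exists_mem_F₀_sup (hf : S.IsHom T f) {x : ℂ ⊗[ℤ] A}
    (hx : mapC f x ∈ T.F₀ ⊔ complexify T.W₂) :
    ∃ y ∈ S.F₀, ∃ w ∈ complexify S.W₂, mapC f (y + w) = mapC f x := by
  obtain ⟨y, hy, w, hw, e⟩ := Submodule.mem_sup.1 hx
  have h : mapC f (S.proj 2 x) = 0 := by
    rw [← hf.mapC_proj, ← e, map_add, ((T.isSplitting.mem_F₀ y).1 hy).1,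
      ((T.isSplitting.mem_W₂ w).1 hw).2.2, add_zero]
  refine ⟨S.proj 0 x + S.proj 1 x, S.F₀.add_mem (S.proj_mem 0 x).1 (S.proj_mem 1 x).1,
    S.proj 3 x, S.proj_mem 3 x, ?_⟩
  conv_rhs => rw [← S.sum_proj x, add_right_comm, map_add _ _ (S.proj 2 x), h, add_zero]

theorem exists_mem_W₂C (hf : S.IsHom T f) {x : ℂ ⊗[ℤ] A} (hx : mapC f x ∈ complexify T.W₂) :
    ∃ y ∈ complexify S.W₂, mapC f y = mapC f x := by
  rw [T.isSplitting.mem_W₂, hf.mapC_proj, hf.mapC_proj, hf.mapC_proj] at hx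
  refine ⟨S.proj 3 x, S.proj_mem 3 x, ?_⟩
  conv_rhs => rw [← S.sum_proj x, map_add, map_add, map_add, hx.1, hx.2.1, hx.2.2]
  simp

theorem exists_mem_W₁C (hf : S.IsHom T f) {x : ℂ ⊗[ℤ] A} (hx : mapC f x ∈ complexify T.W₁) :
    ∃ y ∈ complexify S.W₁, mapC f y = mapC f x := by
  rw [T.isSplitting.mem_W₁, hf.mapC_proj] at hx
  refine ⟨x - S.proj 0 x, ?_, by rw [map_sub, hx, sub_zero]⟩
  rw [S.isSplitting.mem_W₁, map_sub, S.proj_of_mem (S.proj_mem 0 x), if_pos rfl, sub_self]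

/-- A complex solution is turned into a rational one by applying a `ℚ`-linear retraction of `ℚ → ℂ`
to its coefficients. -/
theorem exists_rat_of_complex {f : A →+ B} {W : Submodule ℚ (ℚ ⊗[ℤ] A)}
    {W' : Submodule ℚ (ℚ ⊗[ℤ] B)}
    (h : ∀ x, mapC f x ∈ complexify W' → ∃ y ∈ complexify W, mapC f y = mapC f x)
    {x : ℚ ⊗[ℤ] A} (hx : mapQ f x ∈ W') : ∃ y ∈ W, mapQ f y = mapQ f x := by
  obtain ⟨l, hl⟩ := exists_coord_ratToComplex
  obtain ⟨y, hy, e⟩ := h (ratToComplex A x) (by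
    rw [mapC_ratToComplex]
    exact ratToComplex_mem_complexify hx)
  refine ⟨coord A l y, mem_complexify.1 hy l, ?_⟩
  rw [mapQ_coord, e, mapC_ratToComplex, hl]

theorem exists_mem_W₂ (hf : S.IsHom T f) {x : ℚ ⊗[ℤ] A} (hx : mapQ f x ∈ T.W₂) :
    ∃ y ∈ S.W₂, mapQ f y = mapQ f x :=
  exists_rat_of_complex (fun _ => hf.exists_mem_W₂C) hx

theorem exists_mem_W₁ (hf : S.IsHom T f) {x : ℚ ⊗[ℤ] A} (hx : mapQ f x ∈ T.W₁) :
    ∃ y ∈ S.W₁, mapQ f y = mapQ f x :=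
  exists_rat_of_complex (fun _ => hf.exists_mem_W₁C) hx

end IsHom

end LevelOneMHS

end Splitting

/-! ### Polarizations of the weight -1 graded piece -/

section Polarization

variable {A B D : Type} [AddCommGroup A] [AddCommGroup B] [AddCommGroup D]

/-- A form polarizing the graded piece `gr₋₁`. -/
structure IsPolarization (W₂ W₁ : Submodule ℚ (ℚ ⊗[ℤ] A)) (F₀ : Submodule ℂ (ℂ ⊗[ℤ] A))
    (Ψ : LinearMap.BilinForm ℂ (ℂ ⊗[ℤ] A)) : Prop where
  rat : ∀ a b : A, ∃ q : ℚ, Ψ (1 ⊗ₜ[ℤ] a) (1 ⊗ₜ[ℤ] b) = (q : ℂ)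
  alt : Ψ.IsAlt
  rad : ∀ x ∈ complexify W₂, ∀ y ∈ complexify W₁, Ψ x y = 0
  iso : ∀ x ∈ F₀ ⊓ complexify W₁, ∀ y ∈ F₀ ⊓ complexify W₁, Ψ x y = 0
  pos : ∀ x ∈ F₀ ⊓ complexify W₁, x ≠ 0 → 0 < (Complex.I * Ψ x (conj A x)).re

theorem LevelOneMHS.exists_isPolarization (S : LevelOneMHS A) :
    ∃ Ψ, IsPolarization S.W₂ S.W₁ S.F₀ Ψ :=
  let ⟨Ψ, h1, h2, h3, h4, h5⟩ := S.polarizable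
  ⟨Ψ, h1, h2, h3, h4, h5⟩

/-- A mixed Hodge structure from a splitting of the filtrations and a polarization. -/
def IsSplitting.toMHS {W₂ W₁ : Submodule ℚ (ℚ ⊗[ℤ] A)} {F₀ : Submodule ℂ (ℂ ⊗[ℤ] A)}
    {p : Fin 4 → Module.End ℂ (ℂ ⊗[ℤ] A)} (h : IsSplitting W₂ W₁ F₀ p)
    (pol : ∃ Ψ, IsPolarization W₂ W₁ F₀ Ψ) : LevelOneMHS A :=
  h.toLevelOneMHS (let ⟨Ψ, h⟩ := pol; ⟨Ψ, h.rat, h.alt, h.rad, h.iso, h.pos⟩)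

theorem tmul_eq_smul (c : ℂ) (a : A) : c ⊗ₜ[ℤ] a = c • ((1 : ℂ) ⊗ₜ[ℤ] a) := by
  simp [TensorProduct.smul_tmul']

namespace IsPolarization

variable {W₂ W₁ : Submodule ℚ (ℚ ⊗[ℤ] A)} {F₀ : Submodule ℂ (ℂ ⊗[ℤ] A)}
  {Ψ : LinearMap.BilinForm ℂ (ℂ ⊗[ℤ] A)}

theorem rat' (h : IsPolarization W₂ W₁ F₀ Ψ) (x y : ℚ ⊗[ℤ] A) :
    ∃ q : ℚ, Ψ (ratToComplex A x) (ratToComplex A y) = (q : ℂ) := by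
  induction x using TensorProduct.induction_on with
  | zero => exact ⟨0, by simp⟩
  | tmul c a =>
    induction y using TensorProduct.induction_on with
    | zero => exact ⟨0, by simp⟩
    | tmul d b =>
      obtain ⟨q, hq⟩ := h.rat a b
      refine ⟨c * (d * q), ?_⟩
      rw [ratToComplex_tmul, ratToComplex_tmul, tmul_eq_smul, tmul_eq_smul (d : ℂ)]
      simp [hq, mul_left_comm]
    | add y y' hy hy' =>
      obtain ⟨q, hq⟩ := hy
      obtain ⟨q', hq'⟩ := hy'
      exact ⟨q + q', by rw [map_add, map_add, hq, hq', Rat.cast_add]⟩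
  | add y y' hy hy' =>
    obtain ⟨q, hq⟩ := hy
    obtain ⟨q', hq'⟩ := hy'
    exact ⟨q + q', by simp [hq, hq']⟩

/-- The rational form allows orthogonal complements to be taken over `ℚ`; this is what keeps the
polarization of a quotient rational. -/
theorem exists_rat_form (h : IsPolarization W₂ W₁ F₀ Ψ) :
    ∃ ψ : LinearMap.BilinForm ℚ (ℚ ⊗[ℤ] A),
      ∀ x y, ((ψ x y : ℚ) : ℂ) = Ψ (ratToComplex A x) (ratToComplex A y) := by
  choose g hg using h.rat'
  refine ⟨LinearMap.mk₂ ℚ g ?_ ?_ ?_ ?_, fun x y => (hg x y).symm⟩ <;> intros <;>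
    refine Rat.cast_injective (α := ℂ) ?_ <;> push_cast <;> simp only [← hg] <;>
    simp [ratToComplex_smul]
  · simp [hg]
  · simp [hg]

theorem apply_conj (h : IsPolarization W₂ W₁ F₀ Ψ) (x y : ℂ ⊗[ℤ] A) :
    Ψ (conj A x) (conj A y) = starRingEnd ℂ (Ψ x y) := by
  induction x using TensorProduct.induction_on with
  | zero => simp
  | tmul c a =>
    induction y using TensorProduct.induction_on with
    | zero => simp
    | tmul d b =>
      obtain ⟨q, hq⟩ := h.rat a b
      rw [conj_tmul, conj_tmul, tmul_eq_smul, tmul_eq_smul d, tmul_eq_smul c,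
        tmul_eq_smul (starRingEnd ℂ d)]
      simp [hq]
    | add y y' hy hy' => simp only [map_add, hy, hy']
  | add y y' hy hy' => simp [hy, hy']

theorem symm_zero (h : IsPolarization W₂ W₁ F₀ Ψ) {x y : ℂ ⊗[ℤ] A} (hxy : Ψ x y = 0) :
    Ψ y x = 0 :=
  h.alt.isRefl x y hxy

theorem eq_zero_of_apply_conj (h : IsPolarization W₂ W₁ F₀ Ψ) {x : ℂ ⊗[ℤ] A}
    (hx : x ∈ F₀ ⊓ complexify W₁) (h0 : Ψ x (conj A x) = 0) : x = 0 := by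
  by_contra hne
  have := h.pos x hx hne
  simp [h0] at this

theorem apply_add_add (h : IsPolarization W₂ W₁ F₀ Ψ) (hW : W₂ ≤ W₁) {x y w v : ℂ ⊗[ℤ] A}
    (hx : x ∈ complexify W₁) (hy : y ∈ complexify W₁) (hw : w ∈ complexify W₂)
    (hv : v ∈ complexify W₂) : Ψ (x + w) (y + v) = Ψ x y := by
  simp [h.rad w hw y hy, h.rad w hw v (complexify_mono hW hv), h.symm_zero (h.rad v hv x hx)]

end IsPolarization

end Polarization

/-! ### Structures induced along jointly injective families: kernels and products -/

section Family

variable {A : Type} [AddCommGroup A] {J : Type} {B : J → Type}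
  [∀ j, AddCommGroup (B j)] (S : ∀ j, LevelOneMHS (B j)) (φ : ∀ j, A →+ B j)

/-- Joint injectivity lets every axiom be tested after each `φ j`, where it is an axiom of Deligne's
splitting. The real hypothesis is `hp`: the projections must preserve the image of `A ⊗ ℂ`. -/
theorem isSplitting_iInf (inj : ∀ x, (∀ j, mapC (φ j) x = 0) → x = 0)
    {p : Fin 4 → Module.End ℂ (ℂ ⊗[ℤ] A)}
    (hp : ∀ j i x, mapC (φ j) (p i x) = (S j).proj i (mapC (φ j) x)) :
    IsSplitting (⨅ j, (S j).W₂.comap (mapQ (φ j))) (⨅ j, (S j).W₁.comap (mapQ (φ j)))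
      (⨅ j, (S j).F₀.comap (mapC (φ j))) p := by
  have ext {x y : ℂ ⊗[ℤ] A} : x = y ↔ ∀ j, mapC (φ j) x = mapC (φ j) y := by
    refine ⟨fun h j => by rw [h], fun h => sub_eq_zero.1 (inj _ fun j => ?_)⟩
    rw [map_sub, h, sub_self]
  constructor
  · intro x
    exact ext.2 fun j => by simp only [map_add, hp, (S j).sum_proj]
  · intro i k hik x
    exact ext.2 fun j => by rw [hp, hp, (S j).isSplitting.ortho i k hik, map_zero]
  · intro x
    simp only [Submodule.mem_iInf, Submodule.mem_comap, ext (y := 0), hp, map_zero,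
      (S _).isSplitting.mem_F₀, forall_and]
  · intro x
    simp only [complexify_iInf, complexify_comap, Submodule.mem_iInf, Submodule.mem_comap,
      ext (y := 0), hp, map_zero, (S _).isSplitting.mem_W₁]
  · intro x
    simp only [complexify_iInf, complexify_comap, Submodule.mem_iInf, Submodule.mem_comap,
      ext (y := 0), hp, map_zero, (S _).isSplitting.mem_W₂, forall_and]
  · intro x
    exact ext.2 fun j => by
      rw [hp, mapC_conj, mapC_conj, hp, (S j).isSplitting.conj]

/-- The sum of the pulled-back polarizations works: each summand is nonnegative on `F⁰ ∩ W₋₁`, and a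
nonzero vector has some nonzero image, whose summand is positive. -/
theorem exists_isPolarization_iInf [Fintype J] (inj : ∀ x, (∀ j, mapC (φ j) x = 0) → x = 0) :
    ∃ Ψ, IsPolarization (⨅ j, (S j).W₂.comap (mapQ (φ j))) (⨅ j, (S j).W₁.comap (mapQ (φ j)))
      (⨅ j, (S j).F₀.comap (mapC (φ j))) Ψ := by
  choose Ψ hΨ using fun j => (S j).exists_isPolarization
  refine ⟨∑ j, (Ψ j).compl₁₂ (mapC (φ j)) (mapC (φ j)), ?_⟩
  have app (x y : ℂ ⊗[ℤ] A) : (∑ j, (Ψ j).compl₁₂ (mapC (φ j)) (mapC (φ j))) x y =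
      ∑ j, Ψ j (mapC (φ j) x) (mapC (φ j) y) := by
    simp [LinearMap.sum_apply]
  have mem {x : ℂ ⊗[ℤ] A} (hx : x ∈ (⨅ j, (S j).F₀.comap (mapC (φ j))) ⊓
      complexify (⨅ j, (S j).W₁.comap (mapQ (φ j)))) (j : J) :
      mapC (φ j) x ∈ (S j).F₀ ⊓ complexify (S j).W₁ := by
    rw [complexify_iInf] at hx
    simp only [complexify_comap, Submodule.mem_inf, Submodule.mem_iInf, Submodule.mem_comap] at hx
    exact ⟨hx.1 j, hx.2 j⟩
  constructor
  · intro a b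
    choose q hq using fun j => (hΨ j).rat (φ j a) (φ j b)
    exact ⟨∑ j, q j, by rw [app]; simp [hq]⟩
  · intro x
    rw [app]
    exact Finset.sum_eq_zero fun j _ => (hΨ j).alt _
  · intro x hx y hy
    rw [complexify_iInf] at hx hy
    simp only [complexify_comap, Submodule.mem_iInf, Submodule.mem_comap] at hx hy
    rw [app]
    exact Finset.sum_eq_zero fun j _ => (hΨ j).rad _ (hx j) _ (hy j)
  · intro x hx y hy
    rw [app]
    exact Finset.sum_eq_zero fun j _ => (hΨ j).iso _ (mem hx j) _ (mem hy j)
  · intro x hx hne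
    rw [app, Finset.mul_sum, Complex.re_sum]
    obtain ⟨j, hj⟩ : ∃ j, mapC (φ j) x ≠ 0 := by
      by_contra! h
      exact hne (inj x h)
    refine Finset.sum_pos' (fun k _ => ?_) ⟨j, Finset.mem_univ j, ?_⟩
    · by_cases hk : mapC (φ k) x = 0
      · simp [hk]
      · rw [mapC_conj]
        exact ((hΨ k).pos _ (mem hx k) hk).le
    · rw [mapC_conj]
      exact (hΨ j).pos _ (mem hx j) hj

/-- The mixed Hodge structure induced by a jointly injective family of maps to mixed Hodge
structures. -/
def LevelOneMHS.induced [Fintype J] (inj : ∀ x, (∀ j, mapC (φ j) x = 0) → x = 0)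
    (hp : ∃ p : Fin 4 → Module.End ℂ (ℂ ⊗[ℤ] A),
      ∀ j i x, mapC (φ j) (p i x) = (S j).proj i (mapC (φ j) x)) : LevelOneMHS A :=
  (isSplitting_iInf S φ inj hp.choose_spec).toMHS (exists_isPolarization_iInf S φ inj)

end Family

/-! ### Quotient structures and their polarization by orthogonal splitting -/

section Quotient

variable {A B D : Type} [AddCommGroup A] [AddCommGroup B] [AddCommGroup D]
  {S : LevelOneMHS A} {T : LevelOneMHS B} {f : A →+ B} {π : B →+ D}

namespace LevelOneMHS.IsHom

/-- The projections of `T` preserve the image of `f`, which is the kernel of `π`, so they descend.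
-/
theorem exists_proj_quotient (hf : S.IsHom T f) (hπ : Function.Surjective π)
    (hex : Function.Exact f π) : ∃ p : Fin 4 → Module.End ℂ (ℂ ⊗[ℤ] D),
      ∀ i x, p i (mapC π x) = mapC π (T.proj i x) := by
  obtain ⟨s, hs⟩ := (mapC π).exists_rightInverse_of_surjective
    (LinearMap.range_eq_top.2 (mapC_surjective hπ))
  refine ⟨fun i => mapC π ∘ₗ T.proj i ∘ₗ s, fun i x => ?_⟩
  have h : mapC π (s (mapC π x) - x) = 0 := by
    rw [map_sub, sub_eq_zero]
    exact LinearMap.congr_fun hs (mapC π x)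
  obtain ⟨z, hz⟩ := (mapC_exact hex _).1 h
  have h' : mapC π (T.proj i (s (mapC π x) - x)) = 0 := by
    rw [← hz, hf.mapC_proj]
    exact (mapC_exact hex).apply_apply_eq_zero _
  rwa [map_sub, map_sub, sub_eq_zero] at h'

theorem isSplitting_map (hπ : Function.Surjective π) {p : Fin 4 → Module.End ℂ (ℂ ⊗[ℤ] D)}
    (hp : ∀ i x, p i (mapC π x) = mapC π (T.proj i x)) :
    IsSplitting (T.W₂.map (mapQ π)) (T.W₁.map (mapQ π)) (T.F₀.map (mapC π)) p := by
  have hs := mapC_surjective hπ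
  have sum (x : ℂ ⊗[ℤ] B) : mapC π (T.proj 0 x) + mapC π (T.proj 1 x) + mapC π (T.proj 2 x) +
      mapC π (T.proj 3 x) = mapC π x := by
    rw [← map_add, ← map_add, ← map_add, T.sum_proj]
  constructor
  · intro x
    obtain ⟨x, rfl⟩ := hs x
    simp only [hp, sum]
  · intro i j hij x
    obtain ⟨x, rfl⟩ := hs x
    rw [hp, hp, T.isSplitting.ortho i j hij, map_zero]
  · intro x
    constructor
    · rintro ⟨y, hy, rfl⟩
      have h := (T.isSplitting.mem_F₀ y).1 hy
      rw [hp, hp, h.1, h.2, map_zero]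
      exact ⟨rfl, rfl⟩
    · rintro ⟨h2, h3⟩
      obtain ⟨x, rfl⟩ := hs x
      rw [hp] at h2 h3
      refine ⟨T.proj 0 x + T.proj 1 x, T.F₀.add_mem (T.proj_mem 0 x).1 (T.proj_mem 1 x).1, ?_⟩
      rw [← sum x, h2, h3, map_add, add_zero, add_zero]
  · intro x
    rw [complexify_map]
    constructor
    · rintro ⟨y, hy, rfl⟩
      rw [hp, (T.isSplitting.mem_W₁ y).1 hy, map_zero]
    · intro h0
      obtain ⟨x, rfl⟩ := hs x
      rw [hp] at h0
      refine ⟨T.proj 1 x + T.proj 2 x + T.proj 3 x, Submodule.add_mem _ (Submodule.add_mem _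
        (T.proj_mem 1 x).2 (T.proj_mem 2 x).2) (complexify_W₂_le (T.proj_mem 3 x)), ?_⟩
      rw [← sum x, h0, map_add, map_add, zero_add]
  · intro x
    rw [complexify_map]
    constructor
    · rintro ⟨y, hy, rfl⟩
      have h := (T.isSplitting.mem_W₂ y).1 hy
      rw [hp, hp, hp, h.1, h.2.1, h.2.2, map_zero]
      exact ⟨rfl, rfl, rfl⟩
    · rintro ⟨h0, h1, h2⟩
      obtain ⟨x, rfl⟩ := hs x
      rw [hp] at h0 h1 h2
      refine ⟨T.proj 3 x, T.proj_mem 3 x, ?_⟩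
      rw [← sum x, h0, h1, h2, zero_add, zero_add, zero_add]
  · intro x
    obtain ⟨x, rfl⟩ := hs x
    rw [← mapC_conj, hp, hp, ← mapC_conj, T.isSplitting.conj]

section

variable {Ψ : LinearMap.BilinForm ℂ (ℂ ⊗[ℤ] B)}

theorem mem_map_W₁C (hf : S.IsHom T f) {x : ℂ ⊗[ℤ] A} (hx : mapC f x ∈ complexify T.W₁) :
    mapC f x ∈ complexify (S.W₁.map (mapQ f)) := by
  obtain ⟨y, hy, e⟩ := hf.exists_mem_W₁C hx
  rw [complexify_map, ← e]
  exact ⟨y, hy, rfl⟩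

theorem map_W₁_le (hf : S.IsHom T f) : S.W₁.map (mapQ f) ≤ T.W₁ :=
  Submodule.map_le_iff_le_comap.2 hf.W₁

/-- The subspace `f(W₋₁)` is stable under the projections of Deligne's splitting. -/
theorem proj_mem_map_W₁ (hf : S.IsHom T f) {x : ℂ ⊗[ℤ] B}
    (hx : x ∈ complexify (S.W₁.map (mapQ f))) (i : Fin 4) :
    T.proj i x ∈ complexify (S.W₁.map (mapQ f)) := by
  have h : T.proj i x ∈ complexify T.W₁ := by
    have hx' := (T.isSplitting.mem_W₁ x).1 (complexify_mono hf.map_W₁_le hx)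
    rw [T.isSplitting.mem_W₁]
    by_cases hi : i = 0
    · rw [hi, hx', map_zero]
    · exact T.isSplitting.ortho _ _ (Ne.symm hi) x
  rw [complexify_map] at hx
  obtain ⟨z, -, rfl⟩ := hx
  rw [hf.mapC_proj] at h ⊢
  exact hf.mem_map_W₁C h

theorem mem_F₀_inf_of_proj_two (x : ℂ ⊗[ℤ] B) :
    conj B (T.proj 2 x) ∈ T.F₀ ⊓ complexify T.W₁ :=
  ⟨(T.proj_mem 2 x).1, conj_mem_complexify (T.proj_mem 2 x).2⟩

theorem apply_eq_of_mem_F₀_inf (hΨ : IsPolarization T.W₂ T.W₁ T.F₀ Ψ) {x y : ℂ ⊗[ℤ] B}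
    (hx : x ∈ complexify T.W₁) (hy : y ∈ complexify T.W₁) :
    Ψ x y = Ψ (T.proj 1 x) y + Ψ (T.proj 2 x) y := by
  have e := T.sum_proj x
  rw [(T.isSplitting.mem_W₁ x).1 hx, zero_add] at e
  conv_lhs => rw [← e]
  simp [hΨ.rad _ (T.proj_mem 3 x) y hy]

/-- Pairing `x` with the conjugate of its own `(-1,0)`-component isolates that component: the
`(0,-1)`-part is isotropic against it and the `W₋₂`-part is in the radical. Positivity then forces
it to vanish. -/
theorem proj_two_eq_zero (hΨ : IsPolarization T.W₂ T.W₁ T.F₀ Ψ)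
    {x : ℂ ⊗[ℤ] B} (hx : x ∈ complexify T.W₁) (h : Ψ x (conj B (T.proj 2 x)) = 0) :
    T.proj 2 x = 0 := by
  have hb := mem_F₀_inf_of_proj_two (T := T) x
  rw [apply_eq_of_mem_F₀_inf hΨ hx hb.2, hΨ.iso _ (T.proj_mem 1 x) _ hb, zero_add] at h
  have h0 := hΨ.eq_zero_of_apply_conj hb (by rw [conj_conj]; exact hΨ.symm_zero h)
  rw [← conj_conj (T.proj 2 x), h0, map_zero]

theorem proj_one_eq_zero (hΨ : IsPolarization T.W₂ T.W₁ T.F₀ Ψ)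
    {x : ℂ ⊗[ℤ] B} (hx : x ∈ complexify T.W₁) (h : Ψ x (conj B (T.proj 1 x)) = 0) :
    T.proj 1 x = 0 := by
  rw [apply_eq_of_mem_F₀_inf hΨ hx (conj_mem_complexify (T.proj_mem 1 x).2)] at h
  have h2 : Ψ (T.proj 2 x) (conj B (T.proj 1 x)) = 0 := by
    rw [← conj_conj (T.proj 2 x), hΨ.apply_conj,
      hΨ.iso _ (mem_F₀_inf_of_proj_two x) _ (T.proj_mem 1 x), map_zero]
  rw [h2, add_zero] at h
  exact hΨ.eq_zero_of_apply_conj (T.proj_mem 1 x) h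

theorem conj_proj_mem (hf : S.IsHom T f) {x : ℂ ⊗[ℤ] B}
    (hx : x ∈ complexify (S.W₁.map (mapQ f))) (i : Fin 4) :
    conj B (T.proj i x) ∈ complexify (S.W₁.map (mapQ f)) :=
  conj_mem_complexify (hf.proj_mem_map_W₁ hx i)

/-- The radical of the polarization on `f(W₋₁)` is contained in `W₋₂`. -/
theorem mem_W₂_of_forall (hf : S.IsHom T f) (hΨ : IsPolarization T.W₂ T.W₁ T.F₀ Ψ)
    {x : ℚ ⊗[ℤ] B} (hx : x ∈ S.W₁.map (mapQ f))
    (h : ∀ y ∈ S.W₁.map (mapQ f), Ψ (ratToComplex B x) (ratToComplex B y) = 0) : x ∈ T.W₂ := by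
  have h' (y : ℂ ⊗[ℤ] B) (hy : y ∈ complexify (S.W₁.map (mapQ f))) :
      Ψ (ratToComplex B x) y = 0 := by
    suffices complexify (S.W₁.map (mapQ f)) ≤ LinearMap.ker (Ψ (ratToComplex B x)) from this hy
    refine Submodule.span_le.2 ?_
    rintro _ ⟨y, hy, rfl⟩
    exact h y hy
  have hxC := ratToComplex_mem_complexify hx
  have hxW := complexify_mono hf.map_W₁_le hxC
  exact mem_of_ratToComplex_mem ((T.isSplitting.mem_W₂ _).2 ⟨(T.isSplitting.mem_W₁ _).1 hxW,
    proj_one_eq_zero hΨ hxW (h' _ (hf.conj_proj_mem hxC 1)),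
    proj_two_eq_zero hΨ hxW (h' _ (hf.conj_proj_mem hxC 2))⟩)

/-- The orthogonal complement of `f(W₋₁)` in `W₋₁`. -/
def orthogonalW₁ (S : LevelOneMHS A) (T : LevelOneMHS B) (f : A →+ B)
    (ψ : LinearMap.BilinForm ℚ (ℚ ⊗[ℤ] B)) : Submodule ℚ (ℚ ⊗[ℤ] B) :=
  T.W₁ ⊓ ψ.orthogonal (S.W₁.map (mapQ f))

variable {ψ : LinearMap.BilinForm ℚ (ℚ ⊗[ℤ] B)}

theorem rat_isAlt (hΨ : IsPolarization T.W₂ T.W₁ T.F₀ Ψ)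
    (hψ : ∀ x y, ((ψ x y : ℚ) : ℂ) = Ψ (ratToComplex B x) (ratToComplex B y)) : ψ.IsAlt :=
  fun x => Rat.cast_injective (α := ℂ) (by rw [hψ, hΨ.alt, Rat.cast_zero])

theorem rat_rad (hΨ : IsPolarization T.W₂ T.W₁ T.F₀ Ψ)
    (hψ : ∀ x y, ((ψ x y : ℚ) : ℂ) = Ψ (ratToComplex B x) (ratToComplex B y))
    {x y : ℚ ⊗[ℤ] B} (hx : x ∈ T.W₂) (hy : y ∈ T.W₁) : ψ x y = 0 :=
  Rat.cast_injective (α := ℂ) (by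
    rw [hψ, hΨ.rad _ (ratToComplex_mem_complexify hx) _ (ratToComplex_mem_complexify hy),
      Rat.cast_zero])

theorem mem_W₂_of_mem_orthogonal (hf : S.IsHom T f) (hΨ : IsPolarization T.W₂ T.W₁ T.F₀ Ψ)
    (hψ : ∀ x y, ((ψ x y : ℚ) : ℂ) = Ψ (ratToComplex B x) (ratToComplex B y))
    {x : ℚ ⊗[ℤ] B} (hx : x ∈ S.W₁.map (mapQ f)) (h : x ∈ orthogonalW₁ S T f ψ) : x ∈ T.W₂ := by
  refine hf.mem_W₂_of_forall hΨ hx fun y hy => ?_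
  rw [← hψ, (rat_isAlt hΨ hψ).isRefl _ _ (LinearMap.BilinForm.mem_orthogonal_iff.1 h.2 y hy),
    Rat.cast_zero]

theorem sup_orthogonalW₁ [Module.Finite ℤ B] (hf : S.IsHom T f)
    (hΨ : IsPolarization T.W₂ T.W₁ T.F₀ Ψ)
    (hψ : ∀ x y, ((ψ x y : ℚ) : ℂ) = Ψ (ratToComplex B x) (ratToComplex B y))
    {y : ℚ ⊗[ℤ] B} (hy : y ∈ T.W₁) :
    ∃ u ∈ S.W₁.map (mapQ f), ∃ n ∈ orthogonalW₁ S T f ψ, u + n = y := by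
  have halt := rat_isAlt hΨ hψ
  set I := S.W₁.map (mapQ f) with hI
  -- On `I` the form may degenerate along `I ∩ W₋₂`, and by positivity nowhere else. On the
  -- complement `C ∩ I` it is nondegenerate, so the whole space splits orthogonally there;
  -- orthogonality to `C ∩ I` within `W₋₁` is already orthogonality to `I`.
  obtain ⟨C, hC⟩ := Submodule.exists_isCompl (I ⊓ T.W₂)
  have hsup : (I ⊓ T.W₂) ⊔ (C ⊓ I) = I := by
    rw [← sup_inf_assoc_of_le C inf_le_left, hC.sup_eq_top, top_inf_eq]
  have ext {x : ℚ ⊗[ℤ] B} (hx : x ∈ T.W₁) (h : ∀ z ∈ C ⊓ I, ψ z x = 0) : ∀ z ∈ I, ψ z x = 0 := by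
    intro z hz
    rw [← hsup] at hz
    obtain ⟨w, hw, z', hz', rfl⟩ := Submodule.mem_sup.1 hz
    rw [map_add, LinearMap.add_apply, h z' hz', rat_rad hΨ hψ hw.2 hx, add_zero]
  have sep {x : ℚ ⊗[ℤ] B} (hx : x ∈ C ⊓ I) (h : ∀ z ∈ C ⊓ I, ψ z x = 0) : x = 0 := by
    have hxW := hf.map_W₁_le hx.2
    have h2 := hf.mem_W₂_of_mem_orthogonal hΨ hψ hx.2
      ⟨hxW, LinearMap.BilinForm.mem_orthogonal_iff.2 (ext hxW h)⟩
    exact Submodule.disjoint_def.1 hC.disjoint x ⟨hx.2, h2⟩ hx.1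
  have hnd : (ψ.restrict (C ⊓ I)).Nondegenerate := by
    constructor
    · intro x hx
      exact Subtype.ext (sep x.2 fun z hz => halt.isRefl _ _ (hx ⟨z, hz⟩))
    · intro x hx
      exact Subtype.ext (sep x.2 fun z hz => hx ⟨z, hz⟩)
  have hc := LinearMap.BilinForm.isCompl_orthogonal_of_restrict_nondegenerate halt.isRefl hnd
  have hy' : y ∈ (C ⊓ I) ⊔ ψ.orthogonal (C ⊓ I) := by rw [hc.sup_eq_top]; trivial
  obtain ⟨u, hu, n, hn, rfl⟩ := Submodule.mem_sup.1 hy'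
  have hnW : n ∈ T.W₁ := by
    simpa using T.W₁.sub_mem hy (hf.map_W₁_le hu.2)
  exact ⟨u, hu.2, n, ⟨hnW, LinearMap.BilinForm.mem_orthogonal_iff.2
    (ext hnW (LinearMap.BilinForm.mem_orthogonal_iff.1 hn))⟩, rfl⟩

theorem mapQ_eq_zero (hex : Function.Exact f π) {x : ℚ ⊗[ℤ] B} (hx : x ∈ S.W₁.map (mapQ f)) :
    mapQ π x = 0 := by
  obtain ⟨z, -, rfl⟩ := hx
  exact (mapQ_exact hex).apply_apply_eq_zero z

/-- A rational section of `W₋₁ → π(W₋₁)` with values in the orthogonal complement of `f(W₋₁)`. -/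
theorem exists_section [Module.Finite ℤ B] (hf : S.IsHom T f) (hex : Function.Exact f π)
    (hΨ : IsPolarization T.W₂ T.W₁ T.F₀ Ψ)
    (hψ : ∀ x y, ((ψ x y : ℚ) : ℂ) = Ψ (ratToComplex B x) (ratToComplex B y)) :
    ∃ s : (ℚ ⊗[ℤ] D) →ₗ[ℚ] (ℚ ⊗[ℤ] B), ∀ q ∈ T.W₁.map (mapQ π),
      s q ∈ orthogonalW₁ S T f ψ ∧ mapQ π (s q) = q := by
  let ρ : orthogonalW₁ S T f ψ →ₗ[ℚ] T.W₁.map (mapQ π) :=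
    (mapQ π).restrict fun x hx => ⟨x, hx.1, rfl⟩
  have hρ : LinearMap.range ρ = ⊤ := by
    rw [LinearMap.range_eq_top]
    rintro ⟨_, y, hy, rfl⟩
    obtain ⟨u, hu, n, hn, rfl⟩ := hf.sup_orthogonalW₁ hΨ hψ hy
    refine ⟨⟨n, hn⟩, Subtype.ext ?_⟩
    change mapQ π n = mapQ π (u + n)
    rw [map_add, mapQ_eq_zero hex hu, zero_add]
  obtain ⟨g, hg⟩ := ρ.exists_rightInverse_of_surjective hρ
  obtain ⟨s, hs⟩ := LinearMap.exists_extend ((orthogonalW₁ S T f ψ).subtype ∘ₗ g)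
  refine ⟨s, fun q hq => ?_⟩
  have e : s q = g ⟨q, hq⟩ := LinearMap.congr_fun hs ⟨q, hq⟩
  rw [e]
  exact ⟨(g ⟨q, hq⟩).2, congrArg Subtype.val (LinearMap.congr_fun hg ⟨q, hq⟩)⟩

/-- The vectors `s (π w)` and `w` are both orthogonal to `f(W₋₁)`, and their difference lies in
`f(W₋₁)`. It is therefore in the radical there, hence in `W₋₂`. -/
theorem section_mem_W₂ (hf : S.IsHom T f) (hex : Function.Exact f π)
    (hΨ : IsPolarization T.W₂ T.W₁ T.F₀ Ψ)
    (hψ : ∀ x y, ((ψ x y : ℚ) : ℂ) = Ψ (ratToComplex B x) (ratToComplex B y))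
    {s : (ℚ ⊗[ℤ] D) →ₗ[ℚ] (ℚ ⊗[ℤ] B)} (hs : ∀ q ∈ T.W₁.map (mapQ π),
      s q ∈ orthogonalW₁ S T f ψ ∧ mapQ π (s q) = q) {q : ℚ ⊗[ℤ] D} (hq : q ∈ T.W₂.map (mapQ π)) :
    s q ∈ T.W₂ := by
  obtain ⟨w, hw, rfl⟩ := hq
  obtain ⟨h1, h2⟩ := hs (mapQ π w) ⟨w, T.W₂_le_W₁ hw, rfl⟩
  have hwN : w ∈ orthogonalW₁ S T f ψ := by
    refine ⟨T.W₂_le_W₁ hw, LinearMap.BilinForm.mem_orthogonal_iff.2 fun y hy => ?_⟩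
    exact (rat_isAlt hΨ hψ).isRefl _ _ (rat_rad hΨ hψ hw (hf.map_W₁_le hy))
  have hd : s (mapQ π w) - w ∈ orthogonalW₁ S T f ψ := Submodule.sub_mem _ h1 hwN
  have hI : s (mapQ π w) - w ∈ S.W₁.map (mapQ f) := by
    obtain ⟨z, hz⟩ := (mapQ_exact hex (s (mapQ π w) - w)).1 (by rw [map_sub, h2, sub_self])
    obtain ⟨y, hy, e⟩ := hf.exists_mem_W₁ (x := z) (by rw [hz]; exact hd.1)
    exact ⟨y, hy, e.trans hz⟩
  simpa using T.W₂.add_mem (hf.mem_W₂_of_mem_orthogonal hΨ hψ hI hd) hw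

theorem apply_eq_zero_of_mem_orthogonal (hΨ : IsPolarization T.W₂ T.W₁ T.F₀ Ψ)
    (hψ : ∀ x y, ((ψ x y : ℚ) : ℂ) = Ψ (ratToComplex B x) (ratToComplex B y))
    {n u : ℂ ⊗[ℤ] B} (hn : n ∈ complexify (orthogonalW₁ S T f ψ))
    (hu : u ∈ complexify (S.W₁.map (mapQ f))) : Ψ n u = 0 := by
  suffices complexify (orthogonalW₁ S T f ψ) ≤ LinearMap.ker (Ψ.flip u) from this hn
  refine Submodule.span_le.2 ?_
  rintro _ ⟨n, hn, rfl⟩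
  suffices complexify (S.W₁.map (mapQ f)) ≤ LinearMap.ker (Ψ (ratToComplex B n)) from this hu
  refine Submodule.span_le.2 ?_
  rintro _ ⟨u, hu, rfl⟩
  refine hΨ.symm_zero ?_
  rw [← hψ, LinearMap.BilinForm.mem_orthogonal_iff.1 hn.2 u hu, Rat.cast_zero]

/-- A rational section need not respect `F⁰`, but the orthogonal one does up to `W₋₂`, which is
enough since `W₋₂` pairs trivially with `W₋₁`. The lift is compared with one in `F⁰ ∩ W₋₁`, and the
discrepancy `u` in `f(W₋₁)` is shown to have no `(-1,0)`-component. -/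
theorem section_mem_F₀ (hf : S.IsHom T f) (hπ : Function.Surjective π) (hex : Function.Exact f π)
    (hΨ : IsPolarization T.W₂ T.W₁ T.F₀ Ψ)
    (hψ : ∀ x y, ((ψ x y : ℚ) : ℂ) = Ψ (ratToComplex B x) (ratToComplex B y))
    {s : (ℚ ⊗[ℤ] D) →ₗ[ℚ] (ℚ ⊗[ℤ] B)} (hs : ∀ q ∈ T.W₁.map (mapQ π),
      s q ∈ orthogonalW₁ S T f ψ ∧ mapQ π (s q) = q) {x : ℂ ⊗[ℤ] D}
    (hx : x ∈ T.F₀.map (mapC π) ⊓ complexify (T.W₁.map (mapQ π))) :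
    ∃ y ∈ T.F₀ ⊓ complexify T.W₁, ∃ w ∈ complexify T.W₂, mapC π y = x ∧ extendC s x = y + w := by
  obtain ⟨p, hp⟩ := hf.exists_proj_quotient hπ hex
  have hsp := isSplitting_map hπ hp
  have hx' := (hsp.mem_F₀_inf x).1 hx
  obtain ⟨y, rfl⟩ := mapC_surjective hπ x
  have hy : mapC π (T.proj 1 y) = mapC π y := by
    have e := hsp.sum (mapC π y)
    rwa [hx'.1, hx'.2.1, hx'.2.2, zero_add, add_zero, add_zero, hp] at e
  have hy1 := T.proj_mem 1 y
  rw [← hy] at hx ⊢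
  generalize T.proj 1 y = y at hx hy1
  have hn : extendC s (mapC π y) ∈ complexify (orthogonalW₁ S T f ψ) :=
    extendC_mem_complexify (fun q hq => (hs q hq).1) hx.2
  have hπs : mapC π (extendC s (mapC π y)) = mapC π y := by
    suffices complexify (T.W₁.map (mapQ π)) ≤ LinearMap.eqLocus (mapC π ∘ₗ extendC s) LinearMap.id
      from this hx.2
    refine Submodule.span_le.2 ?_
    rintro _ ⟨q, hq, rfl⟩
    change mapC π (extendC s _) = _
    rw [extendC_ratToComplex, mapC_ratToComplex, (hs q hq).2]
    rfl
  have hu : y - extendC s (mapC π y) ∈ complexify (S.W₁.map (mapQ f)) := by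
    obtain ⟨z, hz⟩ := (mapC_exact hex (y - extendC s (mapC π y))).1 (by
      rw [map_sub, hπs, sub_self])
    rw [← hz]
    refine hf.mem_map_W₁C ?_
    rw [hz]
    exact Submodule.sub_mem _ hy1.2 (complexify_mono inf_le_left hn)
  set n := extendC s (mapC π y) with hndef
  set u := y - n with hudef
  have huW := complexify_mono hf.map_W₁_le hu
  -- In the pairing of `u = y - n` with `conj (T.proj 2 u)`, the `y`-term vanishes because both
  -- vectors lie in `F⁰ ∩ W₋₁`, the `n`-term because `n` is orthogonal to `f(W₋₁)`.
  have h2 : T.proj 2 u = 0 := by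
    refine proj_two_eq_zero hΨ huW ?_
    rw [hudef, map_sub, LinearMap.sub_apply, ← hudef,
      hΨ.iso _ hy1 _ (mem_F₀_inf_of_proj_two u),
      apply_eq_zero_of_mem_orthogonal hΨ hψ hn (hf.conj_proj_mem hu 2), sub_zero]
  have e := T.sum_proj u
  rw [(T.isSplitting.mem_W₁ u).1 huW, h2, zero_add, add_zero] at e
  refine ⟨y - T.proj 1 u, Submodule.sub_mem _ hy1 (T.proj_mem 1 u), -T.proj 3 u,
    Submodule.neg_mem _ (T.proj_mem 3 u), ?_, ?_⟩
  · have h1 := hf.proj_mem_map_W₁ hu 1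
    rw [complexify_map] at h1
    obtain ⟨z, -, hz⟩ := h1
    rw [map_sub, ← hz, (mapC_exact hex).apply_apply_eq_zero, sub_zero]
  · have : n = y - u := by rw [hudef, sub_sub_cancel]
    rw [this]
    conv_lhs => rw [← e]
    abel

/-- The form is pulled back along the complexified orthogonal section. On `F⁰ ∩ W₋₁` its values
agree with those of `Ψ` on lifts in `F⁰ ∩ W₋₁`, so the Riemann relations are inherited. -/
theorem exists_isPolarization_map [Module.Finite ℤ B] (hf : S.IsHom T f)
    (hπ : Function.Surjective π) (hex : Function.Exact f π) :
    ∃ Ψ, IsPolarization (T.W₂.map (mapQ π)) (T.W₁.map (mapQ π)) (T.F₀.map (mapC π)) Ψ := by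
  obtain ⟨Ψ, hΨ⟩ := T.exists_isPolarization
  obtain ⟨ψ, hψ⟩ := hΨ.exists_rat_form
  obtain ⟨s, hs⟩ := hf.exists_section hex hΨ hψ
  refine ⟨Ψ.compl₁₂ (extendC s) (extendC s), ?_⟩
  constructor
  · intro a b
    refine ⟨ψ (s (1 ⊗ₜ a)) (s (1 ⊗ₜ b)), ?_⟩
    rw [hψ, ← extendC_ratToComplex, ← extendC_ratToComplex, ratToComplex_tmul, ratToComplex_tmul,
      Rat.cast_one]
    rfl
  · exact fun x => hΨ.alt _
  · intro x hx y hy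
    exact hΨ.rad _ (extendC_mem_complexify (fun q hq => hf.section_mem_W₂ hex hΨ hψ hs hq) hx) _
      (extendC_mem_complexify (fun q hq => (hs q hq).1.1) hy)
  · intro x hx y hy
    obtain ⟨x', hx', w, hw, -, ex⟩ := hf.section_mem_F₀ hπ hex hΨ hψ hs hx
    obtain ⟨y', hy', v, hv, -, ey⟩ := hf.section_mem_F₀ hπ hex hΨ hψ hs hy
    rw [LinearMap.compl₁₂_apply, ex, ey, hΨ.apply_add_add T.W₂_le_W₁ hx'.2 hy'.2 hw hv,
      hΨ.iso _ hx' _ hy']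
  · intro x hx hne
    obtain ⟨x', hx', w, hw, e, ex⟩ := hf.section_mem_F₀ hπ hex hΨ hψ hs hx
    rw [LinearMap.compl₁₂_apply, extendC_conj, ex, map_add (conj B), hΨ.apply_add_add T.W₂_le_W₁ hx'.2
      (conj_mem_complexify hx'.2) hw (conj_mem_complexify hw)]
    refine hΨ.pos _ hx' ?_
    rintro rfl
    exact hne (by rw [← e, map_zero])

end

/-- The quotient mixed Hodge structure. -/
def quotient [Module.Finite ℤ B] (hf : S.IsHom T f)
    (hπ : Function.Surjective π) (hex : Function.Exact f π) : LevelOneMHS D :=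
  (isSplitting_map hπ (hf.exists_proj_quotient hπ hex).choose_spec).toMHS
    (hf.exists_isPolarization_map hπ hex)

end LevelOneMHS.IsHom

end Quotient

/-! ### Left exactness in terms of fibre products of algebras -/

section LeftExact

instance (R : FinAlg) : Module.Finite ℂ R.obj := R.property

/-- The algebra homomorphism underlying a morphism of `FinAlg`. -/
abbrev FinAlg.toAlgHom {R S : FinAlg} (φ : R ⟶ S) : R.obj →ₐ[ℂ] S.obj := φ.hom.hom

/-- The morphism of `FinAlg` given by an algebra homomorphism. -/
abbrev FinAlg.homOf {R S : FinAlg} (φ : R.obj →ₐ[ℂ] S.obj) : R ⟶ S :=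
  FinAlg.ofHom (R := R.obj) (S := S.obj) φ

/-- The homomorphism `F(R) → F(S)` induced by `R → S`. -/
abbrev pts (F : FinAlg ⥤ AddCommGrpCat.{0}) {R S : FinAlg} (φ : R ⟶ S) : F.obj R →+ F.obj S :=
  (F.map φ).hom

theorem pts_comp (F : FinAlg ⥤ AddCommGrpCat.{0}) {R S T : FinAlg} (φ : R ⟶ S) (ψ : S ⟶ T)
    (x : F.obj R) : pts F (φ ≫ ψ) x = pts F ψ (pts F φ x) := by
  simp [pts]

theorem pts_id (F : FinAlg ⥤ AddCommGrpCat.{0}) {R : FinAlg} (x : F.obj R) :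
    pts F (𝟙 R) x = x := by
  simp [pts]

theorem pts_naturality {F G : FinAlg ⥤ AddCommGrpCat.{0}} (α : F ⟶ G) {R S : FinAlg} (φ : R ⟶ S)
    (x : F.obj R) : (α.app S).hom (pts F φ x) = pts G φ ((α.app R).hom x) :=
  congrArg (fun f => f.hom x) (α.naturality φ)

theorem FinAlg.hom_ext {R S : FinAlg} {φ ψ : R ⟶ S} (h : ∀ x, toAlgHom φ x = toAlgHom ψ x) :
    φ = ψ :=
  ObjectProperty.hom_ext _ (CommAlgCat.hom_ext (AlgHom.ext h))

/-- A square of finite-dimensional algebras is a fibre product of the underlying sets. -/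
structure IsFibreProduct {P R S T : FinAlg} (p : P ⟶ R) (q : P ⟶ S) (f : R ⟶ T) (g : S ⟶ T) :
    Prop where
  comm : p ≫ f = q ≫ g
  inj : ∀ x y, FinAlg.toAlgHom p x = FinAlg.toAlgHom p y →
    FinAlg.toAlgHom q x = FinAlg.toAlgHom q y → x = y
  surj : ∀ r s, FinAlg.toAlgHom f r = FinAlg.toAlgHom g s →
    ∃ x, FinAlg.toAlgHom p x = r ∧ FinAlg.toAlgHom q x = s

/-- The lift is chosen elementwise; since `p` and `q` are jointly injective algebra homomorphisms,
it is forced to be one too. -/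
theorem IsFibreProduct.isPullback {P R S T : FinAlg} {p : P ⟶ R} {q : P ⟶ S} {f : R ⟶ T}
    {g : S ⟶ T} (h : IsFibreProduct p q f g) : IsPullback p q f g := by
  have key (W : FinAlg) (a : W ⟶ R) (b : W ⟶ S) (hab : a ≫ f = b ≫ g) :
      ∃ l : W ⟶ P, l ≫ p = a ∧ l ≫ q = b := by
    have hw (w : W.obj) : ∃ x, FinAlg.toAlgHom p x = FinAlg.toAlgHom a w ∧
        FinAlg.toAlgHom q x = FinAlg.toAlgHom b w :=
      h.surj _ _ (congrArg (fun m => FinAlg.toAlgHom m w) hab)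
    choose l hl hl' using hw
    refine ⟨FinAlg.homOf
      { toFun := l, map_one' := ?_, map_mul' := ?_, map_zero' := ?_, map_add' := ?_,
        commutes' := ?_ }, FinAlg.hom_ext hl, FinAlg.hom_ext hl'⟩
    all_goals intros; apply h.inj <;> simp [hl, hl']
  refine ⟨⟨h.comm⟩, ⟨PullbackCone.IsLimit.mk _ (fun s => (key _ s.fst s.snd s.condition).choose)
    (fun s => (key _ s.fst s.snd s.condition).choose_spec.1)
    (fun s => (key _ s.fst s.snd s.condition).choose_spec.2) ?_⟩⟩
  intro s m h1 h2
  obtain ⟨h3, h4⟩ := (key _ s.fst s.snd s.condition).choose_spec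
  refine FinAlg.hom_ext fun x => h.inj _ _ ?_ ?_
  · exact congrArg (fun m => FinAlg.toAlgHom m x) (h1.trans h3.symm)
  · exact congrArg (fun m => FinAlg.toAlgHom m x) (h2.trans h4.symm)

theorem FinAlg.exists_isFibreProduct {R S T : FinAlg} (f : R ⟶ T) (g : S ⟶ T) :
    ∃ (P : FinAlg) (p : P ⟶ R) (q : P ⟶ S), IsFibreProduct p q f g := by
  let E := AlgHom.equalizer ((FinAlg.toAlgHom f).comp (AlgHom.fst ℂ R.obj S.obj))
    ((FinAlg.toAlgHom g).comp (AlgHom.snd ℂ R.obj S.obj))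
  have : Module.Finite ℂ E := inferInstanceAs (Module.Finite ℂ (Subalgebra.toSubmodule E))
  refine ⟨FinAlg.of E, FinAlg.ofHom (S := R.obj) ((AlgHom.fst ℂ R.obj S.obj).comp E.val),
    FinAlg.ofHom (S := S.obj) ((AlgHom.snd ℂ R.obj S.obj).comp E.val), ?_, ?_, ?_⟩
  · exact FinAlg.hom_ext fun x => x.2
  · exact fun x y h1 h2 => Subtype.ext (Prod.ext h1 h2)
  · exact fun r s h => ⟨⟨(r, s), h⟩, rfl, rfl⟩

instance : Module.Finite ℂ PUnit := inferInstance

/-- The zero algebra. -/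
abbrev FinAlg.zeroAlg : FinAlg := FinAlg.of PUnit

/-- The zero algebra is terminal. -/
def FinAlg.isTerminalOfSubsingleton (R : FinAlg) [Subsingleton R.obj] : IsTerminal R :=
  IsTerminal.ofUniqueHom (fun _ => FinAlg.homOf
    { toFun := fun _ => 0
      map_one' := Subsingleton.elim _ _
      map_mul' := fun _ _ => Subsingleton.elim _ _
      map_zero' := Subsingleton.elim _ _
      map_add' := fun _ _ => Subsingleton.elim _ _
      commutes' := fun _ => Subsingleton.elim _ _ })
    (fun _ _ => FinAlg.hom_ext fun _ => Subsingleton.elim _ _)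

/-- An elementary form of left exactness. -/
class IsLex (F : FinAlg ⥤ AddCommGrpCat.{0}) : Prop where
  zero : ∀ R : FinAlg, Subsingleton R.obj → Subsingleton (F.obj R)
  inj : ∀ {P R S T : FinAlg} {p : P ⟶ R} {q : P ⟶ S} {f : R ⟶ T} {g : S ⟶ T},
    IsFibreProduct p q f g → ∀ x : F.obj P, pts F p x = 0 → pts F q x = 0 → x = 0
  surj : ∀ {P R S T : FinAlg} {p : P ⟶ R} {q : P ⟶ S} {f : R ⟶ T} {g : S ⟶ T},
    IsFibreProduct p q f g → ∀ (r : F.obj R) (s : F.obj S), pts F f r = pts F g s →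
      ∃ x, pts F p x = r ∧ pts F q x = s

theorem isPullback_of_elements {P R S T : AddCommGrpCat.{0}} {p : P ⟶ R} {q : P ⟶ S} {f : R ⟶ T}
    {g : S ⟶ T} (comm : p ≫ f = q ≫ g) (inj : ∀ x, p.hom x = 0 → q.hom x = 0 → x = 0)
    (surj : ∀ r s, f.hom r = g.hom s → ∃ x, p.hom x = r ∧ q.hom x = s) : IsPullback p q f g := by
  refine IsPullback.of_map (forget AddCommGrpCat.{0}) comm ?_
  rw [Types.isPullback_iff]
  refine ⟨by rw [← Functor.map_comp, comm, Functor.map_comp], ?_, surj⟩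
  rintro x y ⟨h1, h2⟩
  refine sub_eq_zero.1 (inj _ ?_ ?_)
  · rw [map_sub, sub_eq_zero]; exact h1
  · rw [map_sub, sub_eq_zero]; exact h2

instance IsLex.of_preservesFiniteLimits (F : FinAlg ⥤ AddCommGrpCat.{0}) [PreservesFiniteLimits F] :
    IsLex F where
  zero R _ := by
    have h := (FinAlg.isTerminalOfSubsingleton R).isTerminalObj F
    exact AddCommGrpCat.subsingleton_of_isZero
      ((isZero_zero AddCommGrpCat).of_iso (h.uniqueUpToIso HasZeroObject.zeroIsTerminal))
  inj h x h1 h2 := by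
    have h' := (h.isPullback.map F).map (forget AddCommGrpCat.{0})
    refine Types.ext_of_isPullback h' (y₁ := (0 : F.obj _)) ?_ ?_
    · exact h1.trans (map_zero (pts F _)).symm
    · exact h2.trans (map_zero (pts F _)).symm
  surj h r s hrs := by
    have h' := (h.isPullback.map F).map (forget AddCommGrpCat.{0})
    exact Types.exists_of_isPullback h' r s hrs

theorem IsLex.preservesFiniteLimits (F : FinAlg ⥤ AddCommGrpCat.{0}) [h : IsLex F] :
    PreservesFiniteLimits F := by
  have : Subsingleton FinAlg.zeroAlg.obj := inferInstanceAs (Subsingleton PUnit)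
  have : HasTerminal FinAlg := (FinAlg.isTerminalOfSubsingleton FinAlg.zeroAlg).hasTerminal
  have (R S T : FinAlg) (f : R ⟶ T) (g : S ⟶ T) : HasLimit (cospan f g) := by
    obtain ⟨P, p, q, hpq⟩ := FinAlg.exists_isFibreProduct f g
    exact hpq.isPullback.hasPullback
  have : HasPullbacks FinAlg := hasPullbacks_of_hasLimit_cospan _
  have : PreservesLimitsOfShape (Discrete PEmpty.{1}) F := by
    have : PreservesLimit (Functor.empty.{0} FinAlg) F := by
      have hs := h.zero FinAlg.zeroAlg inferInstance
      have hz : IsZero (F.obj FinAlg.zeroAlg) := AddCommGrpCat.isZero_of_subsingleton _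
      exact preservesTerminal_of_iso F
        (F.mapIso (terminalIsTerminal.uniqueUpToIso
          (FinAlg.isTerminalOfSubsingleton FinAlg.zeroAlg)) ≪≫
          hz.isTerminal.uniqueUpToIso terminalIsTerminal)
    exact preservesLimitsOfShape_pempty_of_preservesTerminal F
  have : PreservesLimitsOfShape WalkingCospan F := by
    refine ⟨fun {K} => ?_⟩
    obtain ⟨P, p, q, hpq⟩ := FinAlg.exists_isFibreProduct (K.map WalkingCospan.Hom.inl)
      (K.map WalkingCospan.Hom.inr)
    have : PreservesLimit (cospan (K.map WalkingCospan.Hom.inl) (K.map WalkingCospan.Hom.inr)) F := by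
      refine preservesLimit_of_preserves_limit_cone hpq.isPullback.isLimit
        ((isLimitMapConePullbackConeEquiv F hpq.comm).symm ?_)
      exact (isPullback_of_elements (by rw [← F.map_comp, hpq.comm, F.map_comp])
        (h.inj hpq) (h.surj hpq)).isLimit
    exact preservesLimit_of_iso_diagram F (diagramIsoCospan K).symm
  exact preservesFiniteLimits_of_preservesTerminal_and_pullbacks F

namespace IsLex

variable {F : FinAlg ⥤ AddCommGrpCat.{0}}

theorem inj' [h : IsLex F] {P R S T : FinAlg} {p : P ⟶ R} {q : P ⟶ S} {f : R ⟶ T} {g : S ⟶ T}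
    (hpq : IsFibreProduct p q f g) {x y : F.obj P} (h1 : pts F p x = pts F p y)
    (h2 : pts F q x = pts F q y) : x = y :=
  sub_eq_zero.1 (h.inj hpq _ (by rw [map_sub, h1, sub_self]) (by rw [map_sub, h2, sub_self]))

/-- An injection has trivial kernel pair, so `R` is its own fibre product over `S`. -/
theorem injective [h : IsLex F] {R S : FinAlg} {φ : R ⟶ S} (hφ : Function.Injective (FinAlg.toAlgHom φ)) :
    Function.Injective (pts F φ) := by
  have hp : IsFibreProduct (𝟙 R) (𝟙 R) φ φ :=
    ⟨rfl, fun x y h _ => h, fun r s e => ⟨r, rfl, hφ e⟩⟩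
  intro x y hxy
  obtain ⟨z, rfl, h2⟩ := h.surj hp x y hxy
  rw [pts_id] at h2
  rw [pts_id, h2]

end IsLex

end LeftExact

/-! ### Truncated polynomials, dual numbers and the Taylor shift -/

section Algebras

namespace FinAlg

theorem toAlgHom_comp {R S T : FinAlg} (φ : R ⟶ S) (ψ : S ⟶ T) (x : R.obj) :
    toAlgHom (φ ≫ ψ) x = toAlgHom ψ (toAlgHom φ x) := rfl

instance (R : FinAlg) (n : ℕ) :
    Module.Finite ℂ (Polynomial R.obj ⧸ Ideal.span {(Polynomial.X : Polynomial R.obj) ^ n}) :=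
  haveI := (Polynomial.monic_X_pow (R := R.obj) n).finite_quotient
  Module.Finite.trans R.obj _

/-- The truncated polynomial algebra `R[X] / (X ^ n)`. -/
def trunc (R : FinAlg) (n : ℕ) : FinAlg :=
  of (Polynomial R.obj ⧸ Ideal.span {(Polynomial.X : Polynomial R.obj) ^ n})

/-- The class of a polynomial in `R[X] / (X ^ n)`. -/
def trunc.mk {R : FinAlg} (n : ℕ) : Polynomial R.obj →ₐ[ℂ] (trunc R n).obj :=
  Ideal.Quotient.mkₐ ℂ _

theorem trunc.mk_surjective {R : FinAlg} {n : ℕ} : Function.Surjective (trunc.mk (R := R) n) :=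
  Ideal.Quotient.mkₐ_surjective ℂ _

theorem trunc.mk_eq_zero {R : FinAlg} {n : ℕ} {p : Polynomial R.obj} :
    trunc.mk n p = 0 ↔ Polynomial.X ^ n ∣ p :=
  Ideal.Quotient.eq_zero_iff_mem.trans Ideal.mem_span_singleton

theorem trunc.X_pow {R : FinAlg} {n : ℕ} : trunc.mk (R := R) n Polynomial.X ^ n = 0 := by
  rw [← map_pow, trunc.mk_eq_zero]

theorem trunc.X_pow_of_le {R : FinAlg} {n m : ℕ} (h : n ≤ m) :
    trunc.mk (R := R) n Polynomial.X ^ m = 0 :=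
  pow_eq_zero_of_le h trunc.X_pow

/-- The inclusion `R → R[X] / (X ^ n)`. -/
def trunc.incl (R : FinAlg) (n : ℕ) : R ⟶ trunc R n :=
  homOf ((trunc.mk n).comp (IsScalarTower.toAlgHom ℂ R.obj (Polynomial R.obj)))

theorem trunc.incl_apply (R : FinAlg) (n : ℕ) (a : R.obj) :
    toAlgHom (trunc.incl R n) a = trunc.mk n (Polynomial.C a) := rfl

/-- The homomorphism `R[X] / (X ^ n) → S` with `X ↦ x`. -/
def trunc.lift {R S : FinAlg} {n : ℕ} (φ : R ⟶ S) (x : S.obj) (hx : x ^ n = 0) :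
    trunc R n ⟶ S :=
  homOf (R := trunc R n) (Ideal.Quotient.liftₐ _ (Polynomial.eval₂AlgHom (toAlgHom φ) x fun _ => Commute.all _ _) (by
    intro a ha
    obtain ⟨b, rfl⟩ := Ideal.mem_span_singleton.1 ha
    simp [hx]))

theorem trunc.lift_X {R S : FinAlg} {n : ℕ} (φ : R ⟶ S) (x : S.obj) (hx : x ^ n = 0) :
    toAlgHom (trunc.lift φ x hx) (trunc.mk n Polynomial.X) = x := by
  change Polynomial.eval₂ _ x Polynomial.X = x
  simp

theorem trunc.incl_lift {R S : FinAlg} {n : ℕ} (φ : R ⟶ S) (x : S.obj) (hx : x ^ n = 0) :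
    trunc.incl R n ≫ trunc.lift φ x hx = φ := by
  refine FinAlg.hom_ext fun a => ?_
  change Polynomial.eval₂ (toAlgHom φ : R.obj →+* S.obj) x (Polynomial.C a) = _
  simp

theorem trunc.hom_ext {R S : FinAlg} {n : ℕ} {φ ψ : trunc R n ⟶ S}
    (h1 : trunc.incl R n ≫ φ = trunc.incl R n ≫ ψ)
    (h2 : toAlgHom φ (trunc.mk n Polynomial.X) = toAlgHom ψ (trunc.mk n Polynomial.X)) : φ = ψ := by
  have h : (toAlgHom φ).comp (trunc.mk n) = (toAlgHom ψ).comp (trunc.mk n) := by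
    refine AlgHom.ext fun p => ?_
    induction p using Polynomial.induction_on' with
    | add p q hp hq => rw [map_add, map_add, hp, hq]
    | monomial k a =>
      have h3 : toAlgHom φ (trunc.mk n (Polynomial.C a)) =
          toAlgHom ψ (trunc.mk n (Polynomial.C a)) := by
        rw [← trunc.incl_apply, ← toAlgHom_comp, h1, toAlgHom_comp]
      rw [← Polynomial.C_mul_X_pow_eq_monomial, map_mul, map_mul, map_pow, map_pow,
        AlgHom.comp_apply, AlgHom.comp_apply, AlgHom.comp_apply, AlgHom.comp_apply, h2, h3]
  refine FinAlg.hom_ext fun x => ?_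
  obtain ⟨p, rfl⟩ := trunc.mk_surjective x
  exact AlgHom.congr_fun h p

/-- The dual numbers over `R`. -/
def dualOver (R : FinAlg) : FinAlg :=
  haveI : Module.Finite ℂ (DualNumber R.obj) := inferInstanceAs (Module.Finite ℂ (R.obj × R.obj))
  of (DualNumber R.obj)

/-- The inclusion `R → R[ε]`. -/
def dualOver.incl (R : FinAlg) : R ⟶ dualOver R :=
  homOf (S := dualOver R) (TrivSqZeroExt.inlAlgHom ℂ R.obj R.obj)

/-- The reduction `R[ε] → R`. -/
def dualOver.fst (R : FinAlg) : dualOver R ⟶ R :=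
  homOf (R := dualOver R) (TrivSqZeroExt.fstHom ℂ R.obj R.obj)

/-- The coefficient of `ε`. -/
def dualOver.snd (R : FinAlg) : (dualOver R).obj →+ R.obj :=
  (TrivSqZeroExt.sndHom R.obj R.obj).toAddMonoidHom

/-- The element `ε` of `R[ε]`. -/
def dualOver.eps (R : FinAlg) : (dualOver R).obj := (DualNumber.eps : DualNumber R.obj)

theorem dualOver.ext {R : FinAlg} {a b : (dualOver R).obj}
    (h1 : toAlgHom (dualOver.fst R) a = toAlgHom (dualOver.fst R) b)
    (h2 : dualOver.snd R a = dualOver.snd R b) : a = b :=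
  TrivSqZeroExt.ext h1 h2

@[simp]
theorem dualOver.fst_incl {R : FinAlg} (a : R.obj) :
    toAlgHom (dualOver.fst R) (toAlgHom (dualOver.incl R) a) = a := rfl

@[simp]
theorem dualOver.snd_incl {R : FinAlg} (a : R.obj) :
    dualOver.snd R (toAlgHom (dualOver.incl R) a) = 0 := rfl

@[simp]
theorem dualOver.fst_eps {R : FinAlg} : toAlgHom (dualOver.fst R) (dualOver.eps R) = 0 := rfl

@[simp]
theorem dualOver.snd_eps {R : FinAlg} : dualOver.snd R (dualOver.eps R) = 1 := rfl

@[simp]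
theorem dualOver.snd_mul {R : FinAlg} (a b : (dualOver R).obj) : dualOver.snd R (a * b) =
    toAlgHom (dualOver.fst R) a * dualOver.snd R b +
      toAlgHom (dualOver.fst R) b * dualOver.snd R a :=
  (TrivSqZeroExt.snd_mul (R := R.obj) (M := R.obj) a b).trans
    (congrArg (_ + ·) (mul_comm (dualOver.snd R a) _))

theorem dualOver.snd_pow {R : FinAlg} (a : (dualOver R).obj) (n : ℕ) : dualOver.snd R (a ^ n) =
    n * toAlgHom (dualOver.fst R) a ^ (n - 1) * dualOver.snd R a := by
  refine (TrivSqZeroExt.snd_pow (R := R.obj) (M := R.obj) a n).trans ?_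
  rw [nsmul_eq_mul, smul_eq_mul, mul_assoc]
  rfl

theorem dualOver.eps_sq (R : FinAlg) : dualOver.eps R ^ 2 = 0 :=
  dualOver.ext (by simp) (by simp [pow_two])

theorem dualOver.eq_incl_add {R : FinAlg} (a : (dualOver R).obj) :
    a = toAlgHom (dualOver.incl R) (toAlgHom (dualOver.fst R) a) +
      toAlgHom (dualOver.incl R) (dualOver.snd R a) * dualOver.eps R :=
  dualOver.ext (by simp) (by simp)

/-- The homomorphism `R[ε] → S` with `ε ↦ x`. -/
def dualOver.lift {R S : FinAlg} (φ : R ⟶ S) (x : S.obj) (hx : x ^ 2 = 0) : dualOver R ⟶ S :=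
  homOf (R := dualOver R)
    (DualNumber.lift ⟨(toAlgHom φ, x), by rw [← pow_two, hx], fun _ => Commute.all _ _⟩)

theorem dualOver.lift_eps {R S : FinAlg} (φ : R ⟶ S) (x : S.obj) (hx : x ^ 2 = 0) :
    toAlgHom (dualOver.lift φ x hx) (dualOver.eps R) = x :=
  DualNumber.lift_apply_eps _

theorem dualOver.incl_lift {R S : FinAlg} (φ : R ⟶ S) (x : S.obj) (hx : x ^ 2 = 0) :
    dualOver.incl R ≫ dualOver.lift φ x hx = φ :=
  FinAlg.hom_ext fun a => DualNumber.lift_apply_inl _ a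

theorem dualOver.lift_incl {R S : FinAlg} (φ : R ⟶ S) (x : S.obj) (hx : x ^ 2 = 0) (a : R.obj) :
    toAlgHom (dualOver.lift φ x hx) (toAlgHom (dualOver.incl R) a) = toAlgHom φ a := by
  rw [← toAlgHom_comp, dualOver.incl_lift]

theorem dualOver.lift_apply {R S : FinAlg} (φ : R ⟶ S) (x : S.obj) (hx : x ^ 2 = 0)
    (a : (dualOver R).obj) : toAlgHom (dualOver.lift φ x hx) a =
      toAlgHom φ (toAlgHom (dualOver.fst R) a) + toAlgHom φ (dualOver.snd R a) * x := by
  conv_lhs => rw [dualOver.eq_incl_add a]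
  rw [map_add, map_mul, dualOver.lift_incl, dualOver.lift_incl, dualOver.lift_eps]

theorem dualOver.hom_ext {R S : FinAlg} {φ ψ : dualOver R ⟶ S}
    (h1 : dualOver.incl R ≫ φ = dualOver.incl R ≫ ψ)
    (h2 : toAlgHom φ (dualOver.eps R) = toAlgHom ψ (dualOver.eps R)) : φ = ψ := by
  refine FinAlg.hom_ext fun x => ?_
  have h3 (a : R.obj) : toAlgHom φ (toAlgHom (dualOver.incl R) a) =
      toAlgHom ψ (toAlgHom (dualOver.incl R) a) := by
    rw [← toAlgHom_comp, h1, toAlgHom_comp]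
  rw [dualOver.eq_incl_add x, map_add, map_add, map_mul, map_mul, h3, h3, h2]

/-- The structure homomorphism `ℂ → R`. -/
def fromPoint (R : FinAlg) : point ⟶ R := homOf (Algebra.ofId ℂ R.obj)

theorem point_hom_ext {R : FinAlg} (φ ψ : point ⟶ R) : φ = ψ :=
  FinAlg.hom_ext fun x => ((toAlgHom φ).commutes x).trans ((toAlgHom ψ).commutes x).symm

/-- The element `ε` of `ℂ[ε]`. -/
def dualEps : dual.obj := dualOver.eps point

theorem dual_hom_ext {S : FinAlg} {φ ψ : dual ⟶ S}
    (h2 : toAlgHom φ dualEps = toAlgHom ψ dualEps) : φ = ψ :=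
  dualOver.hom_ext (R := point) (point_hom_ext _ _) h2

theorem trunc_point_hom_ext {S : FinAlg} {n : ℕ} {φ ψ : trunc point n ⟶ S}
    (h2 : toAlgHom φ (trunc.mk n Polynomial.X) = toAlgHom ψ (trunc.mk n Polynomial.X)) : φ = ψ :=
  trunc.hom_ext (point_hom_ext _ _) h2

/-- The homomorphism `ℂ[ε] → R` with `ε ↦ x`. -/
def evDual {R : FinAlg} (x : R.obj) (hx : x ^ 2 = 0) : dual ⟶ R :=
  dualOver.lift (R := point) (fromPoint R) x hx

/-- The homomorphism `ℂ[X] / (X ^ n) → R` with `X ↦ x`. -/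
def evTrunc {R : FinAlg} {n : ℕ} (x : R.obj) (hx : x ^ n = 0) : trunc point n ⟶ R :=
  trunc.lift (fromPoint R) x hx

theorem evDual_eps {R : FinAlg} (x : R.obj) (hx : x ^ 2 = 0) :
    toAlgHom (evDual x hx) dualEps = x :=
  dualOver.lift_eps _ _ _

theorem evTrunc_X {R : FinAlg} {n : ℕ} (x : R.obj) (hx : x ^ n = 0) :
    toAlgHom (evTrunc x hx) (trunc.mk n Polynomial.X) = x :=
  trunc.lift_X _ _ _

theorem evDual_comp {R S : FinAlg} (φ : R ⟶ S) (x : R.obj) (hx : x ^ 2 = 0) :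
    evDual x hx ≫ φ = evDual (toAlgHom φ x) (by rw [← map_pow, hx, map_zero]) :=
  dual_hom_ext (by rw [toAlgHom_comp, evDual_eps, evDual_eps])

theorem evTrunc_comp {R S : FinAlg} {n : ℕ} (φ : R ⟶ S) (x : R.obj) (hx : x ^ n = 0) :
    evTrunc x hx ≫ φ = evTrunc (toAlgHom φ x) (by rw [← map_pow, hx, map_zero]) :=
  trunc_point_hom_ext (by rw [toAlgHom_comp, evTrunc_X, evTrunc_X])

theorem add_pow_eq_zero {R : Type*} [CommRing R] {n : ℕ} {x y : R} (hx : x ^ n = 0)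
    (hy : y ^ 2 = 0) : (x + y) ^ (n + 1) = 0 := by
  have h : Commute x y := Commute.all _ _
  exact h.add_pow_eq_zero_of_add_le_succ_of_pow_eq_zero hx hy (by omega)

/-- The homomorphism `R[X] / (X ^ (n + 1)) → R[X] / (X ^ n) [ε]` with `X ↦ X + ε`. -/
def shift (R : FinAlg) (n : ℕ) : trunc R (n + 1) ⟶ dualOver (trunc R n) :=
  trunc.lift (trunc.incl R n ≫ dualOver.incl _)
    (toAlgHom (dualOver.incl _) (trunc.mk n Polynomial.X) + dualOver.eps _)
    (add_pow_eq_zero (by rw [← map_pow, trunc.X_pow, map_zero]) (dualOver.eps_sq _))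

theorem shift_X (R : FinAlg) (n : ℕ) : toAlgHom (shift R n) (trunc.mk (n + 1) Polynomial.X) =
    toAlgHom (dualOver.incl _) (trunc.mk n Polynomial.X) + dualOver.eps _ :=
  trunc.lift_X _ _ _

theorem incl_shift (R : FinAlg) (n : ℕ) :
    trunc.incl R (n + 1) ≫ shift R n = trunc.incl R n ≫ dualOver.incl _ :=
  trunc.incl_lift _ _ _

theorem fst_shift_mk (R : FinAlg) (n : ℕ) (p : Polynomial R.obj) :
    toAlgHom (dualOver.fst _) (toAlgHom (shift R n) (trunc.mk (n + 1) p)) = trunc.mk n p := by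
  induction p using Polynomial.induction_on' with
  | add p q hp hq => simp only [map_add, hp, hq]
  | monomial k a =>
    rw [← Polynomial.C_mul_X_pow_eq_monomial, map_mul, map_pow, ← trunc.incl_apply, map_mul,
      ← toAlgHom_comp, incl_shift, map_pow, shift_X]
    simp [toAlgHom_comp, trunc.incl_apply]

/-- This is the first-order Taylor formula `p(X + ε) = p + p' ε`. -/
theorem snd_shift_mk (R : FinAlg) (n : ℕ) (p : Polynomial R.obj) :
    dualOver.snd _ (toAlgHom (shift R n) (trunc.mk (n + 1) p)) =
      trunc.mk n (Polynomial.derivative p) := by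
  induction p using Polynomial.induction_on' with
  | add p q hp hq => simp only [map_add, hp, hq]
  | monomial k a =>
    rw [← Polynomial.C_mul_X_pow_eq_monomial, map_mul, map_pow, ← trunc.incl_apply, map_mul,
      ← toAlgHom_comp, incl_shift, map_pow, shift_X]
    simp [toAlgHom_comp, trunc.incl_apply, dualOver.snd_pow, Polynomial.derivative_X_pow]

theorem isUnit_natCast (R : FinAlg) {n : ℕ} (hn : n ≠ 0) : IsUnit (n : R.obj) := by
  have h : IsUnit ((n : ℂ)) := isUnit_iff_ne_zero.2 (Nat.cast_ne_zero.2 hn)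
  simpa using h.map (algebraMap ℂ R.obj)

/-- From `p` and `p'` modulo `X^(n+1)` also the coefficient of `X^(n+1)` is known, since `n + 1` is
invertible in a `ℂ`-algebra. The target must be truncated at a positive degree: for `R[X]/(X^0)` it
would be zero. -/
theorem shift_injective (R : FinAlg) (n : ℕ) :
    Function.Injective (toAlgHom (shift R (n + 1))) := by
  refine (injective_iff_map_eq_zero _).2 fun x hx => ?_
  obtain ⟨p, rfl⟩ := trunc.mk_surjective x
  have h1 : trunc.mk (n + 1) p = 0 := by rw [← fst_shift_mk, hx, map_zero]
  have h2 : trunc.mk (n + 1) (Polynomial.derivative p) = 0 := by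
    rw [← snd_shift_mk, hx, map_zero]
  rw [trunc.mk_eq_zero, Polynomial.X_pow_dvd_iff] at h1 h2 ⊢
  intro d hd
  rcases Nat.lt_succ_iff_lt_or_eq.1 hd with hd | rfl
  · exact h1 d hd
  · have h := h2 n (Nat.lt_succ_self n)
    rw [Polynomial.coeff_derivative] at h
    have hu := isUnit_natCast R (Nat.succ_ne_zero n)
    rw [Nat.succ_eq_add_one, Nat.cast_add, Nat.cast_one] at hu
    exact hu.mul_left_eq_zero.1 h

/-- The homomorphism `ℂ[X]/(X^(n+1))[ε] → ℂ[X]/(X^n)[ε'][ε]` with `X ↦ X + ε'`, `ε ↦ ε`. -/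
def shiftLeft (n : ℕ) : dualOver (trunc point (n + 1)) ⟶ dualOver (dualOver (trunc point n)) :=
  dualOver.lift (shift point n ≫ dualOver.incl _) (dualOver.eps _) (dualOver.eps_sq _)

/-- The homomorphism `ℂ[X]/(X^(n+1))[ε] → ℂ[X]/(X^n)[ε'][ε]` with `X ↦ X + ε`, `ε ↦ ε'`. -/
def shiftRight (n : ℕ) : dualOver (trunc point (n + 1)) ⟶ dualOver (dualOver (trunc point n)) :=
  shiftLeft n ≫ dualOver.lift
    (dualOver.lift (dualOver.incl _ ≫ dualOver.incl _) (dualOver.eps _) (dualOver.eps_sq _))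
    (toAlgHom (dualOver.incl _) (dualOver.eps _))
    (by rw [← map_pow, dualOver.eps_sq, map_zero])

/-- The element `X` of `ℂ[X]/(X^n)[ε'][ε]`. -/
def bidualX (n : ℕ) : (dualOver (dualOver (trunc point n))).obj :=
  toAlgHom (dualOver.incl _) (toAlgHom (dualOver.incl _) (trunc.mk n Polynomial.X))

/-- The element `ε'` of `ℂ[X]/(X^n)[ε'][ε]`. -/
def bidualEps (n : ℕ) : (dualOver (dualOver (trunc point n))).obj :=
  toAlgHom (dualOver.incl _) (dualOver.eps _)

theorem bidualX_pow (n : ℕ) : bidualX n ^ n = 0 := by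
  rw [bidualX, ← map_pow, ← map_pow, trunc.X_pow, map_zero, map_zero]

theorem bidualEps_sq (n : ℕ) : bidualEps n ^ 2 = 0 := by
  rw [bidualEps, ← map_pow, dualOver.eps_sq, map_zero]

theorem shiftLeft_X (n : ℕ) : toAlgHom (shiftLeft n) (toAlgHom (dualOver.incl _)
    (trunc.mk (n + 1) Polynomial.X)) = bidualX n + bidualEps n := by
  rw [shiftLeft, ← toAlgHom_comp, dualOver.incl_lift, toAlgHom_comp, shift_X, map_add]
  rfl

theorem shiftLeft_eps (n : ℕ) :
    toAlgHom (shiftLeft n) (dualOver.eps _) = dualOver.eps _ :=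
  dualOver.lift_eps _ _ _

theorem shiftRight_X (n : ℕ) : toAlgHom (shiftRight n) (toAlgHom (dualOver.incl _)
    (trunc.mk (n + 1) Polynomial.X)) = bidualX n + dualOver.eps _ := by
  rw [shiftRight, toAlgHom_comp, shiftLeft_X, map_add, bidualX, bidualEps, dualOver.lift_incl,
    dualOver.lift_incl, dualOver.lift_incl, dualOver.lift_eps]
  rfl

theorem shiftRight_eps (n : ℕ) :
    toAlgHom (shiftRight n) (dualOver.eps _) = bidualEps n := by
  rw [shiftRight, toAlgHom_comp, shiftLeft_eps, dualOver.lift_eps]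
  rfl

theorem shift_comp_shiftLeft (n : ℕ) :
    shift point (n + 1) ≫ shiftLeft n = shift point (n + 1) ≫ shiftRight n := by
  refine trunc_point_hom_ext ?_
  rw [toAlgHom_comp, toAlgHom_comp, shift_X, map_add, map_add, shiftLeft_X, shiftLeft_eps,
    shiftRight_X, shiftRight_eps, add_right_comm]

/-- An element `p + q ε` is a Taylor expansion exactly when `q` is the derivative of a
representative of `p`. Comparing the coefficients of `ε'` in `p(X+ε') + q(X+ε') ε` and `p(X+ε) +
q(X+ε) ε'` gives `p' = q` modulo `X^n`; the missing coefficient is adjusted by hand. -/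
theorem exists_shift_eq (n : ℕ) (a : (dualOver (trunc point (n + 1))).obj)
    (h : toAlgHom (shiftLeft n) a = toAlgHom (shiftRight n) a) :
    ∃ b, toAlgHom (shift point (n + 1)) b = a := by
  obtain ⟨p, hp⟩ := trunc.mk_surjective (toAlgHom (dualOver.fst _) a)
  obtain ⟨q, hq⟩ := trunc.mk_surjective (dualOver.snd _ a)
  have e0 : toAlgHom (shiftLeft n) a =
      toAlgHom (dualOver.incl _) (toAlgHom (shift point n) (trunc.mk (n + 1) p)) +
        toAlgHom (dualOver.incl _) (toAlgHom (shift point n) (trunc.mk (n + 1) q)) *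
          dualOver.eps _ := by
    rw [shiftLeft, dualOver.lift_apply, ← hp, ← hq, toAlgHom_comp, toAlgHom_comp]
  have e1 : dualOver.snd _ (toAlgHom (dualOver.fst _) (toAlgHom (shiftLeft n) a)) =
      trunc.mk n (Polynomial.derivative p) := by
    rw [e0, map_add, map_mul, dualOver.fst_incl, dualOver.fst_eps, mul_zero, add_zero, snd_shift_mk]
  have e2 : dualOver.snd _ (toAlgHom (dualOver.fst _) (toAlgHom (shiftRight n) a)) =
      trunc.mk n q := by
    rw [shiftRight, toAlgHom_comp, e0, map_add, map_mul, dualOver.lift_incl, dualOver.lift_incl,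
      dualOver.lift_eps, dualOver.lift_apply, dualOver.lift_apply, fst_shift_mk, fst_shift_mk]
    simp [toAlgHom_comp]
  rw [h, e2, ← sub_eq_zero, ← map_sub, trunc.mk_eq_zero] at e1
  obtain ⟨r, hr⟩ := e1
  -- The remaining error in `q` is `r(0) X^n` modulo `X^(n+1)`. Adding its primitive `r(0)/(n+1) ·
  -- X^(n+1)` to `p` corrects the derivative without changing `p` modulo `X^(n+1)`.
  obtain ⟨c, hc⟩ := (isUnit_natCast point (Nat.succ_ne_zero n)).exists_right_inv
  refine ⟨trunc.mk (n + 1 + 1)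
    (p + Polynomial.C (c * r.coeff 0) * Polynomial.X ^ (n + 1)), dualOver.ext ?_ ?_⟩
  · rw [fst_shift_mk, ← hp, map_add, map_mul, map_pow, trunc.X_pow, mul_zero, add_zero]
  · rw [snd_shift_mk, ← hq, ← sub_eq_zero, ← map_sub, trunc.mk_eq_zero]
    refine ⟨-r.divX, ?_⟩
    have hr' : q = Polynomial.derivative p + Polynomial.X ^ n *
        (r.divX * Polynomial.X + Polynomial.C (r.coeff 0)) := by
      rw [Polynomial.divX_mul_X_add, ← hr]
      ring
    rw [hr', Polynomial.derivative_add, Polynomial.derivative_C_mul_X_pow]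
    have hcr : c * r.coeff 0 * ((n + 1 : ℕ) : point.obj) = r.coeff 0 := by
      rw [mul_right_comm, mul_comm c, hc, one_mul]
    rw [hcr, Nat.add_sub_cancel]
    ring

end FinAlg
end Algebras

/-! ### Lie algebras and formal one-parameter subgroups -/

section Exponential

open FinAlg

variable {F : FinAlg ⥤ AddCommGrpCat.{0}}

/-- The Lie algebra `ker (F(ℂ[ε]) → F(ℂ))`. -/
def Lie (F : FinAlg ⥤ AddCommGrpCat.{0}) : AddSubgroup (F.obj dual) := (pts F dualToPoint).ker

theorem mem_Lie {t : F.obj dual} : t ∈ Lie F ↔ pts F dualToPoint t = 0 := Iff.rfl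

/-- The image of `t ∈ F(ℂ[ε])` under `ε ↦ x`, for `x ^ 2 = 0`. -/
def evLie {R : FinAlg} (t : F.obj dual) (x : R.obj) : F.obj R :=
  open scoped Classical in if hx : x ^ 2 = 0 then pts F (evDual x hx) t else 0

theorem evLie_eq {R : FinAlg} (t : F.obj dual) {x : R.obj} (hx : x ^ 2 = 0) :
    evLie t x = pts F (evDual x hx) t := dif_pos hx

/-- The image of `e ∈ F(ℂ[X] / (X ^ n))` under `X ↦ x`, for `x ^ n = 0`. -/
def evT {R : FinAlg} {n : ℕ} (e : F.obj (trunc point n)) (x : R.obj) : F.obj R :=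
  open scoped Classical in if hx : x ^ n = 0 then pts F (evTrunc x hx) e else 0

theorem evT_eq {R : FinAlg} {n : ℕ} (e : F.obj (trunc point n)) {x : R.obj} (hx : x ^ n = 0) :
    evT e x = pts F (evTrunc x hx) e := dif_pos hx

theorem pts_evLie {R S : FinAlg} (φ : R ⟶ S) (t : F.obj dual) {x : R.obj} (hx : x ^ 2 = 0) :
    pts F φ (evLie t x) = evLie t (toAlgHom φ x) := by
  rw [evLie_eq t hx, ← pts_comp, evDual_comp, evLie_eq]

theorem pts_evT {R S : FinAlg} (φ : R ⟶ S) {n : ℕ} (e : F.obj (trunc point n)) {x : R.obj}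
    (hx : x ^ n = 0) : pts F φ (evT e x) = evT e (toAlgHom φ x) := by
  rw [evT_eq e hx, ← pts_comp, evTrunc_comp, evT_eq]

theorem evLie_add_left {R : FinAlg} (t t' : F.obj dual) (x : R.obj) :
    evLie (t + t') x = evLie t x + evLie t' x := by
  unfold evLie
  split_ifs <;> simp

theorem evT_add_left {R : FinAlg} {n : ℕ} (e e' : F.obj (trunc point n)) (x : R.obj) :
    evT (e + e') x = evT e x + evT e' x := by
  unfold evT
  split_ifs <;> simp

theorem app_evLie {G : FinAlg ⥤ AddCommGrpCat.{0}} (α : F ⟶ G) {R : FinAlg} (t : F.obj dual)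
    (x : R.obj) : (α.app R).hom (evLie t x) = evLie ((α.app dual).hom t) x := by
  unfold evLie
  split_ifs
  · exact pts_naturality α _ t
  · exact map_zero _

theorem app_evT {G : FinAlg ⥤ AddCommGrpCat.{0}} (α : F ⟶ G) {R : FinAlg} {n : ℕ}
    (e : F.obj (trunc point n)) (x : R.obj) :
    (α.app R).hom (evT e x) = evT ((α.app _).hom e) x := by
  unfold evT
  split_ifs
  · exact pts_naturality α _ e
  · exact map_zero _

theorem evLie_zero {R : FinAlg} {t : F.obj dual} (ht : t ∈ Lie F) : evLie t (0 : R.obj) = 0 := by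
  have h : evDual (0 : R.obj) (by simp) = dualToPoint ≫ fromPoint R :=
    dual_hom_ext (by
      rw [evDual_eps, toAlgHom_comp]
      exact (map_zero _).symm)
  rw [evLie_eq t (by simp), h, pts_comp, mem_Lie.1 ht, map_zero]

theorem dualEps_sq : dualEps ^ 2 = 0 := dualOver.eps_sq point

theorem evLie_dualEps (t : F.obj dual) : evLie t dualEps = t := by
  rw [evLie_eq t dualEps_sq]
  have h : evDual dualEps dualEps_sq = 𝟙 dual := dual_hom_ext (evDual_eps _ _)
  rw [h, pts_id]

theorem dualScale_dualEps (c : ℂ) : toAlgHom (dualScale c) dualEps = c • dualEps := by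
  change TrivSqZeroExt.map (c • (LinearMap.id : ℂ →ₗ[ℂ] ℂ)) (TrivSqZeroExt.inr (1 : ℂ)) =
    c • TrivSqZeroExt.inr (R := ℂ) (1 : ℂ)
  rw [TrivSqZeroExt.map_inr, ← TrivSqZeroExt.inr_smul]
  rfl

theorem evLie_scale {R : FinAlg} (c : ℂ) (t : F.obj dual) {x : R.obj} (hx : x ^ 2 = 0) :
    evLie (pts F (dualScale c) t) x = evLie t (c • x) := by
  have hx' : (c • x) ^ 2 = 0 := by rw [smul_pow, hx, smul_zero]
  rw [evLie_eq _ hx, evLie_eq _ hx', ← pts_comp]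
  congr 2
  exact dual_hom_ext (by
    rw [toAlgHom_comp, dualScale_dualEps, map_smul, evDual_eps, evDual_eps])

/-- The homomorphism from the fibre product `ℂ[ε] ×_ℂ ℂ[ε]` determined by two elements `x`, `y`
with `x ^ 2 = y ^ 2 = x * y = 0`. -/
theorem exists_hom_fibreProduct {P R : FinAlg} {p q : P ⟶ dual}
    (h : IsFibreProduct p q dualToPoint dualToPoint) {x y : R.obj} (hx : x ^ 2 = 0)
    (hy : y ^ 2 = 0) (hxy : x * y = 0) : ∃ φ : P ⟶ R, ∀ e,
      toAlgHom φ e = toAlgHom (fromPoint R) (toAlgHom dualToPoint (toAlgHom p e)) +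
        toAlgHom (fromPoint R) (dualOver.snd point (toAlgHom p e)) * x +
        toAlgHom (fromPoint R) (dualOver.snd point (toAlgHom q e)) * y := by
  let a : P.obj →ₐ[ℂ] ℂ := (toAlgHom dualToPoint).comp (toAlgHom p)
  let s₁ : P.obj →ₗ[ℂ] ℂ := (TrivSqZeroExt.sndHom ℂ ℂ).comp (toAlgHom p).toLinearMap
  let s₂ : P.obj →ₗ[ℂ] ℂ := (TrivSqZeroExt.sndHom ℂ ℂ).comp (toAlgHom q).toLinearMap
  have hpq (e : P.obj) : TrivSqZeroExt.fst (toAlgHom q e) = a e :=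
    (congrArg (fun m => toAlgHom m e) h.comm).symm
  have snd_mul' (z w : TrivSqZeroExt ℂ ℂ) : (z * w).snd = z.fst * w.snd + w.fst * z.snd :=
    (TrivSqZeroExt.snd_mul z w).trans (congrArg (_ + ·) (mul_comm z.snd w.fst))
  have h₁ (e e' : P.obj) : s₁ (e * e') = a e * s₁ e' + a e' * s₁ e := by
    change TrivSqZeroExt.snd (toAlgHom p (e * e')) = _
    rw [map_mul]
    exact snd_mul' _ _
  have h₂ (e e' : P.obj) : s₂ (e * e') = a e * s₂ e' + a e' * s₂ e := by
    change TrivSqZeroExt.snd (toAlgHom q (e * e')) = _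
    rw [map_mul, ← hpq, ← hpq]
    exact snd_mul' _ _
  have h₁' : s₁ 1 = 0 := by
    change TrivSqZeroExt.snd (toAlgHom p 1) = 0
    rw [map_one]
    rfl
  have h₂' : s₂ 1 = 0 := by
    change TrivSqZeroExt.snd (toAlgHom q 1) = 0
    rw [map_one]
    rfl
  refine ⟨homOf (AlgHom.ofLinearMap
    ((Algebra.linearMap ℂ R.obj).comp a.toLinearMap + s₁.smulRight x + s₂.smulRight y) ?_ ?_),
    fun e => ?_⟩
  · simp [h₁', h₂']
  · intro e e'
    simp only [LinearMap.add_apply, LinearMap.comp_apply, Algebra.linearMap_apply,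
      LinearMap.smulRight_apply, AlgHom.toLinearMap_apply, map_mul, h₁, h₂, Algebra.smul_def,
      map_add]
    linear_combination (-algebraMap ℂ R.obj (s₁ e) * algebraMap ℂ R.obj (s₁ e')) * hx -
      (algebraMap ℂ R.obj (s₂ e) * algebraMap ℂ R.obj (s₂ e')) * hy -
      (algebraMap ℂ R.obj (s₁ e) * algebraMap ℂ R.obj (s₂ e') +
        algebraMap ℂ R.obj (s₂ e) * algebraMap ℂ R.obj (s₁ e')) * hxy
  · change algebraMap ℂ R.obj (a e) + s₁ e • x + s₂ e • y = _
    rw [Algebra.smul_def, Algebra.smul_def]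
    rfl

/-- The universal case is `ℂ[ε] ×_ℂ ℂ[ε]`, where `x` and `y` are the two copies of `ε`. There the
identity is checked on both projections, each of which kills one of the two elements. -/
theorem evLie_add [IsLex F] {R : FinAlg} {t : F.obj dual} (ht : t ∈ Lie F) {x y : R.obj}
    (hx : x ^ 2 = 0) (hy : y ^ 2 = 0) (hxy : x * y = 0) :
    evLie t (x + y) = evLie t x + evLie t y := by
  obtain ⟨P, p, q, h⟩ := FinAlg.exists_isFibreProduct dualToPoint dualToPoint
  obtain ⟨φ, hφ⟩ := exists_hom_fibreProduct h hx hy hxy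
  have h0 : toAlgHom dualToPoint dualEps = 0 := rfl
  obtain ⟨e, he, he'⟩ := h.surj dualEps 0 (by rw [h0, map_zero])
  obtain ⟨e', he₂, he₂'⟩ := h.surj 0 dualEps (by rw [h0, map_zero])
  have hsq : dualEps ^ 2 = 0 := dualEps_sq
  have e1 : e ^ 2 = 0 := h.inj _ _ (by rw [map_pow, he, map_zero, hsq])
    (by rw [map_pow, he', map_zero]; simp)
  have e2 : e' ^ 2 = 0 := h.inj _ _ (by rw [map_pow, he₂, map_zero]; simp)
    (by rw [map_pow, he₂', map_zero, hsq])
  have e3 : (e + e') ^ 2 = 0 := h.inj _ _ (by rw [map_pow, map_add, he, he₂, add_zero, map_zero, hsq])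
    (by rw [map_pow, map_add, he', he₂', zero_add, map_zero, hsq])
  have key : evLie t (e + e') = evLie t e + evLie t e' := by
    refine IsLex.inj' h ?_ ?_
    · rw [map_add, pts_evLie _ _ e1, pts_evLie _ _ e2, pts_evLie _ _ e3, map_add, he, he₂,
        add_zero, evLie_zero ht, add_zero]
    · rw [map_add, pts_evLie _ _ e1, pts_evLie _ _ e2, pts_evLie _ _ e3, map_add, he', he₂',
        zero_add, evLie_zero ht, zero_add]
  have hs : dualOver.snd point dualEps = 1 := rfl
  have hs0 : dualOver.snd point (0 : dual.obj) = 0 := rfl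
  have hx' : toAlgHom φ e = x := by
    rw [hφ, he, he', h0, hs, hs0]; simp
  have hy' : toAlgHom φ e' = y := by
    rw [hφ, he₂, he₂', hs, hs0]; simp
  rw [← hx', ← hy', ← map_add, ← pts_evLie _ _ e1, ← pts_evLie _ _ e2, ← pts_evLie _ _ e3, key,
    map_add]

theorem dualScale_comp (c : ℂ) : dualScale c ≫ dualToPoint = dualToPoint :=
  dual_hom_ext (by rw [toAlgHom_comp, dualScale_dualEps, map_smul]; exact smul_zero c)

instance : SMul ℂ (Lie F) where
  smul c t := ⟨pts F (dualScale c) t, by rw [mem_Lie, ← pts_comp, dualScale_comp]; exact t.2⟩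

theorem Lie.coe_smul (c : ℂ) (t : Lie F) : ((c • t : Lie F) : F.obj dual) = pts F (dualScale c) t :=
  rfl

theorem Lie.smul_eq (c : ℂ) (t : Lie F) :
    ((c • t : Lie F) : F.obj dual) = evLie (t : F.obj dual) (c • dualEps) := by
  rw [← evLie_scale c _ dualEps_sq, evLie_dualEps, Lie.coe_smul]

theorem smul_dualEps_sq (c : ℂ) : (c • dualEps) ^ 2 = 0 := by
  rw [smul_pow, dualEps_sq, smul_zero]

instance [IsLex F] : Module ℂ (Lie F) where
  one_smul t := Subtype.ext (by rw [Lie.smul_eq, one_smul, evLie_dualEps])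
  mul_smul c d t := Subtype.ext (by
    rw [Lie.smul_eq, Lie.coe_smul c, Lie.smul_eq, pts_evLie _ _ (smul_dualEps_sq d), map_smul,
      dualScale_dualEps, smul_smul, mul_comm])
  smul_zero c := Subtype.ext (by rw [Lie.coe_smul]; exact map_zero _)
  smul_add c t t' := Subtype.ext (by
    rw [Lie.coe_smul]
    exact map_add (pts F (dualScale c)) _ _)
  add_smul c d t := Subtype.ext (by
    rw [Lie.smul_eq, add_smul, evLie_add t.2 (smul_dualEps_sq c) (smul_dualEps_sq d) (by
      rw [smul_mul_smul_comm, ← pow_two, dualEps_sq,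
        smul_zero])]
    exact congrArg₂ _ (Lie.smul_eq c t).symm (Lie.smul_eq d t).symm)
  zero_smul t := Subtype.ext (by rw [Lie.smul_eq, zero_smul, evLie_zero t.2]; rfl)

/-- Left exact functors preserve equalizers. -/
theorem IsLex.exists_of_equalizer [IsLex F] {E R S : FinAlg} {i : E ⟶ R} {f g : R ⟶ S}
    (hi : Function.Injective (toAlgHom i)) (hfg : i ≫ f = i ≫ g)
    (hE : ∀ a, toAlgHom f a = toAlgHom g a → ∃ b, toAlgHom i b = a) {x : F.obj R}
    (hx : pts F f x = pts F g x) : ∃ z, pts F i z = x := by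
  have hs : Subsingleton zeroAlg.obj := inferInstanceAs (Subsingleton PUnit)
  let T := isTerminalOfSubsingleton zeroAlg
  -- Over the zero algebra the fibre product `P` is `S × S`. The equalizer of `f` and `g` becomes
  -- the fibre product of `(f, g) : R → P` with the diagonal of `S`.
  obtain ⟨P, p, q, h⟩ := FinAlg.exists_isFibreProduct (T.from S) (T.from S)
  let u : R ⟶ P := h.isPullback.lift f g (T.hom_ext _ _)
  let d : S ⟶ P := h.isPullback.lift (𝟙 S) (𝟙 S) rfl
  have hup : u ≫ p = f := h.isPullback.lift_fst _ _ _
  have huq : u ≫ q = g := h.isPullback.lift_snd _ _ _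
  have hdp : d ≫ p = 𝟙 S := h.isPullback.lift_fst _ _ _
  have hdq : d ≫ q = 𝟙 S := h.isPullback.lift_snd _ _ _
  have hf : IsFibreProduct i (i ≫ f) u d := by
    refine ⟨h.isPullback.hom_ext ?_ ?_, fun x y hxy _ => hi hxy, fun r s hrs => ?_⟩
    · simp [hup, hdp]
    · simp [huq, hdq, hfg]
    · have h1 : toAlgHom f r = s := by
        rw [← hup, toAlgHom_comp, hrs, ← toAlgHom_comp, hdp]; rfl
      have h2 : toAlgHom g r = s := by
        rw [← huq, toAlgHom_comp, hrs, ← toAlgHom_comp, hdq]; rfl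
      obtain ⟨b, hb⟩ := hE r (h1.trans h2.symm)
      exact ⟨b, hb, by rw [toAlgHom_comp, hb, h1]⟩
  obtain ⟨z, hz, -⟩ := IsLex.surj hf x (pts F f x) (IsLex.inj' h
    (by rw [← pts_comp, ← pts_comp, hup, hdp, pts_id])
    (by rw [← pts_comp, ← pts_comp, huq, hdq, pts_id, hx]))
  exact ⟨z, hz⟩

/-- `e ∈ F(ℂ[X] / (X ^ (n + 1)))` is the truncation of the formal one-parameter subgroup with
tangent vector `t`. -/
structure IsExp (t : F.obj dual) (n : ℕ) (e : F.obj (trunc point (n + 1))) : Prop where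
  zero : evT e (0 : point.obj) = 0
  add : ∀ {R : FinAlg} (x y : R.obj), x ^ n = 0 → y ^ 2 = 0 → evT e (x + y) = evT e x + evLie t y

/-- This integrates the differential equation one degree at a time. The next truncation should
restrict along `X ↦ X + ε` to `e(X) + t(ε)`. Both shifts turn that element into `e(X) + t(ε') +
t(ε)`, so commutativity of the group is the integrability condition, and left exactness makes the
element descend along the equalizer `shift`. -/
theorem exists_isExp [IsLex F] {t : F.obj dual} (ht : t ∈ Lie F) (n : ℕ) : ∃ e, IsExp t n e := by
  induction n with
  | zero =>
    refine ⟨0, ?_, fun {R} x y hx _ => ?_⟩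
    · rw [evT_eq _ (by simp), map_zero]
    -- In degree zero the condition `x ^ 0 = 0` holds only over the zero algebra.
    · have hs : Subsingleton R.obj := subsingleton_of_zero_eq_one (by simpa using hx.symm)
      have := IsLex.zero (F := F) R hs
      exact Subsingleton.elim _ _
  | succ n ih =>
    obtain ⟨e, he⟩ := ih
    have hX : trunc.mk (R := point) (n + 1) Polynomial.X ^ (n + 1) = 0 := trunc.X_pow
    have hX' : toAlgHom (dualOver.incl _) (trunc.mk (R := point) (n + 1) Polynomial.X) ^ (n + 1) =
      0 := by rw [← map_pow, hX, map_zero]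
    have hl : pts F (shiftLeft n) (evT e (toAlgHom (dualOver.incl _) (trunc.mk _ Polynomial.X)) +
        evLie t (dualOver.eps _)) = evT e (bidualX n) + evLie t (bidualEps n) +
        evLie t (dualOver.eps _) := by
      rw [map_add, pts_evT _ _ hX', pts_evLie _ _ (dualOver.eps_sq _), shiftLeft_X, shiftLeft_eps,
        he.add _ _ (bidualX_pow n) (bidualEps_sq n)]
    have hr : pts F (shiftRight n) (evT e (toAlgHom (dualOver.incl _) (trunc.mk _ Polynomial.X)) +
        evLie t (dualOver.eps _)) = evT e (bidualX n) + evLie t (dualOver.eps _) +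
        evLie t (bidualEps n) := by
      rw [map_add, pts_evT _ _ hX', pts_evLie _ _ (dualOver.eps_sq _), shiftRight_X,
        shiftRight_eps, he.add _ _ (bidualX_pow n) (dualOver.eps_sq _)]
    obtain ⟨e', he'⟩ := IsLex.exists_of_equalizer (shift_injective point n)
      (shift_comp_shiftLeft n) (exists_shift_eq n) (hl.trans ((add_right_comm _ _ _).trans hr.symm))
    have key {R : FinAlg} (x y : R.obj) (hx : x ^ (n + 1) = 0) (hy : y ^ 2 = 0) :
        evT e' (x + y) = evT e x + evLie t y := by
      have h := congrArg (pts F (dualOver.lift (evTrunc x hx) y hy)) he'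
      rw [map_add, pts_evT _ _ hX', pts_evLie _ _ (dualOver.eps_sq _), dualOver.lift_incl,
        dualOver.lift_eps, evTrunc_X] at h
      rw [← h, ← pts_comp, evT_eq _ (add_pow_eq_zero hx hy)]
      congr 2
      refine trunc_point_hom_ext ?_
      rw [evTrunc_X, toAlgHom_comp, shift_X, map_add, dualOver.lift_incl, dualOver.lift_eps,
        evTrunc_X]
    have key0 {R : FinAlg} (x : R.obj) (hx : x ^ (n + 1) = 0) : evT e' x = evT e x := by
      have h := key x 0 hx (by simp)
      rwa [add_zero, evLie_zero ht, add_zero] at h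
    refine ⟨e', ?_, fun x y hx hy => ?_⟩
    · rw [key0 _ (by simp), he.zero]
    · rw [key x y hx hy, key0 x hx]

/-- The image of `e` in `F(ℂ[X] / (X ^ m))`. -/
def restrictT {n : ℕ} (e : F.obj (trunc point n)) (m : ℕ) : F.obj (trunc point m) :=
  evT e (trunc.mk m Polynomial.X)

theorem evT_restrictT {n m : ℕ} (h : m ≤ n) (e : F.obj (trunc point n)) {R : FinAlg} {x : R.obj}
    (hx : x ^ m = 0) : evT (restrictT e m) x = evT e x := by
  rw [restrictT, evT_eq _ hx, pts_evT _ _ (trunc.X_pow_of_le h), evTrunc_X]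

theorem restrictT_self {n : ℕ} (e : F.obj (trunc point n)) : restrictT e n = e := by
  rw [restrictT, evT_eq _ trunc.X_pow]
  have h : evTrunc (trunc.mk (R := point) n Polynomial.X) trunc.X_pow = 𝟙 _ :=
    trunc_point_hom_ext (evTrunc_X _ _)
  rw [h, pts_id]

theorem IsExp.restrict {t : F.obj dual} {n m : ℕ} {e : F.obj (trunc point (n + 1))}
    (h : IsExp t n e) (hm : m ≤ n) : IsExp t m (restrictT e (m + 1)) where
  zero := by rw [evT_restrictT (by omega) _ (by simp), h.zero]
  add x y hx hy := by
    rw [evT_restrictT (by omega) _ (add_pow_eq_zero hx hy),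
      evT_restrictT (by omega) _ (by rw [pow_succ, hx, zero_mul]),
      h.add x y (pow_eq_zero_of_le hm hx) hy]

/-- The equation prescribes the image of `e` under `shift` in terms of its previous truncation, and
`F` keeps the injection `shift` injective. -/
theorem IsExp.unique [IsLex F] {t : F.obj dual} {n : ℕ} {e e' : F.obj (trunc point (n + 1))}
    (h : IsExp t n e) (h' : IsExp t n e') : e = e' := by
  induction n with
  | zero =>
    have key {e : F.obj (trunc point (0 + 1))} (h : IsExp t 0 e) : e = 0 := by
      have hX : trunc.mk (R := point) (0 + 1) Polynomial.X =
          toAlgHom (fromPoint (trunc point (0 + 1))) 0 := by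
        rw [map_zero, ← pow_one (trunc.mk _ _)]
        exact trunc.X_pow
      rw [← restrictT_self e, restrictT, hX, ← pts_evT _ _ (by simp), h.zero, map_zero]
    rw [key h, key h']
  | succ n ih =>
    have hr := ih (h.restrict (Nat.le_succ n)) (h'.restrict (Nat.le_succ n))
    refine IsLex.injective (shift_injective point n) ?_
    have key {e : F.obj (trunc point (n + 1 + 1))} (h : IsExp t (n + 1) e) :
        pts F (shift point (n + 1)) e =
          pts F (dualOver.incl _) (restrictT e (n + 1)) + evLie t (dualOver.eps _) := by
      have hX : trunc.mk (R := point) (n + 1) Polynomial.X ^ (n + 1) = 0 := trunc.X_pow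
      conv_lhs => rw [← restrictT_self e]
      rw [restrictT, pts_evT _ _ trunc.X_pow, shift_X,
        h.add _ _ (by rw [← map_pow, hX, map_zero]) (dualOver.eps_sq _), restrictT,
        pts_evT _ _ (trunc.X_pow_of_le (Nat.le_succ _))]
    rw [key h, key h', hr]

section

variable [IsLex F]

/-- The formal exponential `t ↦ exp(x t)` for nilpotent `x ∈ R`. -/
def nexp {R : FinAlg} (t : Lie F) (x : R.obj) : F.obj R :=
  evT (exists_isExp t.2 (nilpotencyClass x)).choose x

/-- The degree chosen in `nexp` is immaterial: by uniqueness any two truncations are restrictions of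
a common higher one. -/
theorem nexp_eq {R : FinAlg} (t : Lie F) {x : R.obj} {n : ℕ} (hx : x ^ (n + 1) = 0)
    {e : F.obj (trunc point (n + 1))} (he : IsExp (t : F.obj dual) n e) : nexp t x = evT e x := by
  have he' := (exists_isExp t.2 (nilpotencyClass x)).choose_spec
  obtain ⟨E, hE⟩ := exists_isExp t.2 (max (nilpotencyClass x) n)
  have hx' : x ^ (nilpotencyClass x + 1) = 0 := by
    rw [pow_succ, pow_nilpotencyClass ⟨_, hx⟩, zero_mul]
  rw [nexp, he'.unique (hE.restrict (le_max_left _ _)), he.unique (hE.restrict (le_max_right _ _)),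
    evT_restrictT (by omega) _ hx', evT_restrictT (by omega) _ hx]

theorem exists_nexp_eq {R : FinAlg} (t : Lie F) {x : R.obj} (hx : IsNilpotent x) :
    ∃ (n : ℕ) (e : F.obj (trunc point (n + 1))), x ^ n = 0 ∧ IsExp (t : F.obj dual) n e := by
  obtain ⟨n, hn⟩ := hx
  obtain ⟨e, he⟩ := exists_isExp t.2 n
  exact ⟨n, e, hn, he⟩

theorem pts_nexp {R S : FinAlg} (φ : R ⟶ S) (t : Lie F) {x : R.obj} (hx : IsNilpotent x) :
    pts F φ (nexp t x) = nexp t (toAlgHom φ x) := by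
  obtain ⟨n, e, hn, he⟩ := exists_nexp_eq t hx
  have hn' : x ^ (n + 1) = 0 := by rw [pow_succ, hn, zero_mul]
  rw [nexp_eq t hn' he, nexp_eq t (by rw [← map_pow, hn', map_zero]) he, pts_evT _ _ hn']

theorem nexp_zero {R : FinAlg} (t : Lie F) : nexp t (0 : R.obj) = 0 := by
  obtain ⟨e, he⟩ := exists_isExp t.2 0
  rw [nexp_eq t (by simp) he, ← map_zero (toAlgHom (fromPoint R)), ← pts_evT _ _ (by simp), he.zero,
    map_zero]

theorem nexp_add_sq {R : FinAlg} (t : Lie F) {x y : R.obj} (hx : IsNilpotent x) (hy : y ^ 2 = 0) :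
    nexp t (x + y) = nexp t x + evLie (t : F.obj dual) y := by
  obtain ⟨n, e, hn, he⟩ := exists_nexp_eq t hx
  rw [nexp_eq t (add_pow_eq_zero hn hy) he, nexp_eq t (by rw [pow_succ, hn, zero_mul]) he,
    he.add x y hn hy]

theorem nexp_sq {R : FinAlg} (t : Lie F) {y : R.obj} (hy : y ^ 2 = 0) :
    nexp t y = evLie (t : F.obj dual) y := by
  have h := nexp_add_sq t (IsNilpotent.zero (R := R.obj)) hy
  rwa [zero_add, nexp_zero, zero_add] at h

/-- Additivity for square-zero increments is built in. The general case is an induction on the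
nilpotency order of `y`, over all algebras at once, since the universal `y = X` lives in
`R[X]/(X^(n+2))` and is lowered in order by `shift`. -/
theorem nexp_add {R : FinAlg} (t : Lie F) {x y : R.obj} (hx : IsNilpotent x) (hy : IsNilpotent y) :
    nexp t (x + y) = nexp t x + nexp t y := by
  obtain ⟨n, hn⟩ := hy
  have hn' : y ^ (n + 1) = 0 := by rw [pow_succ, hn, zero_mul]
  clear hn
  induction n generalizing R with
  | zero =>
    have : y = 0 := by simpa using hn'
    rw [this, add_zero, nexp_zero, add_zero]
  | succ n ih =>
    have hX : trunc.mk (R := R) (n + 1) Polynomial.X ^ (n + 1) = 0 := trunc.X_pow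
    have hX2 : trunc.mk (R := R) (n + 1 + 1) Polynomial.X ^ (n + 1 + 1) = 0 := trunc.X_pow
    have hx' := hx.map (toAlgHom (trunc.incl R (n + 1)))
    have hx2 := hx.map (toAlgHom (trunc.incl R (n + 1 + 1)))
    -- After the injective `shift` the element `X` becomes `X + ε`; `ε` splits off by `nexp_add_sq`,
    -- and what is left is the inductive case over `R[X]/(X^(n+1))`.
    have key : nexp t (toAlgHom (trunc.incl R (n + 1 + 1)) x + trunc.mk _ Polynomial.X) =
        nexp t (toAlgHom (trunc.incl R (n + 1 + 1)) x) + nexp t (trunc.mk _ Polynomial.X) := by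
      refine IsLex.injective (shift_injective R n) ?_
      have hY := (show IsNilpotent _ from ⟨_, hX⟩).map (toAlgHom (dualOver.incl (trunc R (n + 1))))
      rw [map_add, pts_nexp _ _ (Commute.isNilpotent_add (Commute.all _ _) hx2 ⟨_, hX2⟩),
        pts_nexp _ _ hx2, pts_nexp _ _ ⟨_, hX2⟩, map_add, shift_X, ← toAlgHom_comp, incl_shift,
        toAlgHom_comp, ← add_assoc, ← map_add,
        nexp_add_sq t ((Commute.isNilpotent_add (Commute.all _ _) hx' ⟨_, hX⟩).map _)
          (dualOver.eps_sq _),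
        nexp_add_sq t hY (dualOver.eps_sq _), ← pts_nexp _ _
          (Commute.isNilpotent_add (Commute.all _ _) hx' ⟨_, hX⟩), ih hx' hX, map_add,
        pts_nexp _ _ hx', pts_nexp _ _ ⟨_, hX⟩, add_assoc]
    have h := congrArg (pts F (trunc.lift (𝟙 R) y hn')) key
    rw [map_add, pts_nexp _ _ (Commute.isNilpotent_add (Commute.all _ _) hx2 ⟨_, hX2⟩),
        pts_nexp _ _ hx2, pts_nexp _ _ ⟨_, hX2⟩, map_add, trunc.lift_X, ← toAlgHom_comp,
        trunc.incl_lift] at h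
    exact h

theorem nexp_add_left {R : FinAlg} (t t' : Lie F) {x : R.obj} (hx : IsNilpotent x) :
    nexp (t + t') x = nexp t x + nexp t' x := by
  obtain ⟨n, e, hn, he⟩ := exists_nexp_eq t hx
  obtain ⟨e', he'⟩ := exists_isExp t'.2 n
  have hn' : x ^ (n + 1) = 0 := by rw [pow_succ, hn, zero_mul]
  have h : IsExp ((t + t' : Lie F) : F.obj dual) n (e + e') := by
    refine ⟨by rw [evT_add_left, he.zero, he'.zero, add_zero], fun x y hx hy => ?_⟩
    rw [evT_add_left, evT_add_left, he.add x y hx hy, he'.add x y hx hy, AddSubgroup.coe_add,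
      evLie_add_left, add_add_add_comm]
  rw [nexp_eq _ hn' h, nexp_eq _ hn' he, nexp_eq _ hn' he', evT_add_left]

/-- The reparametrized family `e(c X)` satisfies the equation with tangent vector `c • t`. -/
theorem nexp_smul {R : FinAlg} (c : ℂ) (t : Lie F) {x : R.obj} (hx : IsNilpotent x) :
    nexp (c • t) x = nexp t (c • x) := by
  obtain ⟨n, e, hn, he⟩ := exists_nexp_eq t hx
  have hn' : x ^ (n + 1) = 0 := by rw [pow_succ, hn, zero_mul]
  have hX : (c • trunc.mk (R := point) (n + 1) Polynomial.X) ^ (n + 1) = 0 := by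
    rw [smul_pow, trunc.X_pow, smul_zero]
  have ev {S : FinAlg} {y : S.obj} (hy : y ^ (n + 1) = 0) :
      evT (evT e (c • trunc.mk (R := point) (n + 1) Polynomial.X)) y = evT e (c • y) := by
    rw [evT_eq _ hy, pts_evT _ _ hX, map_smul, evTrunc_X]
  have h : IsExp ((c • t : Lie F) : F.obj dual) n
      (evT e (c • trunc.mk (R := point) (n + 1) Polynomial.X)) := by
    refine ⟨by rw [ev (by simp), smul_zero, he.zero], fun x y hx hy => ?_⟩
    rw [ev (add_pow_eq_zero hx hy), ev (by rw [pow_succ, hx, zero_mul]), smul_add,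
      he.add _ _ (by rw [smul_pow, hx, smul_zero]) (by rw [smul_pow, hy, smul_zero]),
      Lie.coe_smul, evLie_scale c _ hy]
  rw [nexp_eq _ hn' h, nexp_eq _ (by rw [smul_pow, hn', smul_zero]) he, ev hn']

end

/-- The linear map of Lie algebras induced by a homomorphism of group functors. -/
def lieMap {F G : FinAlg ⥤ AddCommGrpCat.{0}} [IsLex F] [IsLex G] (α : F ⟶ G) :
    Lie F →ₗ[ℂ] Lie G where
  toFun t := ⟨(α.app dual).hom t, by
    rw [mem_Lie, ← pts_naturality, mem_Lie.1 t.2, map_zero]⟩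
  map_add' t t' := Subtype.ext (map_add (α.app dual).hom _ _)
  map_smul' c t := Subtype.ext (pts_naturality α (dualScale c) t)

theorem app_nexp {F G : FinAlg ⥤ AddCommGrpCat.{0}} [IsLex F] [IsLex G] (α : F ⟶ G) {R : FinAlg}
    (t : Lie F) {x : R.obj} (hx : IsNilpotent x) :
    (α.app R).hom (nexp t x) = nexp (lieMap α t) x := by
  obtain ⟨n, e, hn, he⟩ := exists_nexp_eq t hx
  have hn' : x ^ (n + 1) = 0 := by rw [pow_succ, hn, zero_mul]
  have h : IsExp (lieMap α t : G.obj dual) n ((α.app _).hom e) := by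
    refine ⟨by rw [← app_evT, he.zero, map_zero], fun x y hx hy => ?_⟩
    rw [← app_evT, he.add x y hx hy, map_add, app_evT, app_evLie]
    rfl
  rw [nexp_eq _ hn' he, nexp_eq _ hn' h, app_evT]

/-- The exponential `Nil(R) ⊗ Lie F → F(R)`. -/
def expHom (F : FinAlg ⥤ AddCommGrpCat.{0}) [IsLex F] (R : FinAlg) :
    (nilradical R.obj ⊗[ℂ] Lie F) →+ F.obj R :=
  TensorProduct.liftAddHom
    (AddMonoidHom.mk' (fun x => AddMonoidHom.mk' (fun t => nexp t (x : R.obj))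
      fun t t' => nexp_add_left t t' x.2)
      fun x y => AddMonoidHom.ext fun t => nexp_add t x.2 y.2)
    fun c x t => (nexp_smul c t x.2).symm

theorem expHom_tmul {F : FinAlg ⥤ AddCommGrpCat.{0}} [IsLex F] {R : FinAlg}
    (x : nilradical R.obj) (t : Lie F) : expHom F R (x ⊗ₜ t) = nexp t (x : R.obj) := rfl

end Exponential

/-! ### Points of a finite algebra and its reduced quotient -/

section Points

open FinAlg

theorem exists_algebraMap_sub_mem {R : FinAlg} (p : Ideal R.obj) [p.IsPrime] (r : R.obj) :
    ∃ c : ℂ, r - algebraMap ℂ R.obj c ∈ p := by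
  have : Module.Finite ℂ (R.obj ⧸ p) :=
    Module.Finite.of_surjective (Ideal.Quotient.mkₐ ℂ p).toLinearMap
      (Ideal.Quotient.mkₐ_surjective ℂ p)
  obtain ⟨c, hc⟩ := (IsAlgClosed.algebraMap_bijective_of_isIntegral (k := ℂ)
    (K := R.obj ⧸ p)).2 (Ideal.Quotient.mk p r)
  exact ⟨c, Ideal.Quotient.eq.1 hc.symm⟩

theorem exists_point_of_isPrime {R : FinAlg} (p : Ideal R.obj) [p.IsPrime] :
    ∃ φ : R ⟶ point, ∀ x, toAlgHom φ x = 0 ↔ x ∈ p := by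
  have : Module.Finite ℂ (R.obj ⧸ p) :=
    Module.Finite.of_surjective (Ideal.Quotient.mkₐ ℂ p).toLinearMap
      (Ideal.Quotient.mkₐ_surjective ℂ p)
  let e : ℂ ≃ₐ[ℂ] (R.obj ⧸ p) := AlgEquiv.ofBijective (Algebra.ofId ℂ _)
    (IsAlgClosed.algebraMap_bijective_of_isIntegral (k := ℂ) (K := R.obj ⧸ p))
  refine ⟨homOf ((e.symm : (R.obj ⧸ p) →ₐ[ℂ] ℂ).comp (Ideal.Quotient.mkₐ ℂ p)), fun x => ?_⟩
  exact e.symm.map_eq_zero_iff.trans Ideal.Quotient.eq_zero_iff_mem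

theorem mem_nilradical_iff_points {R : FinAlg} {x : R.obj} :
    x ∈ nilradical R.obj ↔ ∀ φ : R ⟶ point, toAlgHom φ x = 0 := by
  refine ⟨fun h φ => ?_, fun h => ?_⟩
  · exact ((mem_nilradical.1 h).map (toAlgHom φ)).eq_zero
  · rw [nilradical_eq_sInf, Submodule.mem_sInf]
    intro (p : Ideal R.obj) hp
    have : p.IsPrime := hp
    obtain ⟨φ, hφ⟩ := exists_point_of_isPrime p
    exact (hφ x).1 (h φ)

theorem point_ext_of_ker_le {R : FinAlg} {φ ψ : R ⟶ point}
    (h : RingHom.ker (toAlgHom φ) ≤ RingHom.ker (toAlgHom ψ)) : φ = ψ := by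
  refine FinAlg.hom_ext fun x => ?_
  have h1 : x - algebraMap ℂ R.obj (toAlgHom φ x) ∈ RingHom.ker (toAlgHom φ) := by
    rw [RingHom.mem_ker, map_sub, AlgHom.commutes, Algebra.algebraMap_self_apply, sub_self]
  have h2 := h h1
  rw [RingHom.mem_ker, map_sub, AlgHom.commutes, Algebra.algebraMap_self_apply, sub_eq_zero] at h2
  exact h2.symm

theorem ker_point_isMaximal {R : FinAlg} (φ : R ⟶ point) :
    (RingHom.ker (toAlgHom φ)).IsMaximal :=
  RingHom.ker_isMaximal_of_surjective (K := ℂ) _ fun c => ⟨algebraMap ℂ R.obj c, by simp⟩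

instance (R : FinAlg) : IsArtinianRing R.obj := IsArtinianRing.of_finite ℂ R.obj

instance (R : FinAlg) : Finite (R ⟶ point) := by
  refine Finite.of_injective
    (fun φ : R ⟶ point => (⟨RingHom.ker (toAlgHom φ), ker_point_isMaximal φ⟩ : MaximalSpectrum R.obj))
    fun φ ψ h => point_ext_of_ker_le ?_
  exact (congrArg MaximalSpectrum.asIdeal h).le

theorem exists_forall_points_eq {R : FinAlg} (m : (R ⟶ point) → ℂ) :
    ∃ x : R.obj, ∀ φ, toAlgHom φ x = m φ := by
  obtain ⟨r, hr⟩ := Ideal.exists_forall_sub_mem_ideal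
    (I := fun φ : R ⟶ point => RingHom.ker (toAlgHom φ)) (fun φ ψ h => by
      have := ker_point_isMaximal φ
      have := ker_point_isMaximal ψ
      exact Ideal.isCoprime_of_isMaximal fun e => h (point_ext_of_ker_le e.le))
    fun φ => algebraMap ℂ R.obj (m φ)
  refine ⟨r, fun φ => ?_⟩
  have h := hr φ
  rw [RingHom.mem_ker, map_sub, AlgHom.commutes, sub_eq_zero] at h
  exact h

/-- The algebra of functions on the set of points of `R`. -/
def redAlg (R : FinAlg) : FinAlg := of ((R ⟶ point) → ℂ)

/-- Evaluation of functions at a point. -/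
def redAlg.ev {R : FinAlg} (φ : R ⟶ point) : redAlg R ⟶ point :=
  homOf (R := redAlg R) (S := point) (Pi.evalAlgHom ℂ (fun _ => ℂ) φ)

/-- The homomorphism from `R` to the functions on its points. -/
def redAlg.proj (R : FinAlg) : R ⟶ redAlg R :=
  homOf (S := redAlg R) (AlgHom.pi fun φ => toAlgHom φ)

theorem redAlg.proj_ev {R : FinAlg} (φ : R ⟶ point) : redAlg.proj R ≫ redAlg.ev φ = φ := rfl

/-- The map to functions on points is onto by the Chinese remainder theorem and has nilpotent
kernel, and a finite power of `ℂ` is formally smooth, so the identity lifts. -/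
theorem redAlg.exists_sec (R : FinAlg) : ∃ s : redAlg R ⟶ R, s ≫ redAlg.proj R = 𝟙 _ := by
  have hs : Function.Surjective (toAlgHom (redAlg.proj R)) := fun m => by
    obtain ⟨x, hx⟩ := exists_forall_points_eq (R := R) m
    exact ⟨x, funext hx⟩
  have hn : IsNilpotent (RingHom.ker (toAlgHom (redAlg.proj R) : R.obj →+* (redAlg R).obj)) := by
    obtain ⟨n, hn⟩ := IsNoetherianRing.isNilpotent_nilradical R.obj
    refine ⟨n, le_bot_iff.1 (le_trans (Ideal.pow_right_mono ?_ n) hn.le)⟩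
    exact fun x hx => mem_nilradical_iff_points.2 fun φ => congrFun (RingHom.mem_ker.1 hx) φ
  have : Algebra.FormallySmooth ℂ (redAlg R).obj :=
    inferInstanceAs (Algebra.FormallySmooth ℂ ((R ⟶ point) → ℂ))
  exact ⟨homOf (R := redAlg R) (Algebra.FormallySmooth.liftOfSurjective (AlgHom.id ℂ (redAlg R).obj)
    (toAlgHom (redAlg.proj R)) hs hn), FinAlg.hom_ext fun x =>
    Algebra.FormallySmooth.liftOfSurjective_apply _ _ hs hn x⟩

/-- The section of the projection of `R` to the functions on its points. -/
def redAlg.sec (R : FinAlg) : redAlg R ⟶ R := (redAlg.exists_sec R).choose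

theorem redAlg.sec_comp {R : FinAlg} (φ : R ⟶ point) : redAlg.sec R ≫ φ = redAlg.ev φ := by
  have h := (redAlg.exists_sec R).choose_spec
  rw [← redAlg.proj_ev φ, ← Category.assoc]
  exact (congrArg (· ≫ redAlg.ev φ) h).trans (Category.id_comp _)

/-- The difference is nilpotent, but the difference `d` of two commuting idempotents satisfies `d^3
= d`. -/
theorem IsIdempotentElem.eq_of_points {R : FinAlg} {x y : R.obj} (hx : IsIdempotentElem x)
    (hy : IsIdempotentElem y) (h : ∀ φ : R ⟶ point, toAlgHom φ x = toAlgHom φ y) : x = y := by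
  have hn : IsNilpotent (x - y) :=
    mem_nilradical.1 (mem_nilradical_iff_points.2 fun φ => by rw [map_sub, h, sub_self])
  have hc : (x - y) ^ 3 = x - y := by
    linear_combination (x + 1 - 3 * y) * hx.eq + (3 * x - y - 1) * hy.eq
  obtain ⟨n, hn⟩ := hn
  have key (k : ℕ) : (x - y) ^ (2 * k + 1) = x - y := by
    induction k with
    | zero => simp
    | succ k ih => rw [show 2 * (k + 1) + 1 = 2 * k + 1 + 2 by ring, pow_add, ih, ← pow_succ', hc]
  exact sub_eq_zero.1 ((key n).symm.trans (pow_eq_zero_of_le (by omega) hn))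

/-- A power of `ℂ` is spanned by idempotents, whose images are determined by their values at points.
This rigidity is what makes the chosen sections natural in `R`. -/
theorem redAlg.hom_ext {R S : FinAlg} {f g : redAlg R ⟶ S} (h : ∀ φ : S ⟶ point, f ≫ φ = g ≫ φ) :
    f = g := by
  classical
  let f' : ((R ⟶ point) → ℂ) →ₐ[ℂ] S.obj := toAlgHom f
  let g' : ((R ⟶ point) → ℂ) →ₐ[ℂ] S.obj := toAlgHom g
  have key (A : (R ⟶ point) → ℂ) (hA : IsIdempotentElem A) : f' A = g' A :=
    IsIdempotentElem.eq_of_points (hA.map f') (hA.map g')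
      fun φ => congrArg (fun m => toAlgHom m A) (h φ)
  have := Fintype.ofFinite (R ⟶ point)
  have hfg : f'.toLinearMap = g'.toLinearMap := by
    refine LinearMap.pi_ext fun φ c => ?_
    have hc : (Pi.single φ c : (R ⟶ point) → ℂ) = c • Pi.single φ 1 := by
      rw [← Pi.single_smul, smul_eq_mul, mul_one]
    rw [hc, map_smul, map_smul]
    refine congrArg (c • ·) (key _ ?_)
    rw [IsIdempotentElem, ← Pi.single_mul, one_mul]
  exact FinAlg.hom_ext fun x => LinearMap.congr_fun hfg x

theorem exists_idempotent {R : FinAlg} (A : Set (R ⟶ point)) : ∃ e : R.obj, IsIdempotentElem e ∧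
    ∀ φ : R ⟶ point, (φ ∈ A → toAlgHom φ e = 1) ∧ (φ ∉ A → toAlgHom φ e = 0) := by
  classical
  let m : (R ⟶ point) → ℂ := fun φ => if φ ∈ A then 1 else 0
  refine ⟨toAlgHom (redAlg.sec R) m, ?_, fun φ => ?_⟩
  · have hm : IsIdempotentElem m := funext fun φ => by
      change m φ * m φ = m φ
      by_cases h : φ ∈ A <;> simp [m, h]
    exact hm.map (toAlgHom (redAlg.sec R) : ((R ⟶ point) → ℂ) →ₐ[ℂ] R.obj)
  · have h : toAlgHom φ (toAlgHom (redAlg.sec R) m) = m φ :=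
      congrArg (fun k => toAlgHom k m) (redAlg.sec_comp φ)
    rw [h]
    exact ⟨fun hφ => if_pos hφ, fun hφ => if_neg hφ⟩

/-- Evaluations present `redAlg R` as a product. -/
def redAlg.isLimitFan (R : FinAlg) : IsLimit (Fan.mk (redAlg R) (redAlg.ev (R := R))) :=
  Fan.IsLimit.mk _
    (fun s => homOf (S := redAlg R) (AlgHom.pi fun φ =>
      toAlgHom (s.proj φ)))
    (fun _ _ => rfl)
    (fun _ _ h => FinAlg.hom_ext fun x => funext fun φ =>
      congrArg (fun k => toAlgHom k x) (h φ))

section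

variable {F : FinAlg ⥤ AddCommGrpCat.{0}} [hF : IsLex F]

theorem redAlg.isLimitFanMap (F : FinAlg ⥤ AddCommGrpCat.{0}) [IsLex F] (R : FinAlg) :
    Nonempty (IsLimit (Fan.mk (F.obj (redAlg R))
      fun φ : R ⟶ point => F.map (redAlg.ev φ))) := by
  have := IsLex.preservesFiniteLimits F
  have : PreservesFiniteProducts F := inferInstance
  have := Fintype.ofFinite (R ⟶ point)
  exact ⟨isLimitFanMkObjOfIsLimit F _ _ (redAlg.isLimitFan R)⟩

theorem redAlg.pts_ext {R : FinAlg} {x y : F.obj (redAlg R)}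
    (h : ∀ φ, pts F (redAlg.ev φ) x = pts F (redAlg.ev φ) y) : x = y := by
  obtain ⟨hl⟩ := redAlg.isLimitFanMap F R
  exact Concrete.isLimit_ext _ hl x y fun ⟨φ⟩ => h φ

theorem redAlg.exists_pts {R : FinAlg} (m : (R ⟶ point) → F.obj point) :
    ∃ x : F.obj (redAlg R), ∀ φ, pts F (redAlg.ev φ) x = m φ := by
  obtain ⟨hl⟩ := redAlg.isLimitFanMap F R
  let P : AddCommGrpCat.{0} := AddCommGrpCat.of ((R ⟶ point) → F.obj point)
  let u : P ⟶ F.obj (redAlg R) := Fan.IsLimit.lift hl fun φ =>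
    AddCommGrpCat.ofHom (Pi.evalAddMonoidHom _ φ)
  refine ⟨u.hom m, fun φ => ?_⟩
  have h : u ≫ F.map (redAlg.ev φ) = AddCommGrpCat.ofHom (Pi.evalAddMonoidHom _ φ) :=
    Fan.IsLimit.fac hl _ φ
  exact congrArg (fun k => k.hom m) h

theorem eq_zero_of_reduced {R : FinAlg} (h : nilradical R.obj = ⊥) {x : F.obj R}
    (hx : ∀ φ : R ⟶ point, pts F φ x = 0) : x = 0 := by
  have hi : Function.Injective (toAlgHom (redAlg.proj R)) := by
    refine (injective_iff_map_eq_zero _).2 fun a ha => ?_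
    rw [← Ideal.mem_bot, ← h, mem_nilradical_iff_points]
    exact fun φ => congrFun ha φ
  refine IsLex.injective (F := F) hi (redAlg.pts_ext fun φ => ?_)
  rw [← pts_comp, redAlg.proj_ev, hx, map_zero, map_zero]

end

end Points

/-! ### The decomposition of a left exact group functor -/

section ExponentialIso

open FinAlg

/-- The linear map of nilradicals induced by an algebra homomorphism. -/
def nilMap {R S : FinAlg} (φ : R ⟶ S) : nilradical R.obj →ₗ[ℂ] nilradical S.obj where
  toFun x := ⟨toAlgHom φ x, mem_nilradical.2 ((mem_nilradical.1 x.2).map (toAlgHom φ))⟩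
  map_add' x y := Subtype.ext (map_add (toAlgHom φ) (x : R.obj) y)
  map_smul' c x := Subtype.ext (map_smul (toAlgHom φ) c (x : R.obj))

theorem coe_nilMap {R S : FinAlg} (φ : R ⟶ S) (x : nilradical R.obj) :
    (nilMap φ x : S.obj) = toAlgHom φ x := rfl

theorem subsingleton_nilradical_point : Subsingleton (nilradical point.obj) :=
  ⟨fun x y => Subtype.ext (by
    rw [(mem_nilradical.1 x.2).eq_zero, (mem_nilradical.1 y.2).eq_zero])⟩

variable {F : FinAlg ⥤ AddCommGrpCat.{0}} [IsLex F]

theorem pts_expHom {R S : FinAlg} (φ : R ⟶ S) (z : nilradical R.obj ⊗[ℂ] Lie F) :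
    pts F φ (expHom F R z) = expHom F S (LinearMap.rTensor (Lie F) (nilMap φ) z) := by
  induction z using TensorProduct.induction_on with
  | zero => simp only [map_zero]
  | add z w hz hw => simp only [map_add, hz, hw]
  | tmul x t =>
    rw [LinearMap.rTensor_tmul, expHom_tmul, expHom_tmul, pts_nexp _ _ (mem_nilradical.1 x.2),
      coe_nilMap]

theorem app_expHom {G : FinAlg ⥤ AddCommGrpCat.{0}} [IsLex G] (α : F ⟶ G) {R : FinAlg}
    (z : nilradical R.obj ⊗[ℂ] Lie F) :
    (α.app R).hom (expHom F R z) = expHom G R (LinearMap.lTensor _ (lieMap α) z) := by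
  induction z using TensorProduct.induction_on with
  | zero => simp only [map_zero]
  | add z w hz hw => simp only [map_add, hz, hw]
  | tmul x t =>
    rw [LinearMap.lTensor_tmul, expHom_tmul, expHom_tmul, app_nexp _ _ (mem_nilradical.1 x.2)]

theorem pts_expHom_point {R : FinAlg} (φ : R ⟶ point) (z : nilradical R.obj ⊗[ℂ] Lie F) :
    pts F φ (expHom F R z) = 0 := by
  have := subsingleton_nilradical_point
  rw [pts_expHom, Subsingleton.elim (LinearMap.rTensor (Lie F) (nilMap φ) z) 0, map_zero]

/-- A nonzero nilpotent element spanning an ideal of dimension one. -/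
theorem exists_socle_element {R : FinAlg} (h : nilradical R.obj ≠ ⊥) :
    ∃ x : R.obj, x ≠ 0 ∧ x ^ 2 = 0 ∧ ∀ r : R.obj, ∃ c : ℂ, r * x = c • x := by
  have : Nontrivial (nilradical R.obj) := Submodule.nontrivial_iff_ne_bot.2 h
  -- An associated prime of the nilradical is the annihilator of some nilpotent `x`. Its residue
  -- field is `ℂ`, so `R` acts on `x` by scalars; being nilpotent, `x` lies in this prime, whence `x
  -- * x = 0`.
  obtain ⟨p, hp'⟩ := associatedPrimes.nonempty R.obj (nilradical R.obj)
  obtain ⟨hp, x, hx⟩ := isAssociatedPrime_iff.1 hp'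
  have hmem (r : R.obj) : r ∈ p ↔ r * (x : R.obj) = 0 := by
    rw [hx, Submodule.mem_colon_singleton, Submodule.mem_bot, ← Subtype.coe_inj]
    rfl
  have key (r : R.obj) : ∃ c : ℂ, r * (x : R.obj) = c • (x : R.obj) := by
    obtain ⟨c, hc⟩ := exists_algebraMap_sub_mem p r
    refine ⟨c, ?_⟩
    rw [hmem, sub_mul, sub_eq_zero] at hc
    rw [hc, Algebra.smul_def]
  have hx0 : (x : R.obj) ≠ 0 := fun h0 =>
    hp.ne_top ((Ideal.eq_top_iff_one p).2 ((hmem 1).2 (by rw [h0, mul_zero])))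
  refine ⟨x, hx0, ?_, key⟩
  have hxp : (x : R.obj) ∈ p := by
    obtain ⟨n, hn⟩ := mem_nilradical.1 x.2
    exact hp.mem_of_pow_mem n (hn ▸ p.zero_mem)
  rw [pow_two]
  exact (hmem _).1 hxp

/-- The quotient of `R` by the ideal generated by `x`. -/
def quotAlg (R : FinAlg) (x : R.obj) : FinAlg :=
  haveI : Module.Finite ℂ (R.obj ⧸ Ideal.span {x}) :=
    Module.Finite.of_surjective (Ideal.Quotient.mkₐ ℂ _).toLinearMap
      (Ideal.Quotient.mkₐ_surjective ℂ _)
  of (R.obj ⧸ Ideal.span {x})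

/-- The projection of `R` to its quotient by the ideal generated by `x`. -/
def quotAlg.mk {R : FinAlg} (x : R.obj) : R ⟶ quotAlg R x :=
  homOf (S := quotAlg R x) (Ideal.Quotient.mkₐ ℂ _)

theorem quotAlg.mk_surjective {R : FinAlg} (x : R.obj) :
    Function.Surjective (toAlgHom (quotAlg.mk x)) :=
  Ideal.Quotient.mkₐ_surjective ℂ _

theorem quotAlg.mk_eq_zero {R : FinAlg} {x : R.obj} {r : R.obj} :
    toAlgHom (quotAlg.mk x) r = 0 ↔ ∃ s, r = s * x :=
  Ideal.Quotient.eq_zero_iff_mem.trans (Ideal.mem_span_singleton'.trans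
    (exists_congr fun _ => eq_comm))

theorem quotAlg.finrank_lt {R : FinAlg} {x : R.obj} (hx : x ≠ 0) :
    Module.finrank ℂ (quotAlg R x).obj < Module.finrank ℂ R.obj := by
  have h := (toAlgHom (quotAlg.mk x)).toLinearMap.finrank_range_add_finrank_ker
  rw [LinearMap.range_eq_top.2 (quotAlg.mk_surjective x), finrank_top] at h
  have hk : 0 < Module.finrank ℂ (LinearMap.ker (toAlgHom (quotAlg.mk x)).toLinearMap) := by
    have : Nontrivial (LinearMap.ker (toAlgHom (quotAlg.mk x)).toLinearMap) :=
      Submodule.nontrivial_iff_ne_bot.2 fun hb => hx (by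
        rw [← Submodule.mem_bot ℂ, ← hb]
        exact quotAlg.mk_eq_zero.2 ⟨1, (one_mul x).symm⟩)
    exact Module.finrank_pos
  omega

/-- Since the ideal `(x)` is the line `ℂ x`, the subalgebra `ℂ + ℂ x` of `R` is a copy of `ℂ[ε]` and
is the preimage of `ℂ` in `R/(x)`. A left exact functor therefore identifies the kernel of `F(R) →
F(R/(x))` with its Lie algebra. -/
theorem isFibreProduct_quotAlg {R : FinAlg} {x : R.obj} (hx0 : x ≠ 0) (hx : x ^ 2 = 0)
    (h : ∀ r : R.obj, ∃ c : ℂ, r * x = c • x) :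
    IsFibreProduct (evDual x hx) dualToPoint (quotAlg.mk x) (fromPoint _) := by
  have hev (z : dual.obj) : toAlgHom (evDual x hx) z =
      algebraMap ℂ R.obj (toAlgHom dualToPoint z) + (TrivSqZeroExt.snd z : ℂ) • x := by
    rw [Algebra.smul_def]
    exact dualOver.lift_apply (R := point) (fromPoint R) x hx z
  refine ⟨dual_hom_ext ?_, fun z w h1 h2 => ?_, fun r c hrc => ?_⟩
  · rw [toAlgHom_comp, evDual_eps, quotAlg.mk_eq_zero.2 ⟨1, (one_mul x).symm⟩]
    exact (map_zero (toAlgHom (fromPoint _))).symm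
  · rw [hev, hev, h2, add_right_inj, ← sub_eq_zero, ← sub_smul, smul_eq_zero, sub_eq_zero] at h1
    exact TrivSqZeroExt.ext h2 (h1.resolve_right hx0)
  · have hr : toAlgHom (quotAlg.mk x) (r - algebraMap ℂ R.obj c) = 0 := by
      rw [map_sub, hrc, AlgHom.commutes]
      exact sub_self _
    obtain ⟨s, hs⟩ := quotAlg.mk_eq_zero.1 hr
    obtain ⟨d, hd⟩ := h s
    let w : TrivSqZeroExt ℂ ℂ := TrivSqZeroExt.inl c + TrivSqZeroExt.inr d
    have h1 : toAlgHom dualToPoint w = c := add_zero _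
    have h2 : w.snd = d := zero_add _
    refine ⟨w, ?_, h1⟩
    rw [hev, h1, h2, eq_comm, ← sub_eq_iff_eq_add', hs, hd]

theorem nilMap_mk_surjective {R : FinAlg} {x : R.obj} (hx : x ^ 2 = 0) :
    Function.Surjective (nilMap (quotAlg.mk x)) := by
  rintro ⟨y, hy⟩
  obtain ⟨r, rfl⟩ := quotAlg.mk_surjective x y
  refine ⟨⟨r, ?_⟩, rfl⟩
  obtain ⟨n, hn⟩ := mem_nilradical.1 hy
  rw [← map_pow] at hn
  obtain ⟨s, hs⟩ := quotAlg.mk_eq_zero.1 hn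
  exact ⟨n * 2, by rw [pow_mul, hs, mul_pow, hx, mul_zero]; rfl⟩

theorem nilMap_mk_exact {R : FinAlg} {x : R.obj} (hx : x ^ 2 = 0)
    (h : ∀ r : R.obj, ∃ c : ℂ, r * x = c • x) :
    Function.Exact (LinearMap.toSpanSingleton ℂ (nilradical R.obj) ⟨x, mem_nilradical.2 ⟨2, hx⟩⟩)
      (nilMap (quotAlg.mk x)) := by
  intro y
  rw [← Subtype.coe_inj, coe_nilMap]
  refine quotAlg.mk_eq_zero.trans ⟨fun ⟨s, hs⟩ => ?_, fun ⟨c, hc⟩ => ?_⟩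
  · obtain ⟨c, hc⟩ := h s
    exact ⟨c, Subtype.ext (hc.symm.trans hs.symm)⟩
  · exact ⟨algebraMap ℂ R.obj c, by rw [← hc, ← Algebra.smul_def]; rfl⟩

/-- Induction on the dimension of `R`. Dividing by a socle element `x` compares the sequence `ℂ x ⊗
Lie F → Nil(R) ⊗ Lie F → Nil(R/(x)) ⊗ Lie F` with `Lie F → F(R) → F(R/(x))`, on whose first term the
exponential is the identity. The reduced case holds because then `R` embeds in the functions on its
points. -/
theorem expHom_bijective_aux (F : FinAlg ⥤ AddCommGrpCat.{0}) [IsLex F] (R : FinAlg) :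
    (∀ z, expHom F R z = 0 → z = 0) ∧
      ∀ y, (∀ φ : R ⟶ point, pts F φ y = 0) → ∃ z, expHom F R z = y := by
  induction hn : Module.finrank ℂ R.obj using Nat.strong_induction_on generalizing R with
  | _ n ih =>
  by_cases hR : nilradical R.obj = ⊥
  · have : Subsingleton (nilradical R.obj) := by rw [hR]; infer_instance
    exact ⟨fun z _ => Subsingleton.elim _ _, fun y hy => ⟨0, by
      rw [map_zero, eq_zero_of_reduced hR hy]⟩⟩
  obtain ⟨x, hx0, hx, h⟩ := exists_socle_element hR
  obtain ⟨ih1, ih2⟩ := ih _ (hn ▸ quotAlg.finrank_lt hx0) (quotAlg R x) rfl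
  have hfib := isFibreProduct_quotAlg hx0 hx h
  constructor
  · intro z hz
    have h1 : LinearMap.rTensor (Lie F) (nilMap (quotAlg.mk x)) z = 0 :=
      ih1 _ (by rw [← pts_expHom, hz, map_zero])
    obtain ⟨w, rfl⟩ := (rTensor_exact (Lie F) (nilMap_mk_exact hx h) (nilMap_mk_surjective hx) z).1 h1
    obtain ⟨t, rfl⟩ := (TensorProduct.lid ℂ (Lie F)).symm.surjective w
    rw [TensorProduct.lid_symm_apply, LinearMap.rTensor_tmul, LinearMap.toSpanSingleton_apply,
      one_smul, expHom_tmul, nexp_sq _ hx, evLie_eq _ hx] at hz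
    have ht : t = 0 := Subtype.ext (IsLex.inj hfib _ hz (mem_Lie.1 t.2))
    rw [ht, map_zero, map_zero]
  · intro y hy
    obtain ⟨z, hz⟩ := ih2 (pts F (quotAlg.mk x) y) fun φ => by rw [← pts_comp, hy]
    obtain ⟨z, rfl⟩ := LinearMap.rTensor_surjective (Lie F) (nilMap_mk_surjective hx) z
    obtain ⟨t, ht, ht0⟩ := IsLex.surj hfib (y - expHom F R z) 0 (by
      rw [map_sub, pts_expHom, hz, sub_self, map_zero])
    refine ⟨z + ⟨x, mem_nilradical.2 ⟨2, hx⟩⟩ ⊗ₜ ⟨t, ht0⟩, ?_⟩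
    rw [map_add, expHom_tmul, nexp_sq _ hx, evLie_eq _ hx, ht, add_sub_cancel]

/-- The homomorphism from functions `X(R) → F(ℂ)` to `F(R)` induced by the section of
`R → ℂ ^ X(R)`. -/
def etHom (F : FinAlg ⥤ AddCommGrpCat.{0}) [IsLex F] (R : FinAlg) :
    ((R ⟶ point) → F.obj point) →+ F.obj R :=
  (pts F (redAlg.sec R)).comp (AddMonoidHom.mk' (fun m => (redAlg.exists_pts m).choose)
    fun m m' => redAlg.pts_ext fun φ => by
      rw [map_add, (redAlg.exists_pts _).choose_spec, (redAlg.exists_pts m).choose_spec,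
        (redAlg.exists_pts m').choose_spec, Pi.add_apply])

theorem etHom_eq {R : FinAlg} {m : (R ⟶ point) → F.obj point} {y : F.obj (redAlg R)}
    (h : ∀ φ, pts F (redAlg.ev φ) y = m φ) : etHom F R m = pts F (redAlg.sec R) y := by
  refine congrArg (pts F (redAlg.sec R)) (redAlg.pts_ext fun φ => ?_)
  rw [h]
  exact (redAlg.exists_pts m).choose_spec φ

/-- The sections of the reductions were chosen arbitrarily, but both composites from functions on
`X(R)` to `S` agree at every point of `S`, hence are equal. -/
theorem pts_etHom {R S : FinAlg} (ψ : R ⟶ S) (m : (R ⟶ point) → F.obj point) :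
    pts F ψ (etHom F R m) = etHom F S (fun φ => m (ψ ≫ φ)) := by
  obtain ⟨y, hy⟩ := redAlg.exists_pts m
  let ρ : redAlg R ⟶ redAlg S := redAlg.sec R ≫ ψ ≫ redAlg.proj S
  have hρ (φ : S ⟶ point) : ρ ≫ redAlg.ev φ = redAlg.ev (ψ ≫ φ) := by
    change redAlg.sec R ≫ ψ ≫ φ = _
    exact redAlg.sec_comp (ψ ≫ φ)
  have h : redAlg.sec R ≫ ψ = ρ ≫ redAlg.sec S := redAlg.hom_ext fun φ => by
    rw [Category.assoc, Category.assoc, redAlg.sec_comp, redAlg.sec_comp, hρ]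
  rw [etHom_eq hy, etHom_eq (y := pts F ρ y) fun φ => by rw [← pts_comp, hρ, hy], ← pts_comp,
    ← pts_comp, h]

theorem pts_etHom_point {R : FinAlg} (φ : R ⟶ point) (m : (R ⟶ point) → F.obj point) :
    pts F φ (etHom F R m) = m φ := by
  obtain ⟨y, hy⟩ := redAlg.exists_pts m
  rw [etHom_eq hy, ← pts_comp, redAlg.sec_comp, hy]

theorem app_etHom {G : FinAlg ⥤ AddCommGrpCat.{0}} [IsLex G] (α : F ⟶ G) {R : FinAlg}
    (m : (R ⟶ point) → F.obj point) :
    (α.app R).hom (etHom F R m) = etHom G R (fun φ => (α.app point).hom (m φ)) := by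
  obtain ⟨y, hy⟩ := redAlg.exists_pts m
  rw [etHom_eq hy, etHom_eq (y := (α.app _).hom y) fun φ => by rw [← pts_naturality, hy],
    pts_naturality]

/-- The decomposition of `F(R)` into its connected and étale parts. -/
def stdHom (F : FinAlg ⥤ AddCommGrpCat.{0}) [IsLex F] (R : FinAlg) :
    (nilradical R.obj ⊗[ℂ] Lie F) × ((R ⟶ point) → F.obj point) →+ F.obj R :=
  (expHom F R).coprod (etHom F R)

theorem stdHom_apply {R : FinAlg}
    (z : (nilradical R.obj ⊗[ℂ] Lie F) × ((R ⟶ point) → F.obj point)) :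
    stdHom F R z = expHom F R z.1 + etHom F R z.2 := rfl

theorem stdHom_bijective (F : FinAlg ⥤ AddCommGrpCat.{0}) [IsLex F] (R : FinAlg) :
    Function.Bijective (stdHom F R) := by
  obtain ⟨h1, h2⟩ := expHom_bijective_aux F R
  refine ⟨(injective_iff_map_eq_zero _).2 fun ⟨z, m⟩ hz => ?_, fun y => ?_⟩
  · rw [stdHom_apply] at hz
    have hm : m = 0 := funext fun φ => by
      have h := congrArg (pts F φ) hz
      rwa [map_add, pts_expHom_point, pts_etHom_point, zero_add, map_zero] at h
    subst hm
    rw [map_zero, add_zero] at hz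
    rw [h1 z hz]
    rfl
  · obtain ⟨z, hz⟩ := h2 (y - etHom F R fun φ => pts F φ y) fun φ => by
      rw [map_sub, pts_etHom_point, sub_self]
    exact ⟨(z, fun φ => pts F φ y), by rw [stdHom_apply, hz, sub_add_cancel]⟩

end ExponentialIso

/-! ### Standard functors, cokernels and finiteness of formal groups -/

section FormalGroups

open FinAlg

section Standard

/-- Otherwise the idempotent of `P` supported at `χ` would vanish at all points of `R` and `S`,
hence in both algebras and so in `P`, although it is `1` at `χ`. -/
theorem IsFibreProduct.exists_point {P R S T : FinAlg} {p : P ⟶ R} {q : P ⟶ S} {f : R ⟶ T}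
    {g : S ⟶ T} (h : IsFibreProduct p q f g) (χ : P ⟶ point) :
    (∃ φ, p ≫ φ = χ) ∨ ∃ ψ, q ≫ ψ = χ := by
  by_contra! hχ
  obtain ⟨e, he, hφ⟩ := exists_idempotent (R := P) {χ}
  have h0 : e = 0 := by
    refine h.inj _ _ ?_ ?_
    · refine IsIdempotentElem.eq_of_points (he.map (toAlgHom p)) (by rw [map_zero]; exact .zero)
        fun φ => ?_
      rw [map_zero, map_zero]
      exact (hφ (p ≫ φ)).2 (hχ.1 φ)
    · refine IsIdempotentElem.eq_of_points (he.map (toAlgHom q)) (by rw [map_zero]; exact .zero)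
        fun φ => ?_
      rw [map_zero, map_zero]
      exact (hφ (q ≫ φ)).2 (hχ.2 φ)
  have h1 := (hφ χ).1 rfl
  rw [h0, map_zero] at h1
  exact zero_ne_one h1

/-- Each level set is encoded by an idempotent of `R` and one of `S`. They agree in `T` because they
agree at its points, so they glue to an element of `P` marking the level set of the function sought.
-/
theorem IsFibreProduct.exists_function {P R S T : FinAlg} {p : P ⟶ R} {q : P ⟶ S} {f : R ⟶ T}
    {g : S ⟶ T} (h : IsFibreProduct p q f g) {M : Type} (m : (R ⟶ point) → M)
    (n : (S ⟶ point) → M) (hmn : ∀ χ : T ⟶ point, m (f ≫ χ) = n (g ≫ χ)) :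
    ∃ k : (P ⟶ point) → M, (∀ φ, k (p ≫ φ) = m φ) ∧ ∀ ψ, k (q ≫ ψ) = n ψ := by
  have key (μ : M) : ∃ e : P.obj, (∀ φ : R ⟶ point, toAlgHom (p ≫ φ) e = 1 ↔ m φ = μ) ∧
      ∀ ψ : S ⟶ point, toAlgHom (q ≫ ψ) e = 1 ↔ n ψ = μ := by
    obtain ⟨a, ha, ha'⟩ := exists_idempotent (R := R) {φ | m φ = μ}
    obtain ⟨b, hb, hb'⟩ := exists_idempotent (R := S) {ψ | n ψ = μ}
    obtain ⟨e, rfl, rfl⟩ := h.surj a b (IsIdempotentElem.eq_of_points (ha.map (toAlgHom f))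
      (hb.map (toAlgHom g)) fun χ => by
        by_cases hχ : m (f ≫ χ) = μ
        · exact ((ha' (f ≫ χ)).1 hχ).trans ((hb' (g ≫ χ)).1 ((hmn χ).symm.trans hχ)).symm
        · exact ((ha' (f ≫ χ)).2 hχ).trans
            ((hb' (g ≫ χ)).2 fun h' => hχ ((hmn χ).trans h')).symm)
    refine ⟨e, fun φ => ⟨fun h1 => ?_, (ha' φ).1⟩, fun ψ => ⟨fun h1 => ?_, (hb' ψ).1⟩⟩
    · by_contra hφ
      exact zero_ne_one (((ha' φ).2 hφ).symm.trans h1)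
    · by_contra hψ
      exact zero_ne_one (((hb' ψ).2 hψ).symm.trans h1)
  choose e he he' using key
  have hk (χ : P ⟶ point) : ∃ μ : M, toAlgHom χ (e μ) = 1 ∧ ∀ ν, toAlgHom χ (e ν) = 1 → μ = ν := by
    rcases h.exists_point χ with ⟨φ, rfl⟩ | ⟨ψ, rfl⟩
    · exact ⟨m φ, (he _ φ).2 rfl, fun ν => (he ν φ).1⟩
    · exact ⟨n ψ, (he' _ ψ).2 rfl, fun ν => (he' ν ψ).1⟩
  choose k _ hk' using hk
  exact ⟨k, fun φ => hk' _ _ ((he _ φ).2 rfl), fun ψ => hk' _ _ ((he' _ ψ).2 rfl)⟩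

theorem IsFibreProduct.rTensor_eq_zero {P R S T : FinAlg} {p : P ⟶ R} {q : P ⟶ S} {f : R ⟶ T}
    {g : S ⟶ T} (h : IsFibreProduct p q f g) (Q : Type) [AddCommGroup Q] [Module ℂ Q]
    {z : nilradical P.obj ⊗[ℂ] Q} (h1 : LinearMap.rTensor Q (nilMap p) z = 0)
    (h2 : LinearMap.rTensor Q (nilMap q) z = 0) : z = 0 := by
  let u := (nilMap p).prod (nilMap q)
  have hu : Function.Injective u := fun x y hxy =>
    Subtype.ext (h.inj _ _ (congrArg (fun w => (w.1 : R.obj)) hxy)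
      (congrArg (fun w => (w.2 : S.obj)) hxy))
  refine Module.Flat.rTensor_preserves_injective_linearMap (M := Q) u hu ?_
  apply (TensorProduct.prodLeft ℂ ℂ (nilradical R.obj) (nilradical S.obj) Q).injective
  rw [map_zero, map_zero]
  refine Prod.ext (Eq.trans ?_ h1) (Eq.trans ?_ h2)
  · clear h1 h2
    induction z using TensorProduct.induction_on with
    | zero => simp only [map_zero, Prod.fst_zero]
    | add z w hz hw => simp only [map_add, hz, hw, Prod.fst_add]
    | tmul x t => rfl
  · clear h1 h2
    induction z using TensorProduct.induction_on with
    | zero => simp only [map_zero, Prod.snd_zero]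
    | add z w hz hw => simp only [map_add, hz, hw, Prod.snd_add]
    | tmul x t => rfl

theorem IsFibreProduct.exists_rTensor {P R S T : FinAlg} {p : P ⟶ R} {q : P ⟶ S} {f : R ⟶ T}
    {g : S ⟶ T} (h : IsFibreProduct p q f g) (Q : Type) [AddCommGroup Q] [Module ℂ Q]
    {x : nilradical R.obj ⊗[ℂ] Q} {y : nilradical S.obj ⊗[ℂ] Q}
    (hxy : LinearMap.rTensor Q (nilMap f) x = LinearMap.rTensor Q (nilMap g) y) :
    ∃ z, LinearMap.rTensor Q (nilMap p) z = x ∧ LinearMap.rTensor Q (nilMap q) z = y := by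
  let u := (nilMap p).prod (nilMap q)
  let d := (nilMap f).coprod (-nilMap g)
  -- Nilradicals form a fibre product too: an element of `P` with nilpotent images in `R` and `S` is
  -- nilpotent. Tensoring with `Q` over the field `ℂ` keeps the sequence exact.
  have hud : Function.Exact u d := by
    rintro ⟨a, b⟩
    constructor
    · intro hab
      have hab' : nilMap f a = nilMap g b := by
        rw [← sub_eq_zero, sub_eq_add_neg]
        exact hab
      obtain ⟨c, hc, hc'⟩ := h.surj a b (congrArg Subtype.val hab')
      refine ⟨⟨c, ?_⟩, Prod.ext (Subtype.ext hc) (Subtype.ext hc')⟩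
      obtain ⟨n, hn⟩ := mem_nilradical.1 a.2
      obtain ⟨k, hk⟩ := mem_nilradical.1 b.2
      refine mem_nilradical.2 ⟨n + k, h.inj _ _ ?_ ?_⟩
      · rw [map_pow, hc, pow_add, hn, zero_mul, map_zero]
      · rw [map_pow, hc', pow_add, hk, mul_zero, map_zero]
    · rintro ⟨c, hc⟩
      rw [← hc]
      change nilMap f (nilMap p c) + -nilMap g (nilMap q c) = 0
      rw [← sub_eq_add_neg, sub_eq_zero]
      exact Subtype.ext (congrArg (fun k => toAlgHom k (c : P.obj)) h.comm)
  let w := LinearMap.rTensor Q (LinearMap.inl ℂ _ _) x + LinearMap.rTensor Q (LinearMap.inr ℂ _ _) y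
  have hw : LinearMap.rTensor Q d w = 0 := by
    rw [map_add, ← LinearMap.comp_apply, ← LinearMap.comp_apply, ← LinearMap.rTensor_comp,
      ← LinearMap.rTensor_comp, LinearMap.coprod_inl, LinearMap.coprod_inr, LinearMap.rTensor_neg,
      LinearMap.neg_apply, hxy, add_neg_cancel]
  obtain ⟨z, hz⟩ := (Module.Flat.rTensor_exact Q hud w).1 hw
  refine ⟨z, ?_, ?_⟩
  · have h1 := congrArg (LinearMap.rTensor Q (LinearMap.fst ℂ _ _)) hz
    rw [map_add, ← LinearMap.comp_apply, ← LinearMap.comp_apply, ← LinearMap.comp_apply,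
      ← LinearMap.rTensor_comp, ← LinearMap.rTensor_comp, ← LinearMap.rTensor_comp,
      LinearMap.fst_prod, LinearMap.fst_comp_inl, LinearMap.fst_comp_inr, LinearMap.rTensor_id,
      LinearMap.rTensor_zero, LinearMap.zero_apply, add_zero, LinearMap.id_apply] at h1
    exact h1
  · have h1 := congrArg (LinearMap.rTensor Q (LinearMap.snd ℂ _ _)) hz
    rw [map_add, ← LinearMap.comp_apply, ← LinearMap.comp_apply, ← LinearMap.comp_apply,
      ← LinearMap.rTensor_comp, ← LinearMap.rTensor_comp, ← LinearMap.rTensor_comp,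
      LinearMap.snd_prod, LinearMap.snd_comp_inl, LinearMap.snd_comp_inr, LinearMap.rTensor_id,
      LinearMap.rTensor_zero, LinearMap.zero_apply, zero_add, LinearMap.id_apply] at h1
    exact h1

/-- The group functor `R ↦ Nil(R) ⊗ Q × M ^ X(R)`. -/
def stdFunctor (Q M : Type) [AddCommGroup Q] [Module ℂ Q] [AddCommGroup M] :
    FinAlg ⥤ AddCommGrpCat.{0} where
  obj R := AddCommGrpCat.of ((nilradical R.obj ⊗[ℂ] Q) × ((R ⟶ point) → M))
  map {R S} φ := AddCommGrpCat.ofHom (AddMonoidHom.prodMap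
    (LinearMap.rTensor Q (nilMap φ)).toAddMonoidHom
    (AddMonoidHom.mk' (fun m χ => m (φ ≫ χ)) fun _ _ => rfl))
  map_id R := by
    refine AddCommGrpCat.hom_ext (AddMonoidHom.ext fun z => Prod.ext ?_ rfl)
    exact LinearMap.rTensor_id_apply Q _ z.1
  map_comp φ ψ := by
    refine AddCommGrpCat.hom_ext (AddMonoidHom.ext fun z => Prod.ext ?_ rfl)
    exact LinearMap.rTensor_comp_apply Q (nilMap ψ) (nilMap φ) z.1

theorem pts_stdFunctor {Q M : Type} [AddCommGroup Q] [Module ℂ Q] [AddCommGroup M] {R S : FinAlg}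
    (φ : R ⟶ S) (z : (nilradical R.obj ⊗[ℂ] Q) × ((R ⟶ point) → M)) :
    pts (stdFunctor Q M) φ z = (LinearMap.rTensor Q (nilMap φ) z.1, fun χ => z.2 (φ ≫ χ)) := rfl

instance (Q M : Type) [AddCommGroup Q] [Module ℂ Q] [AddCommGroup M] : IsLex (stdFunctor Q M) where
  zero R hR := by
    have : Subsingleton (nilradical R.obj) := inferInstance
    have : IsEmpty (R ⟶ point) := ⟨fun φ => zero_ne_one (α := ℂ) (by
      rw [← map_zero (toAlgHom φ), ← map_one (toAlgHom φ)]
      exact congrArg _ (Subsingleton.elim _ _))⟩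
    exact inferInstanceAs (Subsingleton ((nilradical R.obj ⊗[ℂ] Q) × ((R ⟶ point) → M)))
  inj h z h1 h2 := by
    refine Prod.ext ?_ (funext fun χ => ?_)
    · exact h.rTensor_eq_zero Q (congrArg Prod.fst h1) (congrArg Prod.fst h2)
    · rcases h.exists_point χ with ⟨φ, rfl⟩ | ⟨φ, rfl⟩
      · exact congrFun (congrArg Prod.snd h1) φ
      · exact congrFun (congrArg Prod.snd h2) φ
  surj h r s hrs := by
    obtain ⟨z, hz, hz'⟩ := h.exists_rTensor Q (congrArg Prod.fst hrs)
    obtain ⟨m, hm, hm'⟩ := h.exists_function r.2 s.2 (congrFun (congrArg Prod.snd hrs))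
    exact ⟨(z, m), Prod.ext hz (funext hm), Prod.ext hz' (funext hm')⟩

end Standard

section Cokernel

variable {F G C : FinAlg ⥤ AddCommGrpCat.{0}} [IsLex F] [IsLex G] (α : F ⟶ G) (π : G ⟶ C)

/-- The quotient of the decomposition of `G(R)` by the image of `F(R)`. -/
def quotientStd (R : FinAlg) : G.obj R →+
    (nilradical R.obj ⊗[ℂ] (Lie G ⧸ LinearMap.range (lieMap α))) ×
      ((R ⟶ point) → (G.obj point ⧸ (α.app point).hom.range)) :=
  (AddMonoidHom.prodMap (LinearMap.lTensor _ (LinearMap.range (lieMap α)).mkQ).toAddMonoidHom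
    ((QuotientAddGroup.mk' (α.app point).hom.range).compLeft (R ⟶ point))).comp
      (AddEquiv.ofBijective (stdHom G R) (stdHom_bijective G R)).symm.toAddMonoidHom

theorem quotientStd_stdHom {R : FinAlg}
    (z : (nilradical R.obj ⊗[ℂ] Lie G) × ((R ⟶ point) → G.obj point)) :
    quotientStd α R (stdHom G R z) =
      (LinearMap.lTensor _ (LinearMap.range (lieMap α)).mkQ z.1,
        fun χ => QuotientAddGroup.mk' (α.app point).hom.range (z.2 χ)) := by
  have h : (AddEquiv.ofBijective (stdHom G R) (stdHom_bijective G R)).symm (stdHom G R z) = z :=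
    (AddEquiv.ofBijective (stdHom G R) (stdHom_bijective G R)).symm_apply_apply z
  change AddMonoidHom.prodMap _ _
    ((AddEquiv.ofBijective (stdHom G R) (stdHom_bijective G R)).symm (stdHom G R z)) = _
  rw [h]
  rfl

theorem quotientStd_surjective (R : FinAlg) : Function.Surjective (quotientStd α R) := by
  rintro ⟨z, m⟩
  obtain ⟨z, rfl⟩ := LinearMap.lTensor_surjective (nilradical R.obj)
    (LinearMap.range (lieMap α)).mkQ_surjective z
  choose m' hm' using fun χ => QuotientAddGroup.mk'_surjective (α.app point).hom.range (m χ)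
  exact ⟨stdHom G R (z, m'), by rw [quotientStd_stdHom]; exact Prod.ext rfl (funext hm')⟩

theorem pts_quotientStd {R S : FinAlg} (φ : R ⟶ S) (y : G.obj R) :
    pts (stdFunctor _ _) φ (quotientStd α R y) = quotientStd α S (pts G φ y) := by
  obtain ⟨z, rfl⟩ := (stdHom_bijective G R).2 y
  have h : pts G φ (stdHom G R z) =
      stdHom G S (LinearMap.rTensor _ (nilMap φ) z.1, fun χ => z.2 (φ ≫ χ)) := by
    rw [stdHom_apply, stdHom_apply, map_add, pts_expHom, pts_etHom]
  rw [h, quotientStd_stdHom, quotientStd_stdHom, pts_stdFunctor]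
  refine Prod.ext ?_ rfl
  exact (LinearMap.congr_fun (LinearMap.rTensor_comp_lTensor _ _ _) z.1).trans
    (LinearMap.congr_fun (LinearMap.lTensor_comp_rTensor _ _ _) z.1).symm

/-- Naturality of the decomposition in the functor turns the image of `α` into the images of `lieMap
α` and of `α` on `ℂ`-points, which are the kernels of the two quotient maps by right exactness of
the tensor product. -/
theorem quotientStd_eq_zero {R : FinAlg} {y : G.obj R} :
    quotientStd α R y = 0 ↔ ∃ x, (α.app R).hom x = y := by
  obtain ⟨⟨z, m⟩, rfl⟩ := (stdHom_bijective G R).2 y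
  rw [quotientStd_stdHom]
  constructor
  · intro h
    have h1 : LinearMap.lTensor _ (LinearMap.range (lieMap α)).mkQ z = 0 := congrArg Prod.fst h
    have h2 (χ : R ⟶ point) : ∃ x, (α.app point).hom x = m χ :=
      (QuotientAddGroup.eq_zero_iff _).1 (congrFun (congrArg Prod.snd h) χ)
    choose m' hm' using h2
    have hex : Function.Exact (lieMap α) (LinearMap.range (lieMap α)).mkQ :=
      LinearMap.exact_map_mkQ_range _
    obtain ⟨z', rfl⟩ := (lTensor_exact (nilradical R.obj) hex (Submodule.mkQ_surjective _) z).1 h1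
    refine ⟨stdHom F R (z', m'), ?_⟩
    rw [stdHom_apply, stdHom_apply, map_add, app_expHom, app_etHom]
    exact congrArg (_ + etHom G R ·) (funext hm')
  · rintro ⟨x, hx⟩
    obtain ⟨⟨z', m'⟩, rfl⟩ := (stdHom_bijective F R).2 x
    rw [stdHom_apply, map_add, app_expHom, app_etHom] at hx
    have hz := (stdHom_bijective G R).1 (a₁ := (LinearMap.lTensor _ (lieMap α) z',
      fun φ => (α.app point).hom (m' φ))) hx
    rw [Prod.ext_iff] at hz
    obtain ⟨rfl, rfl⟩ := hz
    refine Prod.ext ?_ (funext fun χ => ?_)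
    · change LinearMap.lTensor _ (LinearMap.range (lieMap α)).mkQ (LinearMap.lTensor _ _ z') = 0
      rw [← LinearMap.comp_apply, ← LinearMap.lTensor_comp, LinearMap.range_mkQ_comp,
        LinearMap.lTensor_zero, LinearMap.zero_apply]
    · exact (QuotientAddGroup.eq_zero_iff _).2 ⟨m' χ, rfl⟩

variable {α π}

/-- A cokernel of left exact group functors is left exact. -/
theorem IsLex.of_exact (hex : ∀ R, Function.Exact (α.app R).hom (π.app R).hom)
    (hπ : ∀ R, Function.Surjective (π.app R).hom) : IsLex C := by
  -- Both `C(R)` and the standard functor are quotients of `G(R)` by the same subgroup, naturally in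
  -- `R`, so left exactness is transported from the latter.
  have hker {R : FinAlg} (y : G.obj R) : (π.app R).hom y = 0 ↔ quotientStd α R y = 0 :=
    (hex R y).trans (quotientStd_eq_zero α).symm
  refine ⟨fun R hR => ?_, fun {P R S T p q f g} h c h1 h2 => ?_,
    fun {P R S T p q f g} h r s hrs => ?_⟩
  · have := IsLex.zero (F := G) R hR
    exact (hπ R).subsingleton
  · obtain ⟨y, rfl⟩ := hπ P c
    rw [← pts_naturality, hker, ← pts_quotientStd] at h1 h2
    exact (hker y).2 (IsLex.inj h _ h1 h2)
  · obtain ⟨r, rfl⟩ := hπ R r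
    obtain ⟨s, rfl⟩ := hπ S s
    rw [← pts_naturality, ← pts_naturality, ← sub_eq_zero, ← map_sub, hker, map_sub, sub_eq_zero,
      ← pts_quotientStd, ← pts_quotientStd] at hrs
    obtain ⟨x, hx, hx'⟩ := IsLex.surj h _ _ hrs
    obtain ⟨y, rfl⟩ := quotientStd_surjective α P x
    refine ⟨(π.app P).hom y, ?_, ?_⟩
    · rw [← pts_naturality, ← sub_eq_zero, ← map_sub, hker, map_sub, sub_eq_zero,
        ← pts_quotientStd, hx]
    · rw [← pts_naturality, ← sub_eq_zero, ← map_sub, hker, map_sub, sub_eq_zero,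
        ← pts_quotientStd, hx']

end Cokernel

/-- A preimage in `G(ℂ[ε])` is moved into the Lie algebra by subtracting its constant part, pulled
back along `ℂ → ℂ[ε]`; that part maps to zero in `C`. -/
theorem lieMap_surjective {G C : FinAlg ⥤ AddCommGrpCat.{0}} [IsLex G] [IsLex C] {π : G ⟶ C}
    (hπ : ∀ R, Function.Surjective (π.app R).hom) : Function.Surjective (lieMap π) := by
  rintro ⟨t, ht⟩
  obtain ⟨y, rfl⟩ := hπ dual t
  rw [mem_Lie, ← pts_naturality] at ht
  have hid : fromPoint dual ≫ dualToPoint = 𝟙 point := point_hom_ext _ _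
  refine ⟨⟨y - pts G (fromPoint dual) (pts G dualToPoint y), ?_⟩, Subtype.ext ?_⟩
  · rw [mem_Lie, map_sub, ← pts_comp, hid, pts_id, sub_self]
  · change (π.app dual).hom _ = _
    rw [map_sub, pts_naturality π (fromPoint dual), ht, map_zero, sub_zero]

theorem isFormalGroup_iff (F : FinAlg ⥤ AddCommGrpCat.{0}) [IsLex F] :
    IsFormalGroup F ↔ Module.Finite ℤ (F.obj point) ∧ Module.Finite ℂ (Lie F) := by
  refine ⟨fun h => ⟨h.etale_fg, ?_⟩, fun h => ⟨IsLex.preservesFiniteLimits F, h.1, ?_⟩⟩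
  · obtain ⟨n, t, ht, hspan⟩ := h.lie_fin
    refine Module.Finite.of_surjective (Fintype.linearCombination ℂ (M := Lie F)
      fun i : Fin n => ⟨t i, ht i⟩) fun x => ?_
    obtain ⟨c, hc⟩ := hspan x x.2
    refine ⟨c, Subtype.ext ?_⟩
    rw [hc, Fintype.linearCombination_apply]
    exact AddSubgroup.val_finsetSum _ _ _
  · have := h.2
    obtain ⟨n, t, ht⟩ := Module.Finite.exists_fin (R := ℂ) (M := Lie F)
    refine ⟨n, fun i => t i, fun i => (t i).2, fun x hx => ?_⟩
    obtain ⟨c, hc⟩ := (Submodule.mem_span_range_iff_exists_fun ℂ).1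
      (ht.symm ▸ Submodule.mem_top : (⟨x, hx⟩ : Lie F) ∈ Submodule.span ℂ (Set.range t))
    refine ⟨c, ?_⟩
    have h := congrArg Subtype.val hc.symm
    exact h.trans (AddSubgroup.val_finsetSum _ _ _)

theorem IsFormalGroup.isLex {F : FinAlg ⥤ AddCommGrpCat.{0}} (h : IsFormalGroup F) : IsLex F :=
  have := h.leftExact
  inferInstance

theorem IsFormalGroup.of_cokernel {F G C : FinAlg ⥤ AddCommGrpCat.{0}} (hF : IsFormalGroup F)
    (hG : IsFormalGroup G) {α : F ⟶ G} {π : G ⟶ C}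
    (hex : ∀ R, Function.Exact (α.app R).hom (π.app R).hom)
    (hπ : ∀ R, Function.Surjective (π.app R).hom) : IsFormalGroup C := by
  have := hF.isLex
  have := hG.isLex
  have := IsLex.of_exact hex hπ
  have h := (isFormalGroup_iff G).1 hG
  have := h.1
  have := h.2
  exact (isFormalGroup_iff C).2 ⟨Module.Finite.of_surjective
    (π.app point).hom.toIntLinearMap (hπ point),
    Module.Finite.of_surjective (lieMap π) (lieMap_surjective hπ)⟩

theorem IsFormalGroup.of_kernel {K F G : FinAlg ⥤ AddCommGrpCat.{0}} (hF : IsFormalGroup F)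
    (hG : IsFormalGroup G) {i : K ⟶ F} {α : F ⟶ G}
    (hex : ∀ R, Function.Exact (i.app R).hom (α.app R).hom)
    (hi : ∀ R, Function.Injective (i.app R).hom) : IsFormalGroup K := by
  have := hF.isLex
  have := hG.isLex
  have : IsLex K := by
    refine ⟨fun R hR => ?_, fun {P R S T p q f g} h c h1 h2 => ?_,
      fun {P R S T p q f g} h r s hrs => ?_⟩
    · have := IsLex.zero (F := F) R hR
      exact (hi R).subsingleton
    · refine hi P ?_
      rw [map_zero]
      refine IsLex.inj h _ ?_ ?_
      · rw [← pts_naturality, h1, map_zero]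
      · rw [← pts_naturality, h2, map_zero]
    · obtain ⟨x, hx, hx'⟩ := IsLex.surj h ((i.app R).hom r) ((i.app S).hom s) (by
        rw [← pts_naturality, ← pts_naturality, hrs])
      have h0 : (α.app P).hom x = 0 := by
        refine IsLex.inj h _ ?_ ?_
        · rw [← pts_naturality, hx]
          exact (hex R _).2 ⟨r, rfl⟩
        · rw [← pts_naturality, hx']
          exact (hex S _).2 ⟨s, rfl⟩
      obtain ⟨y, rfl⟩ := (hex P x).1 h0
      exact ⟨y, hi R (by rw [pts_naturality, hx]), hi S (by rw [pts_naturality, hx'])⟩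
  have h := (isFormalGroup_iff F).1 hF
  have := h.1
  have := h.2
  exact (isFormalGroup_iff K).2 ⟨Module.Finite.of_injective (i.app point).hom.toIntLinearMap
    (hi point), Module.Finite.of_injective (lieMap i) fun x y hxy =>
      Subtype.ext (hi dual (congrArg Subtype.val hxy))⟩

theorem IsFormalGroup.of_product {J : Type} [Finite J] {P : FinAlg ⥤ AddCommGrpCat.{0}}
    {F : J → FinAlg ⥤ AddCommGrpCat.{0}} (hF : ∀ j, IsFormalGroup (F j)) (π : ∀ j, P ⟶ F j)
    (inj : ∀ R (x : P.obj R), (∀ j, ((π j).app R).hom x = 0) → x = 0)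
    (surj : ∀ R (y : ∀ j, (F j).obj R), ∃ x, ∀ j, ((π j).app R).hom x = y j) :
    IsFormalGroup P := by
  have (j : J) := (hF j).isLex
  have inj' {R : FinAlg} {x y : P.obj R}
      (h : ∀ j, ((π j).app R).hom x = ((π j).app R).hom y) : x = y :=
    sub_eq_zero.1 (inj R _ fun j => by rw [map_sub, h, sub_self])
  have : IsLex P := by
    refine ⟨fun R hR => ⟨fun x y => inj' fun j => ?_⟩, fun {P R S T p q f g} h c h1 h2 => ?_,
      fun {P R S T p q f g} h r s hrs => ?_⟩
    · have := IsLex.zero (F := F j) R hR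
      exact Subsingleton.elim _ _
    · refine inj _ _ fun j => IsLex.inj h _ ?_ ?_
      · rw [← pts_naturality, h1, map_zero]
      · rw [← pts_naturality, h2, map_zero]
    · have hj (j : J) := IsLex.surj h (((π j).app R).hom r) (((π j).app S).hom s) (by
        rw [← pts_naturality, ← pts_naturality, hrs])
      choose y hy hy' using hj
      obtain ⟨x, hx⟩ := surj _ y
      exact ⟨x, inj' fun j => by rw [pts_naturality, hx, hy],
        inj' fun j => by rw [pts_naturality, hx, hy']⟩
  have h (j : J) := (isFormalGroup_iff (F j)).1 (hF j)
  have (j : J) := (h j).1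
  have (j : J) := (h j).2
  exact (isFormalGroup_iff P).2
    ⟨Module.Finite.of_injective (LinearMap.pi fun j => ((π j).app point).hom.toIntLinearMap)
      fun x y hxy => inj' fun j => congrFun hxy j,
    Module.Finite.of_injective (LinearMap.pi fun j => lieMap (π j))
      fun x y hxy => Subtype.ext (inj' fun j => congrArg Subtype.val (congrFun hxy j))⟩

end FormalGroups

/-! ### Formal groups as an abelian full subcategory of group functors -/

section FormalGroupCategory

open FinAlg

theorem exact_iff_pointwise (S : ShortComplex (FinAlg ⥤ AddCommGrpCat.{0})) :
    S.Exact ↔ ∀ R, Function.Exact (S.f.app R).hom (S.g.app R).hom := by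
  have h (R : FinAlg) : (S.map ((evaluation FinAlg AddCommGrpCat.{0}).obj R)).Exact ↔
      Function.Exact (S.f.app R).hom (S.g.app R).hom :=
    ShortComplex.ab_exact_iff_function_exact _
  refine ⟨fun hS R => (h R).1 (hS.map _), fun hS => ?_⟩
  rw [ShortComplex.exact_iff_isZero_homology]
  refine Functor.isZero _ fun R => ?_
  exact (((ShortComplex.exact_iff_isZero_homology _).1 ((h R).2 (hS R)))).of_iso
    (S.mapHomologyIso ((evaluation FinAlg AddCommGrpCat.{0}).obj R)).symm

theorem mono_iff_pointwise {F G : FinAlg ⥤ AddCommGrpCat.{0}} (f : F ⟶ G) :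
    Mono f ↔ ∀ R, Function.Injective (f.app R).hom := by
  rw [NatTrans.mono_iff_mono_app]
  exact forall_congr' fun R => AddCommGrpCat.mono_iff_injective _

theorem epi_iff_pointwise {F G : FinAlg ⥤ AddCommGrpCat.{0}} (f : F ⟶ G) :
    Epi f ↔ ∀ R, Function.Surjective (f.app R).hom := by
  rw [NatTrans.epi_iff_epi_app]
  exact forall_congr' fun R => AddCommGrpCat.epi_iff_surjective _

instance : ObjectProperty.ContainsZero IsFormalGroup where
  exists_zero := by
    open scoped ZeroObject in
    have hs (R : FinAlg) : Subsingleton ((0 : FinAlg ⥤ AddCommGrpCat.{0}).obj R) :=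
      AddCommGrpCat.subsingleton_of_isZero ((isZero_zero (FinAlg ⥤ AddCommGrpCat.{0})).obj R)
    open scoped ZeroObject in
    exact ⟨0, isZero_zero _, IsFormalGroup.of_product (J := PEmpty) (F := PEmpty.elim)
      (fun j => j.elim) (fun j => j.elim) (fun R x _ => Subsingleton.elim _ _)
      fun R y => ⟨0, fun j => j.elim⟩⟩

instance : ObjectProperty.IsClosedUnderKernels IsFormalGroup where
  kernels_le := by
    rintro _ ⟨f, k, hk, hX, hY⟩
    have := Fork.IsLimit.mono hk
    exact IsFormalGroup.of_kernel hX hY ((exact_iff_pointwise (.mk k.ι f k.condition)).1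
        (ShortComplex.exact_of_f_is_kernel _ (IsLimit.ofIsoLimit hk (Fork.ext (Iso.refl _)))))
      ((mono_iff_pointwise k.ι).1 this)

instance : ObjectProperty.IsClosedUnderCokernels IsFormalGroup where
  cokernels_le := by
    rintro _ ⟨f, k, hk, hX, hY⟩
    have := Cofork.IsColimit.epi hk
    exact IsFormalGroup.of_cokernel hX hY ((exact_iff_pointwise (.mk f k.π k.condition)).1
        (ShortComplex.exact_of_g_is_cokernel _ (IsColimit.ofIsoColimit hk (Cofork.ext (Iso.refl _)))))
      ((epi_iff_pointwise k.π).1 this)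

theorem fan_pointwise {J : Type} [Finite J] {F : Discrete J ⥤ FinAlg ⥤ AddCommGrpCat.{0}}
    {c : Cone F} (hc : IsLimit c) (R : FinAlg) :
    (∀ x : c.pt.obj R, (∀ j, ((c.π.app j).app R).hom x = 0) → x = 0) ∧
      ∀ y : ∀ j : J, (F.obj ⟨j⟩).obj R, ∃ x : c.pt.obj R, ∀ j, ((c.π.app ⟨j⟩).app R).hom x = y j := by
  let E := (evaluation FinAlg AddCommGrpCat.{0}).obj R
  have hl : IsLimit (E.mapCone c) := isLimitOfPreserves E hc
  refine ⟨fun x hx => ?_, fun y => ?_⟩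
  · exact Concrete.isLimit_ext _ hl x 0 fun j => (hx j).trans (map_zero _).symm
  · let Y : AddCommGrpCat.{0} := AddCommGrpCat.of (∀ j : J, (F.obj ⟨j⟩).obj R)
    let s : Cone (F ⋙ E) :=
      { pt := Y
        π := Discrete.natTrans fun j => AddCommGrpCat.ofHom (Pi.evalAddMonoidHom _ j.as) }
    exact ⟨(hl.lift s).hom y, fun j => congrArg (fun k => k.hom y) (hl.fac s ⟨j⟩)⟩

instance : ObjectProperty.IsClosedUnderFiniteProducts IsFormalGroup where
  isClosedUnderLimitsOfShape J _ := ⟨by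
    rintro P ⟨p⟩
    refine IsFormalGroup.of_product (F := fun j => p.diag.obj ⟨j⟩) (fun j => p.prop_diag_obj ⟨j⟩)
      (fun j => p.π.app ⟨j⟩) (fun R x hx => (fan_pointwise p.isLimit R).1 x fun j => hx j.as)
      fun R y => (fan_pointwise p.isLimit R).2 y⟩

instance : Abelian FormalGroup := inferInstance

instance : (ObjectProperty.ι IsFormalGroup).PreservesHomology :=
  ⟨fun _ _ f => ObjectProperty.preservesKernels_ι _ f,
    fun _ _ f => ObjectProperty.preservesCokernels_ι _ f⟩

namespace FormalGroup

theorem exact_iff (S : ShortComplex FormalGroup) : S.Exact ↔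
    ∀ R, Function.Exact (S.f.hom.app R).hom (S.g.hom.app R).hom :=
  (S.exact_map_iff_of_faithful (ObjectProperty.ι IsFormalGroup)).symm.trans
    (exact_iff_pointwise (S.map (ObjectProperty.ι IsFormalGroup)))

theorem mono_iff {H H' : FormalGroup} (f : H ⟶ H') :
    Mono f ↔ ∀ R, Function.Injective (f.hom.app R).hom :=
  ((ObjectProperty.ι IsFormalGroup).mono_map_iff_mono f).symm.trans (mono_iff_pointwise _)

theorem epi_iff {H H' : FormalGroup} (f : H ⟶ H') :
    Epi f ↔ ∀ R, Function.Surjective (f.hom.app R).hom :=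
  ((ObjectProperty.ι IsFormalGroup).epi_map_iff_epi f).symm.trans (epi_iff_pointwise _)

end FormalGroup

end FormalGroupCategory

/-! ### Formal Hodge structures without `σ` -/

section Core

open FinAlg

section VectorGroup

variable {V V' V'' : Type} [AddCommGroup V] [Module ℂ V] [AddCommGroup V'] [Module ℂ V']
  [AddCommGroup V''] [Module ℂ V'']

theorem vectorGroupMap_add (g g' : V →ₗ[ℂ] V') :
    vectorGroupMap (g + g') = vectorGroupMap g + vectorGroupMap g' := by
  ext R x
  exact LinearMap.congr_fun (LinearMap.lTensor_add R.obj g g') x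

theorem vectorGroupMap_neg (g : V →ₗ[ℂ] V') : vectorGroupMap (-g) = -vectorGroupMap g := by
  ext R x
  exact LinearMap.congr_fun (LinearMap.lTensor_neg (M := R.obj) g) x

theorem vectorGroupMap_sum {J : Type} (s : Finset J) (g : J → V →ₗ[ℂ] V') :
    vectorGroupMap (∑ j ∈ s, g j) = ∑ j ∈ s, vectorGroupMap (g j) := by
  classical
  induction s using Finset.induction_on with
  | empty => exact vectorGroupMap_zero V V'
  | insert j s hj ih => rw [Finset.sum_insert hj, Finset.sum_insert hj, vectorGroupMap_add, ih]

theorem mono_vectorGroupMap {g : V →ₗ[ℂ] V'} (hg : Function.Injective g) :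
    Mono (vectorGroupMap g) :=
  (mono_iff_pointwise _).2 fun _ => Module.Flat.lTensor_preserves_injective_linearMap g hg

theorem exact_vectorGroupMap {g : V →ₗ[ℂ] V'} {g' : V' →ₗ[ℂ] V''} (h : Function.Exact g g') :
    ∃ w, (ShortComplex.mk (vectorGroupMap g) (vectorGroupMap g') w).Exact := by
  refine ⟨?_, (exact_iff_pointwise _).2 fun R => Module.Flat.lTensor_exact R.obj h⟩
  rw [← vectorGroupMap_comp, h.linearMap_comp_eq_zero, vectorGroupMap_zero]

end VectorGroup

section Value

variable {H : FormalGroup} {V : Type} [AddCommGroup V] [Module ℂ V]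

/-- The complex linear extension `H_ℂ → V` of `v_ℤ`. -/
def valueC (v : H.obj ⟶ vectorGroup V) : (ℂ ⊗[ℤ] H.etalePart) →ₗ[ℂ] V :=
  LinearMap.liftBaseChange ℂ (etaleValue v).toIntLinearMap

theorem valueC_tmul (v : H.obj ⟶ vectorGroup V) (c : ℂ) (h : H.etalePart) :
    valueC v (c ⊗ₜ h) = c • etaleValue v h := rfl

theorem linearMap_ext_tmul {A : Type} [AddCommGroup A] {f g : (ℂ ⊗[ℤ] A) →ₗ[ℂ] V}
    (h : ∀ a : A, f (1 ⊗ₜ a) = g (1 ⊗ₜ a)) : f = g := by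
  refine LinearMap.ext fun x => ?_
  induction x using TensorProduct.induction_on with
  | zero => rw [map_zero, map_zero]
  | tmul c a => rw [tmul_eq_smul, map_smul, map_smul, h]
  | add x y hx hy => rw [map_add, map_add, hx, hy]

theorem etaleValue_comp {H' : FormalGroup} {V' : Type} [AddCommGroup V'] [Module ℂ V']
    {v : H.obj ⟶ vectorGroup V} {v' : H'.obj ⟶ vectorGroup V'} {f : H ⟶ H'} {g : V →ₗ[ℂ] V'}
    (comm : f.hom ≫ v' = v ≫ vectorGroupMap g) (h : H.etalePart) :
    etaleValue v' (FormalGroup.etaleMap f h) = g (etaleValue v h) := by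
  have h1 : (v'.app point).hom ((f.hom.app point).hom h) =
      LinearMap.lTensor ℂ g ((v.app point).hom h) :=
    congrArg (fun k => (k.app point).hom h) comm
  change TensorProduct.lid ℂ V' ((v'.app point).hom ((f.hom.app point).hom h)) =
    g (TensorProduct.lid ℂ V ((v.app point).hom h))
  rw [h1]
  generalize (v.app point).hom h = z
  refine LinearMap.congr_fun (f := (TensorProduct.lid ℂ V').toLinearMap ∘ₗ LinearMap.lTensor ℂ g)
    (g := g ∘ₗ (TensorProduct.lid ℂ V).toLinearMap) ?_ z
  ext x
  simp

theorem valueC_comp {H' : FormalGroup} {V' : Type} [AddCommGroup V'] [Module ℂ V']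
    {v : H.obj ⟶ vectorGroup V} {v' : H'.obj ⟶ vectorGroup V'} {f : H ⟶ H'} {g : V →ₗ[ℂ] V'}
    (comm : f.hom ≫ v' = v ≫ vectorGroupMap g) (z : ℂ ⊗[ℤ] H.etalePart) :
    valueC v' (mapC (FormalGroup.etaleMap f) z) = g (valueC v z) := by
  refine LinearMap.congr_fun (f := valueC v' ∘ₗ mapC (FormalGroup.etaleMap f))
    (g := g ∘ₗ valueC v) (linearMap_ext_tmul fun h => ?_) z
  change valueC v' (mapC _ (1 ⊗ₜ h)) = g (valueC v (1 ⊗ₜ h))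
  rw [mapC_tmul, valueC_tmul, valueC_tmul, one_smul, one_smul, etaleValue_comp comm]

end Value

namespace FHS₁

/-- The complex linear extension `H_ℂ → V` of `v_ℤ`. -/
def vC (X : FHS₁) : (ℂ ⊗[ℤ] X.H.etalePart) →ₗ[ℂ] X.V := valueC X.v

/-- Both sides are complex linear and agree on the lattice by `σ_comm`. Hence `σ` carries no
information beyond `v`. -/
theorem σ_mk (X : FHS₁) (z : ℂ ⊗[ℤ] X.H.etalePart) :
    X.σ (X.mhs.F₀.mkQ z) = X.V₀.mkQ (X.vC z) := by
  refine LinearMap.congr_fun (f := X.σ.toLinearMap ∘ₗ X.mhs.F₀.mkQ) (g := X.V₀.mkQ ∘ₗ X.vC)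
    (linearMap_ext_tmul fun h => ?_) z
  refine (X.σ_comm h).trans (congrArg X.V₀.mkQ ?_)
  rw [vC, valueC_tmul, one_smul]

theorem vC_mem_V₀ (X : FHS₁) {z : ℂ ⊗[ℤ] X.H.etalePart} : X.vC z ∈ X.V₀ ↔ z ∈ X.mhs.F₀ := by
  rw [← Submodule.Quotient.mk_eq_zero, ← Submodule.mkQ_apply, ← σ_mk, LinearEquiv.map_eq_zero_iff,
    Submodule.mkQ_apply, Submodule.Quotient.mk_eq_zero]

theorem exists_vC_add (X : FHS₁) (x : X.V) : ∃ z, ∃ w ∈ X.V₀, X.vC z + w = x := by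
  obtain ⟨z, hz⟩ := X.mhs.F₀.mkQ_surjective (X.σ.symm (X.V₀.mkQ x))
  refine ⟨z, x - X.vC z, ?_, add_sub_cancel _ _⟩
  rw [← Submodule.Quotient.mk_eq_zero, ← Submodule.mkQ_apply, map_sub, ← σ_mk, hz,
    LinearEquiv.apply_symm_apply, sub_self]

theorem mem_V₁ (X : FHS₁) {x : X.V} :
    x ∈ X.V₁ ↔ ∃ z ∈ complexify X.mhs.W₂, ∃ w ∈ X.V₀, X.vC z + w = x := by
  have key : X.V₀.mkQ x ∈ X.V₁.map X.V₀.mkQ ↔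
      ∃ z ∈ complexify X.mhs.W₂, ∃ w ∈ X.V₀, X.vC z + w = x := by
    rw [← X.σ_W₂]
    constructor
    · rintro ⟨_, ⟨z, hz, rfl⟩, h⟩
      refine ⟨z, hz, x - X.vC z, ?_, add_sub_cancel _ _⟩
      rw [← Submodule.Quotient.mk_eq_zero, ← Submodule.mkQ_apply, map_sub, ← σ_mk, ← h]
      exact sub_self _
    · rintro ⟨z, hz, w, hw, rfl⟩
      refine ⟨_, ⟨z, hz, rfl⟩, ?_⟩
      refine (X.σ_mk z).trans ?_
      rw [map_add, Submodule.mkQ_apply _ w, (Submodule.Quotient.mk_eq_zero _).2 hw, add_zero]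
  rw [← key, ← Submodule.mem_comap, Submodule.comap_map_mkQ, sup_eq_right.2 X.V₀_le_V₁]

theorem vC_mem_V₁ (X : FHS₁) {z : ℂ ⊗[ℤ] X.H.etalePart} (hz : z ∈ complexify X.mhs.W₂) :
    X.vC z ∈ X.V₁ :=
  X.mem_V₁.2 ⟨z, hz, 0, X.V₀.zero_mem, add_zero _⟩

/-- A formal Hodge structure is determined by `H`, `V`, `V⁰` and `v`. -/
def ofCore (H : FormalGroup) (mhs : LevelOneMHS H.etalePart) (V : Type) [AddCommGroup V]
    [Module ℂ V] [FiniteDimensional ℂ V] (V₀ V₁ : Submodule ℂ V) (v : H.obj ⟶ vectorGroup V)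
    (h₀ : ∀ z, valueC v z ∈ V₀ ↔ z ∈ mhs.F₀) (hV : ∀ x, ∃ z, ∃ w ∈ V₀, valueC v z + w = x)
    (h₁ : ∀ x, x ∈ V₁ ↔ ∃ z ∈ complexify mhs.W₂, ∃ w ∈ V₀, valueC v z + w = x) : FHS₁ where
  H := H
  mhs := mhs
  V := V
  V₀ := V₀
  V₁ := V₁
  V₀_le_V₁ w hw := (h₁ w).2 ⟨0, Submodule.zero_mem _, w, hw, by rw [map_zero, zero_add]⟩
  v := v
  σ := LinearEquiv.ofBijective (mhs.F₀.mapQ V₀ (valueC v) fun z hz => (h₀ z).2 hz) ⟨by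
    refine (injective_iff_map_eq_zero _).2 fun z hz => ?_
    obtain ⟨z, rfl⟩ := mhs.F₀.mkQ_surjective z
    exact (Submodule.Quotient.mk_eq_zero _).2 ((h₀ z).1 ((Submodule.Quotient.mk_eq_zero _).1 hz)),
    fun x => by
    obtain ⟨x, rfl⟩ := V₀.mkQ_surjective x
    obtain ⟨z, w, hw, rfl⟩ := hV x
    refine ⟨mhs.F₀.mkQ z, ?_⟩
    rw [map_add, Submodule.mkQ_apply _ w, (Submodule.Quotient.mk_eq_zero _).2 hw, add_zero]
    rfl⟩
  σ_W₂ := by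
    ext x
    constructor
    · rintro ⟨_, ⟨z, hz, rfl⟩, rfl⟩
      exact ⟨valueC v z, (h₁ _).2 ⟨z, hz, 0, V₀.zero_mem, add_zero _⟩, rfl⟩
    · rintro ⟨x, hx, rfl⟩
      obtain ⟨z, hz, w, hw, rfl⟩ := (h₁ x).1 hx
      refine ⟨_, ⟨z, hz, rfl⟩, ?_⟩
      rw [map_add, Submodule.mkQ_apply _ w, (Submodule.Quotient.mk_eq_zero _).2 hw, add_zero]
      rfl
  σ_comm h := by
    change V₀.mkQ (valueC v (1 ⊗ₜ h)) = _
    rw [valueC_tmul, one_smul]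

variable {X Y Z : FHS₁}

theorem vC_mapC (φ : X ⟶ Y) (z : ℂ ⊗[ℤ] X.H.etalePart) :
    Y.vC (mapC (FormalGroup.etaleMap φ.f) z) = φ.g (X.vC z) :=
  valueC_comp φ.comm z

/-- Morphisms of formal Hodge structures automatically respect `V¹` and `σ`. -/
def homMk (f : X.H ⟶ Y.H) (g : X.V →ₗ[ℂ] Y.V)
    (isHom : X.mhs.IsHom Y.mhs (FormalGroup.etaleMap f)) (map_V₀ : X.V₀ ≤ Y.V₀.comap g)
    (comm : f.hom ≫ Y.v = X.v ≫ vectorGroupMap g) : X ⟶ Y where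
  f := f
  g := g
  isHom := isHom
  map_V₀ := map_V₀
  map_V₁ x hx := by
    obtain ⟨z, hz, w, hw, rfl⟩ := X.mem_V₁.1 hx
    refine Y.mem_V₁.2 ⟨mapC (FormalGroup.etaleMap f) z, isHom.complexify_W₂ hz, g w, map_V₀ hw, ?_⟩
    rw [map_add]
    exact congrArg (· + g w) (valueC_comp comm z)
  comm := comm
  comm_σ z := by
    obtain ⟨z, rfl⟩ := X.mhs.F₀.mkQ_surjective z
    rw [σ_mk]
    refine (Y.σ_mk _).trans ?_
    exact congrArg Y.V₀.mkQ (valueC_comp comm z)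

theorem hom_ext {φ ψ : X ⟶ Y} (hf : φ.f = ψ.f) (hg : φ.g = ψ.g) : φ = ψ := Hom.ext hf hg

/-- Morphisms are strictly compatible with `V⁰`. -/
theorem exists_mem_V₀ (φ : X ⟶ Y) {x : X.V} (hx : φ.g x ∈ Y.V₀) : ∃ y ∈ X.V₀, φ.g y = φ.g x := by
  obtain ⟨z, w, hw, rfl⟩ := X.exists_vC_add x
  have h : mapC (FormalGroup.etaleMap φ.f) z ∈ Y.mhs.F₀ := by
    rw [← vC_mem_V₀, vC_mapC, ← add_sub_cancel_right (φ.g (X.vC z)) (φ.g w), ← map_add]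
    exact Y.V₀.sub_mem hx (φ.map_V₀ hw)
  obtain ⟨y, hy, e⟩ := φ.isHom.exists_mem_F₀ h
  refine ⟨X.vC y + w, X.V₀.add_mem (X.vC_mem_V₀.2 hy) hw, ?_⟩
  rw [map_add, map_add, ← vC_mapC, e, vC_mapC]

/-- Morphisms are strictly compatible with `V¹`. -/
theorem exists_mem_V₁ (φ : X ⟶ Y) {x : X.V} (hx : φ.g x ∈ Y.V₁) : ∃ y ∈ X.V₁, φ.g y = φ.g x := by
  obtain ⟨z, w, hw, rfl⟩ := X.exists_vC_add x
  obtain ⟨z', hz', w', hw', e'⟩ := Y.mem_V₁.1 hx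
  -- The image of `z` and the vector `z'` of `W₋₂` have the same value modulo `V⁰`, so they differ
  -- by an element of `F⁰`. Strictness for the sum `F⁰ + W₋₂` is therefore what is needed, not for
  -- `W₋₂` alone.
  have h : mapC (FormalGroup.etaleMap φ.f) z ∈ Y.mhs.F₀ ⊔ complexify Y.mhs.W₂ := by
    refine Submodule.mem_sup.2 ⟨mapC (FormalGroup.etaleMap φ.f) z - z', ?_, z', hz',
      sub_add_cancel _ _⟩
    have e : Y.vC (mapC (FormalGroup.etaleMap φ.f) z - z') = w' - φ.g w := by
      rw [map_sub, vC_mapC, sub_eq_sub_iff_add_eq_add, ← map_add, ← e', add_comm]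
    rw [← vC_mem_V₀, e]
    exact Y.V₀.sub_mem hw' (φ.map_V₀ hw)
  obtain ⟨y, hy, u, hu, e⟩ := φ.isHom.exists_mem_F₀_sup h
  refine ⟨X.vC (y + u) + w, ?_, ?_⟩
  · rw [map_add]
    exact X.V₁.add_mem (X.V₁.add_mem (X.V₀_le_V₁ (X.vC_mem_V₀.2 hy)) (X.vC_mem_V₁ hu))
      (X.V₀_le_V₁ hw)
  · rw [map_add φ.g, map_add φ.g, ← vC_mapC, e, vC_mapC]

end FHS₁

end Core

/-! ### Sums, lifts, descents and kernels of morphisms of mixed Hodge structures -/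

section HomOperations

variable {A B D : Type} [AddCommGroup A] [AddCommGroup B] [AddCommGroup D]
  {S : LevelOneMHS A} {T : LevelOneMHS B} {U : LevelOneMHS D}

theorem mapQ_add (f g : A →+ B) : mapQ (f + g) = mapQ f + mapQ g :=
  LinearMap.baseChange_add (A := ℚ) f.toIntLinearMap g.toIntLinearMap

theorem mapC_add (f g : A →+ B) : mapC (f + g) = mapC f + mapC g :=
  LinearMap.baseChange_add (A := ℂ) f.toIntLinearMap g.toIntLinearMap

theorem mapQ_neg (f : A →+ B) : mapQ (-f) = -mapQ f :=
  eq_neg_of_add_eq_zero_left (by rw [← mapQ_add, neg_add_cancel, mapQ_zero])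

theorem mapC_neg (f : A →+ B) : mapC (-f) = -mapC f :=
  eq_neg_of_add_eq_zero_left (by rw [← mapC_add, neg_add_cancel, mapC_zero])

namespace LevelOneMHS.IsHom

theorem add {f g : A →+ B} (hf : S.IsHom T f) (hg : S.IsHom T g) : S.IsHom T (f + g) where
  W₂ := by rw [mapQ_add]; exact fun x hx => T.W₂.add_mem (hf.W₂ hx) (hg.W₂ hx)
  W₁ := by rw [mapQ_add]; exact fun x hx => T.W₁.add_mem (hf.W₁ hx) (hg.W₁ hx)
  F₀ := by rw [mapC_add]; exact fun x hx => T.F₀.add_mem (hf.F₀ hx) (hg.F₀ hx)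

theorem neg {f : A →+ B} (hf : S.IsHom T f) : S.IsHom T (-f) where
  W₂ := by rw [mapQ_neg]; exact fun x hx => T.W₂.neg_mem (hf.W₂ hx)
  W₁ := by rw [mapQ_neg]; exact fun x hx => T.W₁.neg_mem (hf.W₁ hx)
  F₀ := by rw [mapC_neg]; exact fun x hx => T.F₀.neg_mem (hf.F₀ hx)

/-- For an injective morphism strictness says that the source carries the induced filtrations, so
any homomorphism factoring through it is compatible. -/
theorem lift {f : A →+ B} {k : D →+ B} {l : D →+ A} (hf : S.IsHom T f)
    (hinj : Function.Injective f) (hk : U.IsHom T k) (h : f.comp l = k) : U.IsHom S l := by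
  subst h
  constructor
  · intro x hx
    have h1 := hk.W₂ hx
    rw [mapQ_comp] at h1
    obtain ⟨y, hy, e⟩ := hf.exists_mem_W₂ h1
    rwa [mapQ_injective hinj e] at hy
  · intro x hx
    have h1 := hk.W₁ hx
    rw [mapQ_comp] at h1
    obtain ⟨y, hy, e⟩ := hf.exists_mem_W₁ h1
    rwa [mapQ_injective hinj e] at hy
  · intro x hx
    have h1 := hk.F₀ hx
    rw [mapC_comp] at h1
    obtain ⟨y, hy, e⟩ := hf.exists_mem_F₀ h1
    rwa [mapC_injective hinj e] at hy

theorem desc {f : A →+ B} {k : A →+ D} {l : B →+ D} (hf : S.IsHom T f)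
    (hsurj : Function.Surjective f) (hk : S.IsHom U k) (h : l.comp f = k) : T.IsHom U l := by
  subst h
  constructor
  · intro x hx
    obtain ⟨x, rfl⟩ := mapQ_surjective hsurj x
    obtain ⟨y, hy, e⟩ := hf.exists_mem_W₂ hx
    have h1 := hk.W₂ hy
    rw [mapQ_comp] at h1
    rw [← e]
    exact h1
  · intro x hx
    obtain ⟨x, rfl⟩ := mapQ_surjective hsurj x
    obtain ⟨y, hy, e⟩ := hf.exists_mem_W₁ hx
    have h1 := hk.W₁ hy
    rw [mapQ_comp] at h1
    rw [← e]
    exact h1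
  · intro x hx
    obtain ⟨x, rfl⟩ := mapC_surjective hsurj x
    obtain ⟨y, hy, e⟩ := hf.exists_mem_F₀ hx
    have h1 := hk.F₀ hy
    rw [mapC_comp] at h1
    rw [← e]
    exact h1

/-- The kernel of a morphism of mixed Hodge structures. -/
def kernel {i : A →+ B} {f : B →+ D} (hf : T.IsHom U f) (hi : Function.Injective i)
    (hex : Function.Exact i f) : LevelOneMHS A :=
  LevelOneMHS.induced (fun _ : Unit => T) (fun _ => i)
    (fun x hx => mapC_injective hi ((hx ()).trans (map_zero _).symm)) (by
      -- The projections of `T` preserve the kernel of `mapC f`, which is the image of `mapC i`; the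
      -- retraction `r` transports them back to `A ⊗ ℂ`.
      obtain ⟨r, hr⟩ := (mapC i).exists_leftInverse_of_injective
        (LinearMap.ker_eq_bot.2 (mapC_injective hi))
      refine ⟨fun j => r ∘ₗ T.proj j ∘ₗ mapC i, fun _ j x => ?_⟩
      have h0 : mapC f (T.proj j (mapC i x)) = 0 := by
        rw [← hf.mapC_proj, (mapC_exact hex _).2 ⟨x, rfl⟩, map_zero]
      obtain ⟨y, hy⟩ := (mapC_exact hex _).1 h0
      rw [LinearMap.comp_apply, LinearMap.comp_apply, ← hy]
      exact congrArg (mapC i) (LinearMap.congr_fun hr y))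

section

variable {i : A →+ B} {f : B →+ D} (hf : T.IsHom U f) (hi : Function.Injective i)
  (hex : Function.Exact i f)

theorem kernel_W₂ : (hf.kernel hi hex).W₂ = T.W₂.comap (mapQ i) := iInf_const

theorem kernel_W₁ : (hf.kernel hi hex).W₁ = T.W₁.comap (mapQ i) := iInf_const

theorem kernel_F₀ : (hf.kernel hi hex).F₀ = T.F₀.comap (mapC i) := iInf_const

theorem kernel_isHom : (hf.kernel hi hex).IsHom T i where
  W₂ := (kernel_W₂ hf hi hex).le
  W₁ := (kernel_W₁ hf hi hex).le
  F₀ := (kernel_F₀ hf hi hex).le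

end

end LevelOneMHS.IsHom

end HomOperations

/-! ### Pointwise exactness, universal properties and kernels -/

namespace FHS₁

variable {X Y Z T : FHS₁}

/-- Injectivity on all components. -/
structure PointwiseMono (φ : X ⟶ Y) : Prop where
  f : Mono φ.f
  g : Function.Injective φ.g

/-- Surjectivity on all components. -/
structure PointwiseEpi (φ : X ⟶ Y) : Prop where
  f : Epi φ.f
  g : Function.Surjective φ.g

/-- Exactness on all components. -/
structure PointwiseExact (φ : X ⟶ Y) (ψ : Y ⟶ Z) : Prop where
  zero : φ ≫ ψ = 0
  f : (ShortComplex.mk φ.f ψ.f (congrArg Hom.f zero)).Exact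
  g : Function.Exact φ.g ψ.g

theorem PointwiseMono.etaleMap_injective {φ : X ⟶ Y} (h : PointwiseMono φ) :
    Function.Injective (FormalGroup.etaleMap φ.f) := (FormalGroup.mono_iff _).1 h.f _

theorem PointwiseEpi.etaleMap_surjective {φ : X ⟶ Y} (h : PointwiseEpi φ) :
    Function.Surjective (FormalGroup.etaleMap φ.f) := (FormalGroup.epi_iff _).1 h.f _

theorem PointwiseExact.etaleMap_exact {φ : X ⟶ Y} {ψ : Y ⟶ Z} (h : PointwiseExact φ ψ) :
    Function.Exact (FormalGroup.etaleMap φ.f) (FormalGroup.etaleMap ψ.f) :=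
  (FormalGroup.exact_iff _).1 h.f _

theorem PointwiseMono.mono {φ : X ⟶ Y} (h : PointwiseMono φ) : Mono φ where
  right_cancellation a b hab := by
    have := h.f
    refine hom_ext ((cancel_mono φ.f).1 (congrArg Hom.f hab)) (LinearMap.ext fun x => h.g ?_)
    exact LinearMap.congr_fun (congrArg Hom.g hab) x

theorem PointwiseEpi.epi {φ : X ⟶ Y} (h : PointwiseEpi φ) : Epi φ where
  left_cancellation a b hab := by
    have := h.f
    refine hom_ext ((cancel_epi φ.f).1 (congrArg Hom.f hab)) (LinearMap.ext fun x => ?_)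
    obtain ⟨x, rfl⟩ := h.g x
    exact LinearMap.congr_fun (congrArg Hom.g hab) x

/-- A lift on both components is automatically a morphism: strictness of `φ` handles the
filtrations, and compatibility with `v` can be checked after the injection of vector groups. -/
theorem PointwiseMono.exists_lift {φ : X ⟶ Y} (h : PointwiseMono φ) (k : T ⟶ Y)
    (lf : T.H ⟶ X.H) (hf : lf ≫ φ.f = k.f) (lg : T.V →ₗ[ℂ] X.V) (hg : φ.g ∘ₗ lg = k.g) :
    ∃ l : T ⟶ X, l ≫ φ = k := by
  refine ⟨homMk lf lg (φ.isHom.lift h.etaleMap_injective k.isHom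
    (congrArg FormalGroup.etaleMap hf)) (fun x hx => ?_) ?_, hom_ext hf hg⟩
  · have h1 : φ.g (lg x) ∈ Y.V₀ := by
      rw [← LinearMap.comp_apply, hg]
      exact k.map_V₀ hx
    obtain ⟨y, hy, e⟩ := exists_mem_V₀ φ h1
    rwa [h.g e] at hy
  · have := mono_vectorGroupMap h.g
    rw [← cancel_mono (vectorGroupMap φ.g), Category.assoc, Category.assoc, ← φ.comm,
      ← vectorGroupMap_comp, hg, ← k.comm, ← hf]
    rfl

theorem PointwiseEpi.exists_desc {φ : X ⟶ Y} (h : PointwiseEpi φ) (k : X ⟶ T)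
    (lf : Y.H ⟶ T.H) (hf : φ.f ≫ lf = k.f) (lg : Y.V →ₗ[ℂ] T.V) (hg : lg ∘ₗ φ.g = k.g) :
    ∃ l : Y ⟶ T, φ ≫ l = k := by
  refine ⟨homMk lf lg (φ.isHom.desc h.etaleMap_surjective k.isHom
    (congrArg FormalGroup.etaleMap hf)) (fun x hx => ?_) ?_, hom_ext hf hg⟩
  · obtain ⟨x, rfl⟩ := h.g x
    obtain ⟨y, hy, e⟩ := exists_mem_V₀ φ hx
    rw [Submodule.mem_comap, ← e, ← LinearMap.comp_apply, hg]
    exact k.map_V₀ hy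
  · have : Epi φ.f.hom := (epi_iff_pointwise _).2 ((FormalGroup.epi_iff _).1 h.f)
    rw [← cancel_epi φ.f.hom, ← Category.assoc φ.f.hom Y.v, φ.comm, Category.assoc,
      ← vectorGroupMap_comp, hg, ← k.comm, ← hf]
    rfl

/-- A pointwise kernel is a kernel. -/
theorem isLimit_of_pointwise {φ : X ⟶ Y} {ψ : Y ⟶ Z} (hφ : PointwiseMono φ)
    (h : PointwiseExact φ ψ) : Nonempty (IsLimit (KernelFork.ofι φ h.zero)) := by
  have := hφ.f
  have := hφ.mono
  have key {T : FHS₁} (k : T ⟶ Y) (hk : k ≫ ψ = 0) : ∃ l : T ⟶ X, l ≫ φ = k := by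
    let e := LinearEquiv.ofInjective φ.g hφ.g
    have hr (x : T.V) : k.g x ∈ LinearMap.range φ.g :=
      (h.g _).1 (LinearMap.congr_fun (congrArg Hom.g hk) x)
    refine hφ.exists_lift k (h.f.lift k.f (congrArg Hom.f hk)) (h.f.lift_f _ _)
      (e.symm.toLinearMap ∘ₗ k.g.codRestrict _ hr) (LinearMap.ext fun x => ?_)
    exact congrArg Subtype.val (e.apply_symm_apply ⟨k.g x, hr x⟩)
  exact ⟨KernelFork.IsLimit.ofι' φ h.zero fun k hk => ⟨(key k hk).choose, (key k hk).choose_spec⟩⟩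

/-- A pointwise cokernel is a cokernel. -/
theorem isColimit_of_pointwise {φ : X ⟶ Y} {ψ : Y ⟶ Z} (hψ : PointwiseEpi ψ)
    (h : PointwiseExact φ ψ) : Nonempty (IsColimit (CokernelCofork.ofπ ψ h.zero)) := by
  have := hψ.f
  have := hψ.epi
  have key {T : FHS₁} (k : Y ⟶ T) (hk : φ ≫ k = 0) : ∃ l : Z ⟶ T, ψ ≫ l = k := by
    obtain ⟨s, hs⟩ := ψ.g.exists_rightInverse_of_surjective (LinearMap.range_eq_top.2 hψ.g)
    refine hψ.exists_desc k (h.f.desc k.f (congrArg Hom.f hk)) (h.f.g_desc _ _)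
      (k.g ∘ₗ s) (LinearMap.ext fun x => ?_)
    have h1 : ψ.g (s (ψ.g x) - x) = 0 := by
      rw [map_sub, sub_eq_zero]
      exact LinearMap.congr_fun hs _
    obtain ⟨y, hy⟩ := (h.g _).1 h1
    change k.g (s (ψ.g x)) = k.g x
    rw [← sub_eq_zero, ← map_sub, ← hy]
    exact LinearMap.congr_fun (congrArg Hom.g hk) y
  exact ⟨CokernelCofork.IsColimit.ofπ' ψ h.zero fun k hk =>
    ⟨(key k hk).choose, (key k hk).choose_spec⟩⟩

/-- The kernels of `f` and `g` are taken separately, with induced filtrations. The point is that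
`ker g` is still generated by the image of `ker f` and `V⁰`, which is where strictness enters. -/
theorem exists_kernel (φ : X ⟶ Y) :
    ∃ (K : FHS₁) (ι : K ⟶ X), PointwiseMono ι ∧ PointwiseExact ι φ := by
  let i : kernel φ.f ⟶ X.H := kernel.ι φ.f
  have hi : i ≫ φ.f = 0 := kernel.condition φ.f
  have hex : (ShortComplex.mk i φ.f hi).Exact := ShortComplex.exact_kernel φ.f
  have hinj : Function.Injective (FormalGroup.etaleMap i) :=
    (FormalGroup.mono_iff i).1 inferInstance _
  have hex' : Function.Exact (FormalGroup.etaleMap i) (FormalGroup.etaleMap φ.f) :=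
    (FormalGroup.exact_iff _).1 hex _
  let s : LinearMap.ker φ.g →ₗ[ℂ] X.V := (LinearMap.ker φ.g).subtype
  have hs : Function.Injective s := Subtype.val_injective
  have hsg : Function.Exact s φ.g := LinearMap.exact_subtype_ker_map φ.g
  obtain ⟨w, hw⟩ := exact_vectorGroupMap hsg
  have := mono_vectorGroupMap hs
  have hv : (i.hom ≫ X.v) ≫ vectorGroupMap φ.g = 0 := by
    rw [Category.assoc, ← φ.comm, ← Category.assoc]
    exact (congrArg (fun k : kernel φ.f ⟶ Y.H => k.hom ≫ Y.v) hi).trans zero_comp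
  let v : (kernel φ.f).obj ⟶ vectorGroup (LinearMap.ker φ.g) := hw.lift (i.hom ≫ X.v) hv
  have comm : i.hom ≫ X.v = v ≫ vectorGroupMap s := (hw.lift_f _ _).symm
  have hvC (z : ℂ ⊗[ℤ] (kernel φ.f).etalePart) :
      X.vC (mapC (FormalGroup.etaleMap i) z) = valueC v z := valueC_comp comm z
  let S := φ.isHom.kernel hinj hex'
  have hS : S.IsHom X.mhs (FormalGroup.etaleMap i) := φ.isHom.kernel_isHom hinj hex'
  have hF : S.F₀ = X.mhs.F₀.comap (mapC (FormalGroup.etaleMap i)) := φ.isHom.kernel_F₀ hinj hex'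
  have hW : S.W₂ = X.mhs.W₂.comap (mapQ (FormalGroup.etaleMap i)) := φ.isHom.kernel_W₂ hinj hex'
  let K : FHS₁ := ofCore (kernel φ.f) S (LinearMap.ker φ.g) (X.V₀.comap s) (X.V₁.comap s) v
    (fun z => by
      rw [Submodule.mem_comap, hF, Submodule.mem_comap, ← vC_mem_V₀, hvC]
      rfl)
    (fun x => by
      obtain ⟨z, w, hw, e⟩ := X.exists_vC_add x
      have h0 : Y.vC (mapC (FormalGroup.etaleMap φ.f) z) + φ.g w = 0 := by
        rw [vC_mapC, ← map_add, e]
        exact x.2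
      have h1 : mapC (FormalGroup.etaleMap φ.f) z ∈ Y.mhs.F₀ := by
        rw [← vC_mem_V₀, eq_neg_of_add_eq_zero_left h0]
        exact Y.V₀.neg_mem (φ.map_V₀ hw)
      -- Writing `x = vC z + w`, the image of `z` lies in `F⁰`; by strictness it is the image of
      -- some `y` in `F⁰`. Then `z - y` comes from the kernel, and `vC y` is absorbed into `V⁰`.
      obtain ⟨y, hy, e'⟩ := φ.isHom.exists_mem_F₀ h1
      obtain ⟨z', hz'⟩ := (mapC_exact hex' (z - y)).1 (by rw [map_sub, e', sub_self])
      refine ⟨z', x - valueC v z', ?_, add_sub_cancel _ _⟩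
      have h2 : s (x - valueC v z') = w + X.vC y := by
        rw [map_sub]
        change (x : X.V) - (valueC v z' : X.V) = _
        rw [← hvC, hz', map_sub, ← e]
        abel
      rw [Submodule.mem_comap, h2]
      exact X.V₀.add_mem hw (X.vC_mem_V₀.2 hy))
    (fun x => by
      constructor
      · intro hx
        obtain ⟨z, hz, w, hw, e⟩ := X.mem_V₁.1 hx
        have h0 : Y.vC (mapC (FormalGroup.etaleMap φ.f) z) + φ.g w = 0 := by
          rw [vC_mapC, ← map_add, e]
          exact x.2
        have h1 : mapC (FormalGroup.etaleMap φ.f) z ∈ Y.mhs.F₀ := by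
          rw [← vC_mem_V₀, eq_neg_of_add_eq_zero_left h0]
          exact Y.V₀.neg_mem (φ.map_V₀ hw)
        -- Here no correction is needed: the image of `z` lies in `F⁰ ∩ W₋₂ = 0`, so `z` already
        -- comes from the kernel.
        obtain ⟨z', rfl⟩ := (mapC_exact hex' z).1
          (LevelOneMHS.eq_zero_of_mem_F₀_of_mem_W₂ h1 (φ.isHom.complexify_W₂ hz))
        refine ⟨z', ?_, x - valueC v z', ?_, add_sub_cancel _ _⟩
        · rw [hW, complexify_comap]
          exact hz
        · have h2 : s (x - valueC v z') = w := by
            rw [map_sub]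
            change (x : X.V) - (valueC v z' : X.V) = _
            rw [← hvC, sub_eq_iff_eq_add']
            exact e.symm
          rw [Submodule.mem_comap, h2]
          exact hw
      · rintro ⟨z, hz, w, hw, rfl⟩
        rw [hW, complexify_comap] at hz
        refine X.mem_V₁.2 ⟨_, hz, s w, hw, ?_⟩
        rw [hvC]
        rfl)
  let ι : K ⟶ X := homMk (X := K) i s hS le_rfl comm
  have hι : ι ≫ φ = 0 := hom_ext hi (LinearMap.ext fun x => x.2)
  exact ⟨K, ι, ⟨inferInstanceAs (Mono (kernel.ι φ.f)), hs⟩, ⟨hι, hex, hsg⟩⟩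

end FHS₁

/-! ### Cokernels, additive structure and finite products -/

namespace FHS₁

variable {X Y Z T : FHS₁}

/-- All filtrations are images. That `F⁰` of the quotient is exactly the preimage of `V⁰` uses that
the source's `V` is generated by its lattice and its `V⁰`. -/
theorem exists_cokernel (φ : X ⟶ Y) :
    ∃ (C : FHS₁) (π : Y ⟶ C), PointwiseEpi π ∧ PointwiseExact φ π := by
  let p : Y.H ⟶ cokernel φ.f := cokernel.π φ.f
  have hp : φ.f ≫ p = 0 := cokernel.condition φ.f
  have hex : (ShortComplex.mk φ.f p hp).Exact := ShortComplex.exact_cokernel φ.f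
  have hsurj : Function.Surjective (FormalGroup.etaleMap p) :=
    (FormalGroup.epi_iff p).1 inferInstance _
  have hex' : Function.Exact (FormalGroup.etaleMap φ.f) (FormalGroup.etaleMap p) :=
    (FormalGroup.exact_iff _).1 hex _
  have hpepi : Epi p.hom := (epi_iff_pointwise _).2 ((FormalGroup.epi_iff p).1 inferInstance)
  have hexF : (ShortComplex.mk φ.f.hom p.hom (congrArg (fun k => k.hom) hp)).Exact :=
    (exact_iff_pointwise _).2 ((FormalGroup.exact_iff _).1 hex)
  let q : Y.V →ₗ[ℂ] Y.V ⧸ LinearMap.range φ.g := (LinearMap.range φ.g).mkQ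
  have hq : Function.Surjective q := Submodule.mkQ_surjective _
  have hgq : Function.Exact φ.g q := LinearMap.exact_map_mkQ_range φ.g
  have hv : φ.f.hom ≫ Y.v ≫ vectorGroupMap q = 0 := by
    rw [← Category.assoc, φ.comm, Category.assoc, ← vectorGroupMap_comp,
      hgq.linearMap_comp_eq_zero, vectorGroupMap_zero, comp_zero]
  let v : (cokernel φ.f).obj ⟶ vectorGroup (Y.V ⧸ LinearMap.range φ.g) := hexF.desc _ hv
  have comm : p.hom ≫ v = Y.v ≫ vectorGroupMap q := hexF.g_desc _ _
  have hvC (z : ℂ ⊗[ℤ] Y.H.etalePart) :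
      valueC v (mapC (FormalGroup.etaleMap p) z) = q (Y.vC z) := valueC_comp comm z
  have hfC (z : ℂ ⊗[ℤ] X.H.etalePart) :
      mapC (FormalGroup.etaleMap p) (mapC (FormalGroup.etaleMap φ.f) z) = 0 :=
    (mapC_exact hex' _).2 ⟨z, rfl⟩
  let S := φ.isHom.quotient hsurj hex'
  have hF : S.F₀ = Y.mhs.F₀.map (mapC (FormalGroup.etaleMap p)) := rfl
  have hW : S.W₂ = Y.mhs.W₂.map (mapQ (FormalGroup.etaleMap p)) := rfl
  have hW₁ : S.W₁ = Y.mhs.W₁.map (mapQ (FormalGroup.etaleMap p)) := rfl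
  have hS : Y.mhs.IsHom S (FormalGroup.etaleMap p) :=
    ⟨hW ▸ Submodule.le_comap_map _ _, hW₁ ▸ Submodule.le_comap_map _ _,
      hF ▸ Submodule.le_comap_map _ _⟩
  let C : FHS₁ := ofCore (cokernel φ.f) S (Y.V ⧸ LinearMap.range φ.g) (Y.V₀.map q) (Y.V₁.map q) v
    (fun z => by
      obtain ⟨z, rfl⟩ := mapC_surjective hsurj z
      rw [hvC, hF]
      constructor
      · rintro ⟨w, hw, e⟩
        obtain ⟨x, hx⟩ := (hgq (Y.vC z - w)).1 (by rw [map_sub, e, sub_self])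
        -- The error in the image of `g` splits as a value of `f(a)` plus `g(b)`. Subtracting `f(a)`
        -- does not change the class in the cokernel, and `g(b)` lies in `V⁰`, so the corrected `z`
        -- is in `F⁰`.
        obtain ⟨a, b, hb, rfl⟩ := X.exists_vC_add x
        refine ⟨z - mapC (FormalGroup.etaleMap φ.f) a, ?_, by rw [map_sub, hfC, sub_zero]⟩
        have h1 : Y.vC (z - mapC (FormalGroup.etaleMap φ.f) a) = w + φ.g b := by
          rw [map_add, ← vC_mapC] at hx
          rw [map_sub, sub_eq_iff_eq_add', ← add_assoc, add_right_comm, hx, sub_add_cancel]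
        rw [SetLike.mem_coe, ← vC_mem_V₀, h1]
        exact Y.V₀.add_mem hw (φ.map_V₀ hb)
      · rintro ⟨y, hy, e⟩
        rw [← hvC, ← e, hvC]
        exact ⟨_, Y.vC_mem_V₀.2 hy, rfl⟩)
    (fun x => by
      obtain ⟨x, rfl⟩ := hq x
      obtain ⟨z, w, hw, rfl⟩ := Y.exists_vC_add x
      exact ⟨mapC (FormalGroup.etaleMap p) z, q w, ⟨w, hw, rfl⟩, by rw [hvC, map_add]⟩)
    (fun x => by
      rw [hW, complexify_map]
      constructor
      · rintro ⟨x, hx, rfl⟩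
        obtain ⟨z, hz, w, hw, rfl⟩ := Y.mem_V₁.1 hx
        exact ⟨_, ⟨z, hz, rfl⟩, q w, ⟨w, hw, rfl⟩, by rw [hvC, map_add]⟩
      · rintro ⟨_, ⟨z, hz, rfl⟩, _, ⟨w, hw, rfl⟩, rfl⟩
        exact ⟨_, Y.mem_V₁.2 ⟨z, hz, w, hw, rfl⟩, by rw [hvC, map_add]⟩)
  let π : Y ⟶ C := homMk (Y := C) p q hS (Submodule.le_comap_map _ _) comm
  have hπ : φ ≫ π = 0 := hom_ext hp hgq.linearMap_comp_eq_zero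
  exact ⟨C, π, ⟨inferInstanceAs (Epi (cokernel.π φ.f)), hq⟩, ⟨hπ, hex, hgq⟩⟩

section Preadditive

instance : Add (X ⟶ Y) where
  add φ ψ := homMk (φ.f + ψ.f) (φ.g + ψ.g) (φ.isHom.add ψ.isHom)
    (fun _ hx => Y.V₀.add_mem (φ.map_V₀ hx) (ψ.map_V₀ hx)) (by
      rw [vectorGroupMap_add, Preadditive.comp_add, ← φ.comm, ← ψ.comm, ← Preadditive.add_comp]
      rfl)

instance : Neg (X ⟶ Y) where
  neg φ := homMk (-φ.f) (-φ.g) φ.isHom.neg (fun _ hx => Y.V₀.neg_mem (φ.map_V₀ hx)) (by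
      rw [vectorGroupMap_neg, Preadditive.comp_neg, ← φ.comm, ← Preadditive.neg_comp]
      rfl)

instance : AddCommGroup (X ⟶ Y) where
  add_assoc φ ψ χ := hom_ext (add_assoc φ.f ψ.f χ.f) (add_assoc φ.g ψ.g χ.g)
  zero_add φ := hom_ext (zero_add φ.f) (zero_add φ.g)
  add_zero φ := hom_ext (add_zero φ.f) (add_zero φ.g)
  add_comm φ ψ := hom_ext (add_comm φ.f ψ.f) (add_comm φ.g ψ.g)
  neg_add_cancel φ := hom_ext (neg_add_cancel φ.f) (neg_add_cancel φ.g)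
  nsmul := nsmulRec
  zsmul := zsmulRec

theorem add_comp (φ φ' : X ⟶ Y) (ψ : Y ⟶ Z) : (φ + φ') ≫ ψ = φ ≫ ψ + φ' ≫ ψ :=
  hom_ext (Preadditive.add_comp _ _ _ φ.f φ'.f ψ.f) (LinearMap.comp_add φ.g φ'.g ψ.g)

theorem comp_add (φ : X ⟶ Y) (ψ ψ' : Y ⟶ Z) : φ ≫ (ψ + ψ') = φ ≫ ψ + φ ≫ ψ' :=
  hom_ext (Preadditive.comp_add _ _ _ φ.f ψ.f ψ'.f) (LinearMap.add_comp φ.g ψ'.g ψ.g)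

instance : Preadditive FHS₁ where
  homGroup _ _ := inferInstance
  add_comp _ _ _ := add_comp
  comp_add _ _ _ := comp_add

end Preadditive

section Products

variable {J : Type} [Fintype J] (X : J → FHS₁)

theorem mapC_sum {A B ι : Type} [AddCommGroup A] [AddCommGroup B] (s : Finset ι) (f : ι → A →+ B) :
    mapC (∑ j ∈ s, f j) = ∑ j ∈ s, mapC (f j) := by
  classical
  induction s using Finset.induction_on with
  | empty => exact mapC_zero
  | insert j s hj ih => rw [Finset.sum_insert hj, Finset.sum_insert hj, mapC_add, ih]

/-- The biproduct of formal groups carries the structure induced by its jointly injective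
projections, whose Deligne projections are the componentwise ones; the conditions on `V` hold
coordinate by coordinate. -/
theorem exists_product : ∃ (P : FHS₁) (π : ∀ j, P ⟶ X j), Nonempty (IsLimit (Fan.mk P π)) := by
  classical
  have : HasFiniteBiproducts FormalGroup := Abelian.hasFiniteBiproducts
  let H : FormalGroup := ⨁ fun j => (X j).H
  let p (j : J) : H ⟶ (X j).H := biproduct.π (fun j => (X j).H) j
  let i (j : J) : (X j).H ⟶ H := biproduct.ι (fun j => (X j).H) j
  have hii (j : J) : i j ≫ p j = 𝟙 _ := biproduct.ι_π_self _ j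
  have hij {j k : J} (h : j ≠ k) : i j ≫ p k = 0 := biproduct.ι_π_ne _ h
  have htot : ∑ j, p j ≫ i j = 𝟙 H := biproduct.total
  let a (j : J) := FormalGroup.etaleMap (p j)
  let b (j : J) := FormalGroup.etaleMap (i j)
  have hab (j k : J) (z : ℂ ⊗[ℤ] (X j).H.etalePart) :
      mapC (a k) (mapC (b j) z) = if h : j = k then h ▸ z else 0 := by
    rw [← LinearMap.comp_apply, ← mapC_comp]
    split_ifs with h
    · subst h
      have e : (a j).comp (b j) = AddMonoidHom.id _ := congrArg FormalGroup.etaleMap (hii j)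
      rw [e, mapC_id]
      rfl
    · have e : (a k).comp (b j) = 0 := congrArg FormalGroup.etaleMap (hij h)
      rw [e, mapC_zero]
      rfl
  have inj (z : ℂ ⊗[ℤ] H.etalePart) (hz : ∀ j, mapC (a j) z = 0) : z = 0 := by
    have e : ∑ j, (b j).comp (a j) = AddMonoidHom.id _ := by
      let F : (H ⟶ H) →+ (H.etalePart →+ H.etalePart) :=
        AddMonoidHom.mk' (fun f => FormalGroup.etaleMap f) fun _ _ => rfl
      exact (map_sum F (fun j => p j ≫ i j) Finset.univ).symm.trans (congrArg F htot)
    have h := LinearMap.congr_fun (congrArg mapC e) z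
    rw [mapC_id, mapC_sum, LinearMap.sum_apply] at h
    rw [← LinearMap.id_apply (R := ℂ) z, ← h]
    exact Finset.sum_eq_zero fun j _ => by rw [mapC_comp, LinearMap.comp_apply, hz, map_zero]
  have surj (y : ∀ j, ℂ ⊗[ℤ] (X j).H.etalePart) : ∃ z, ∀ j, mapC (a j) z = y j := by
    refine ⟨∑ j, mapC (b j) (y j), fun k => ?_⟩
    rw [map_sum, Finset.sum_eq_single k]
    · rw [hab, dif_pos rfl]
    · intro j _ hjk
      rw [hab, dif_neg hjk]
    · exact fun h => (h (Finset.mem_univ _)).elim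
  let S : LevelOneMHS H.etalePart := LevelOneMHS.induced (fun j => (X j).mhs) a inj (by
    refine ⟨fun l => ∑ j, mapC (b j) ∘ₗ (X j).mhs.proj l ∘ₗ mapC (a j), fun k l z => ?_⟩
    rw [LinearMap.sum_apply, map_sum, Finset.sum_eq_single k]
    · rw [LinearMap.comp_apply, hab, dif_pos rfl]
      rfl
    · intro j _ hjk
      rw [LinearMap.comp_apply, hab, dif_neg hjk]
    · exact fun h => (h (Finset.mem_univ _)).elim)
  have hF (z : ℂ ⊗[ℤ] H.etalePart) : z ∈ S.F₀ ↔ ∀ j, mapC (a j) z ∈ (X j).mhs.F₀ :=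
    Submodule.mem_iInf _
  have hW (z : ℚ ⊗[ℤ] H.etalePart) : z ∈ S.W₂ ↔ ∀ j, mapQ (a j) z ∈ (X j).mhs.W₂ :=
    Submodule.mem_iInf _
  have hW₁ (z : ℚ ⊗[ℤ] H.etalePart) : z ∈ S.W₁ ↔ ∀ j, mapQ (a j) z ∈ (X j).mhs.W₁ :=
    Submodule.mem_iInf _
  have hWC (z : ℂ ⊗[ℤ] H.etalePart) :
      z ∈ complexify S.W₂ ↔ ∀ j, mapC (a j) z ∈ complexify (X j).mhs.W₂ := by
    change z ∈ complexify (⨅ j, ((X j).mhs.W₂).comap (mapQ (a j))) ↔ _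
    simp only [complexify_iInf, complexify_comap, Submodule.mem_iInf, Submodule.mem_comap]
  let s (j : J) : (X j).V →ₗ[ℂ] ∀ j, (X j).V := LinearMap.single ℂ (fun j => (X j).V) j
  let v : H.obj ⟶ vectorGroup (∀ j, (X j).V) :=
    ∑ j, (p j).hom ≫ (X j).v ≫ vectorGroupMap (s j)
  have comm (k : J) : (p k).hom ≫ (X k).v = v ≫ vectorGroupMap (LinearMap.proj k) := by
    rw [Preadditive.sum_comp, Finset.sum_eq_single k]
    · rw [Category.assoc, Category.assoc, ← vectorGroupMap_comp, LinearMap.proj_comp_single_same,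
        vectorGroupMap_id, Category.comp_id]
    · intro j _ hjk
      rw [Category.assoc, Category.assoc, ← vectorGroupMap_comp,
        LinearMap.proj_comp_single_ne _ _ _ _ hjk.symm, vectorGroupMap_zero, comp_zero, comp_zero]
    · exact fun h => (h (Finset.mem_univ _)).elim
  have hvC (k : J) (z : ℂ ⊗[ℤ] H.etalePart) : (X k).vC (mapC (a k) z) = valueC v z k :=
    valueC_comp (comm k) z
  let P : FHS₁ := ofCore H S (∀ j, (X j).V) (Submodule.pi Set.univ fun j => (X j).V₀)
    (Submodule.pi Set.univ fun j => (X j).V₁) v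
    (fun z => by
      rw [hF, Submodule.mem_pi]
      refine ⟨fun h j => ?_, fun h j _ => ?_⟩
      · rw [← vC_mem_V₀, hvC]
        exact h j trivial
      · rw [← hvC, vC_mem_V₀]
        exact h j)
    (fun x => by
      choose y w hw e using fun j => (X j).exists_vC_add (x j)
      obtain ⟨z, hz⟩ := surj y
      exact ⟨z, w, fun j _ => hw j, funext fun j => by rw [Pi.add_apply, ← hvC, hz, e]⟩)
    (fun x => by
      rw [Submodule.mem_pi]
      constructor
      · intro hx
        choose y hy w hw e using fun j => (X j).mem_V₁.1 (hx j trivial)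
        obtain ⟨z, hz⟩ := surj y
        exact ⟨z, (hWC z).2 fun j => by rw [hz]; exact hy j, w, fun j _ => hw j,
          funext fun j => by rw [Pi.add_apply, ← hvC, hz, e]⟩
      · rintro ⟨z, hz, w, hw, rfl⟩ j -
        refine (X j).mem_V₁.2 ⟨_, (hWC z).1 hz j, w j, hw j trivial, ?_⟩
        rw [Pi.add_apply, hvC])
  let π (j : J) : P ⟶ X j := homMk (X := P) (p j) (LinearMap.proj j)
    ⟨fun z hz => (hW z).1 hz j, fun z hz => (hW₁ z).1 hz j, fun z hz => (hF z).1 hz j⟩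
    (fun x hx => hx j trivial) (comm j)
  have lift {T : FHS₁} (φ : ∀ j, T ⟶ X j) : ∃ l : T ⟶ P, ∀ j, l ≫ π j = φ j := by
    let lf : T.H ⟶ H := biproduct.lift fun j => (φ j).f
    have hl (j : J) : lf ≫ p j = (φ j).f := biproduct.lift_π _ _
    have hl' (j : J) : (a j).comp (FormalGroup.etaleMap lf) = FormalGroup.etaleMap (φ j).f :=
      congrArg FormalGroup.etaleMap (hl j)
    have hS : T.mhs.IsHom S (FormalGroup.etaleMap lf) := by
      refine ⟨fun z hz => (hW _).2 fun j => ?_, fun z hz => (hW₁ _).2 fun j => ?_,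
        fun z hz => (hF _).2 fun j => ?_⟩
      · rw [← LinearMap.comp_apply, ← mapQ_comp, hl']
        exact (φ j).isHom.W₂ hz
      · rw [← LinearMap.comp_apply, ← mapQ_comp, hl']
        exact (φ j).isHom.W₁ hz
      · rw [← LinearMap.comp_apply, ← mapC_comp, hl']
        exact (φ j).isHom.F₀ hz
    have hv : lf.hom ≫ v = T.v ≫ vectorGroupMap (LinearMap.pi fun j => (φ j).g) := by
      have e : (LinearMap.pi fun j => (φ j).g) = ∑ j, s j ∘ₗ (φ j).g := by
        refine LinearMap.ext fun x => ?_
        rw [LinearMap.sum_apply]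
        exact (Finset.univ_sum_single fun j => (φ j).g x).symm
      rw [e, vectorGroupMap_sum, Preadditive.comp_sum, Preadditive.comp_sum]
      refine Finset.sum_congr rfl fun j _ => ?_
      rw [vectorGroupMap_comp, ← Category.assoc T.v, ← (φ j).comm, ← hl]
      rfl
    exact ⟨homMk (Y := P) lf (LinearMap.pi fun j => (φ j).g) hS
      (fun x hx j _ => (φ j).map_V₀ hx) hv, fun j => hom_ext (hl j) rfl⟩
  have ext {T : FHS₁} {l l' : T ⟶ P} (h : ∀ j, l ≫ π j = l' ≫ π j) : l = l' :=
    hom_ext (biproduct.hom_ext _ _ fun j => congrArg Hom.f (h j))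
      (LinearMap.ext fun x => funext fun j => LinearMap.congr_fun (congrArg Hom.g (h j)) x)
  exact ⟨P, π, ⟨Fan.IsLimit.mk _ (fun c => (lift c.proj).choose)
    (fun c j => (lift c.proj).choose_spec j)
    fun c m hm => ext fun j => (hm j).trans ((lift c.proj).choose_spec j).symm⟩⟩

end Products

end FHS₁

/-! ### Short exactness from kernel-cokernel pairs -/

section ShortExact

open ZeroObject

variable {C : Type*} [Category C] [HasZeroMorphisms C] [HasZeroObject C]

/-- A kernel-cokernel pair is a short exact sequence. -/
theorem shortExact_of_isLimit_of_isColimit (S : ShortComplex C)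
    (hf : IsLimit (KernelFork.ofι S.f S.zero)) (hg : IsColimit (CokernelCofork.ofπ S.g S.zero)) :
    S.ShortExact := by
  -- The first map factors through its own kernel object by the identity, so the cokernel of that
  -- factorization, the left homology, is zero; dually for the right homology.
  have h1 : hf.lift (KernelFork.ofι S.f S.zero) = 𝟙 _ :=
    Fork.IsLimit.hom_ext hf ((Fork.IsLimit.lift_ι hf).trans (Category.id_comp _).symm)
  have h2 : hg.desc (CokernelCofork.ofπ S.g S.zero) = 𝟙 _ :=
    Cofork.IsColimit.hom_ext hg ((Cofork.IsColimit.π_desc hg).trans (Category.comp_id _).symm)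
  let L : S.LeftHomologyData :=
    { K := S.X₁
      H := 0
      i := S.f
      π := 0
      wi := S.zero
      hi := hf
      wπ := comp_zero
      hπ := CokernelCofork.IsColimit.ofπ _ _ (fun _ _ => 0)
        (fun k hk => by
          rw [h1] at hk
          rw [zero_comp, ← Category.id_comp k]
          exact hk.symm)
        (fun _ _ _ _ => (isZero_zero C).eq_of_src _ _) }
  let R : S.RightHomologyData :=
    { Q := S.X₃
      H := 0
      p := S.g
      ι := 0
      wp := S.zero
      hp := hg
      wι := zero_comp
      hι := KernelFork.IsLimit.ofι _ _ (fun _ _ => 0)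
        (fun k hk => by
          rw [h2] at hk
          rw [comp_zero, ← Category.comp_id k]
          exact hk.symm)
        (fun _ _ _ _ => (isZero_zero C).eq_of_tgt _ _) }
  exact
    { exact := ⟨{ left := L, right := R, iso := Iso.refl _, comm := (zero_comp.trans S.zero.symm :) },
        isZero_zero C⟩
      mono_f := mono_of_isLimit_fork hf
      epi_g := epi_of_isColimit_cofork hg }

end ShortExact

namespace MHS₁

instance : HasZeroObject MHS₁ where
  zero := by
    have h (x : ℂ ⊗[ℤ] PUnit.{1}) : x = 0 := Subsingleton.elim _ _
    let Z : MHS₁ :=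
      { carrier := PUnit
        str := LevelOneMHS.induced (J := PEmpty) (B := fun _ => PUnit) (fun j => j.elim)
          (fun j => j.elim) (fun x _ => h x) ⟨0, fun j => j.elim⟩ }
    refine ⟨Z, fun Y => ⟨⟨⟨0⟩, fun f => Hom.ext (AddMonoidHom.ext fun x => ?_)⟩⟩,
      fun Y => ⟨⟨⟨0⟩, fun f => Hom.ext (AddMonoidHom.ext fun x => ?_)⟩⟩⟩
    · exact f.hom.map_zero
    · rfl

/-- Strictness upgrades exactness of groups to the universal properties of kernel and cokernel,
without `MHS₁` having to be known to be abelian. -/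
theorem shortExact_of_exact (S : ShortComplex MHS₁) (hf : Function.Injective S.f.hom)
    (h : Function.Exact S.f.hom S.g.hom) (hg : Function.Surjective S.g.hom) : S.ShortExact := by
  have : Mono S.f := ⟨fun a b e => Hom.ext (AddMonoidHom.ext fun x =>
    hf (DFunLike.congr_fun (congrArg Hom.hom e) x))⟩
  have : Epi S.g := ⟨fun a b e => Hom.ext ((AddMonoidHom.cancel_right hg).1 (congrArg Hom.hom e))⟩
  refine shortExact_of_isLimit_of_isColimit S (KernelFork.IsLimit.ofι' S.f S.zero fun {T} k hk => ?_)
    (CokernelCofork.IsColimit.ofπ' S.g S.zero fun {T} k hk => ?_)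
  · have hr (x : T.carrier) : k.hom x ∈ S.f.hom.range :=
      (h _).1 (DFunLike.congr_fun (congrArg Hom.hom hk) x)
    let l : T.carrier →+ S.X₁.carrier :=
      (AddMonoidHom.ofInjective hf).symm.toAddMonoidHom.comp (k.hom.codRestrict _ hr)
    have hl : S.f.hom.comp l = k.hom := AddMonoidHom.ext fun x =>
      congrArg Subtype.val ((AddMonoidHom.ofInjective hf).apply_symm_apply ⟨k.hom x, hr x⟩)
    exact ⟨⟨l, S.f.isHom.lift hf k.isHom hl⟩, Hom.ext hl⟩
  · let l : S.X₃.carrier →+ T.carrier := AddMonoidHom.liftOfSurjective S.g.hom hg ⟨k.hom, fun y hy => by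
      obtain ⟨x, rfl⟩ := (h y).1 hy
      exact DFunLike.congr_fun (congrArg Hom.hom hk) x⟩
    have hl : l.comp S.g.hom = k.hom := AddMonoidHom.liftOfRightInverse_comp _ _ _ _
    exact ⟨⟨l, S.g.isHom.desc hg k.isHom hl⟩, Hom.ext hl⟩

end MHS₁

/-! ### The abelian structure and the characterization of short exact sequences -/

namespace FHS₁

variable {X Y Z : FHS₁}

/-- It suffices that a pointwise kernel factors through `φ`; categorical exactness provides such a
factorization. -/
theorem pointwiseExact_of_factors {K : FHS₁} {φ : X ⟶ Y} {ψ : Y ⟶ Z} {ι : K ⟶ Y} (l : K ⟶ X)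
    (hl : l ≫ φ = ι) (hι : PointwiseExact ι ψ) (h : φ ≫ ψ = 0) : PointwiseExact φ ψ := by
  subst hl
  refine ⟨h, (FormalGroup.exact_iff _).2 fun R y => ⟨fun hy => ?_, ?_⟩, fun y => ⟨fun hy => ?_, ?_⟩⟩
  · obtain ⟨x, hx⟩ := ((FormalGroup.exact_iff _).1 hι.f R y).1 hy
    exact ⟨(l.f.hom.app R).hom x, hx⟩
  · rintro ⟨x, rfl⟩
    exact congrArg (fun k : X ⟶ Z => (k.f.hom.app R).hom x) h
  · obtain ⟨x, hx⟩ := (hι.g y).1 hy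
    exact ⟨l.g x, hx⟩
  · rintro ⟨x, rfl⟩
    exact congrArg (fun k : X ⟶ Z => k.g x) h

/-- The pointwise kernel of a monomorphism has zero inclusion, and pointwise exactness then reads as
injectivity on each component. -/
theorem pointwiseMono_of_mono (φ : X ⟶ Y) [Mono φ] : PointwiseMono φ := by
  obtain ⟨K, ι, -, h⟩ := exists_kernel φ
  have hι : ι = 0 := zero_of_comp_mono φ h.zero
  subst hι
  refine ⟨(FormalGroup.mono_iff _).2 fun R => (injective_iff_map_eq_zero _).2 fun x hx => ?_,
    (injective_iff_map_eq_zero _).2 fun x hx => ?_⟩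
  · obtain ⟨y, rfl⟩ := ((FormalGroup.exact_iff _).1 h.f R x).1 hx
    rfl
  · obtain ⟨y, rfl⟩ := (h.g x).1 hx
    rfl

theorem pointwiseEpi_of_epi (φ : X ⟶ Y) [Epi φ] : PointwiseEpi φ := by
  obtain ⟨C, π, -, h⟩ := exists_cokernel φ
  have hπ : π = 0 := zero_of_epi_comp φ h.zero
  subst hπ
  exact ⟨(FormalGroup.epi_iff _).2 fun R x => ((FormalGroup.exact_iff _).1 h.f R x).1 rfl,
    fun x => (h.g x).1 rfl⟩

instance : HasKernels FHS₁ where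
  has_limit φ := by
    obtain ⟨K, ι, hι, h⟩ := exists_kernel φ
    exact ⟨⟨⟨_, (isLimit_of_pointwise hι h).some⟩⟩⟩

instance : HasCokernels FHS₁ where
  has_colimit φ := by
    obtain ⟨C, π, hπ, h⟩ := exists_cokernel φ
    exact ⟨⟨⟨_, (isColimit_of_pointwise hπ h).some⟩⟩⟩

instance : HasFiniteProducts FHS₁ where
  out n :=
    { has_limit := fun F => by
        obtain ⟨P, π, ⟨h⟩⟩ := exists_product (F.obj ∘ Discrete.mk)
        have : HasLimit (Discrete.functor (F.obj ∘ Discrete.mk)) := ⟨⟨⟨_, h⟩⟩⟩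
        exact hasLimit_of_iso (Discrete.natIsoFunctor (F := F)).symm }

instance : IsNormalMonoCategory FHS₁ where
  normalMonoOfMono φ := by
    obtain ⟨C, π, -, h⟩ := exists_cokernel φ
    exact ⟨⟨C, π, h.zero, (isLimit_of_pointwise (pointwiseMono_of_mono φ) h).some⟩⟩

instance : IsNormalEpiCategory FHS₁ where
  normalEpiOfEpi φ := by
    obtain ⟨K, ι, -, h⟩ := exists_kernel φ
    exact ⟨⟨K, ι, h.zero, (isColimit_of_pointwise (pointwiseEpi_of_epi φ) h).some⟩⟩

instance : Abelian FHS₁ where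

/-- Short exactness is short exactness of all components. -/
theorem shortExact_iff_pointwise (S : ShortComplex FHS₁) : S.ShortExact ↔
    PointwiseMono S.f ∧ PointwiseExact S.f S.g ∧ PointwiseEpi S.g := by
  constructor
  · intro h
    have := h.mono_f
    have := h.epi_g
    refine ⟨pointwiseMono_of_mono S.f, ?_, pointwiseEpi_of_epi S.g⟩
    obtain ⟨K, ι, -, hι⟩ := exists_kernel S.g
    exact pointwiseExact_of_factors (h.exact.lift ι hι.zero) (h.exact.lift_f ι hι.zero) hι S.zero
  · rintro ⟨hf, h, hg⟩
    exact shortExact_of_isLimit_of_isColimit S (isLimit_of_pointwise hf h).some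
      (isColimit_of_pointwise hg h).some

theorem filteredShortExact_of_pointwise {S : ShortComplex FHS₁} (hf : PointwiseMono S.f)
    (h : PointwiseExact S.f S.g) (hg : PointwiseEpi S.g) : FilteredShortExact S where
  total := ⟨fun x _ hx => hf.g (hx.trans (map_zero _).symm),
    fun y _ => (h.g y).trans ⟨fun ⟨x, hx⟩ => ⟨x, trivial, hx⟩, fun ⟨x, _, hx⟩ => ⟨x, hx⟩⟩,
    fun z _ => (hg.g z).imp fun y hy => ⟨trivial, hy⟩⟩
  step₁ := by
    refine ⟨fun x _ hx => hf.g (hx.trans (map_zero _).symm), fun y hy =>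
      ⟨fun h0 => ?_, fun ⟨x, _, hx⟩ => (h.g y).2 ⟨x, hx⟩⟩, fun z hz => ?_⟩
    · obtain ⟨x, rfl⟩ := (h.g y).1 h0
      exact exists_mem_V₁ S.f hy
    · obtain ⟨y, rfl⟩ := hg.g z
      exact exists_mem_V₁ S.g hz
  step₀ := by
    refine ⟨fun x _ hx => hf.g (hx.trans (map_zero _).symm), fun y hy =>
      ⟨fun h0 => ?_, fun ⟨x, _, hx⟩ => (h.g y).2 ⟨x, hx⟩⟩, fun z hz => ?_⟩
    · obtain ⟨x, rfl⟩ := (h.g y).1 h0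
      exact exists_mem_V₀ S.f hy
    · obtain ⟨y, rfl⟩ := hg.g z
      exact exists_mem_V₀ S.g hz

theorem shortExact_iff (S : ShortComplex FHS₁) : S.ShortExact ↔
    (S.map toFormalGroup).ShortExact ∧ FilteredShortExact S ∧ (S.map toMHS).ShortExact := by
  rw [shortExact_iff_pointwise]
  constructor
  · rintro ⟨hf, h, hg⟩
    exact ⟨{ exact := h.f, mono_f := hf.f, epi_g := hg.f },
      filteredShortExact_of_pointwise hf h hg,
      MHS₁.shortExact_of_exact _ hf.etaleMap_injective h.etaleMap_exact hg.etaleMap_surjective⟩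
  -- Only exactness of formal groups and of the total vector spaces is used; the filtration steps
  -- and the mixed Hodge structures are determined by these.
  · rintro ⟨h, ⟨hV, -, -⟩, -⟩
    exact ⟨⟨h.mono_f, (injective_iff_map_eq_zero _).2 fun x hx => hV.injective x trivial hx⟩,
      ⟨S.zero, h.exact, fun y => (hV.exact y trivial).trans
        ⟨fun ⟨x, _, hx⟩ => ⟨x, hx⟩, fun ⟨x, hx⟩ => ⟨x, trivial, hx⟩⟩⟩,
      ⟨h.epi_g, fun z => (hV.surjective z trivial).imp fun y hy => hy.2⟩⟩

end FHS₁

end FormalHodge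

end

theorem mainTheorem2 :
    Nonempty (CategoryTheory.Abelian FormalHodge.FHS₁) ∧
    ∀ S : CategoryTheory.ShortComplex FormalHodge.FHS₁,
      S.ShortExact ↔
        (S.map FormalHodge.FHS₁.toFormalGroup).ShortExact ∧
        FormalHodge.FilteredShortExact S ∧
        (S.map FormalHodge.FHS₁.toMHS).ShortExact :=
  ⟨⟨inferInstance⟩, FormalHodge.FHS₁.shortExact_iff⟩
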